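/- Setting. Let $HH^\omega$ be the logic of hereditary Harrop formulas over a user-provided signature of primitive types and typed constants. Its types are built with $\to$ from the primitive types and the type $o$ of formulas. Its formulas are the simply typed $\lambda$-terms (up to $\alpha\beta\eta$) of type $o$ over the signature and the logical constants $\wedge,\Rightarrow\,:o\to o\to o$ and $\forall_\tau:(\tau\to o)\to o$, for every type $\tau$ not containing $o$. Let $\Theta$ be a finite program, that is, a finite list of closed formulas. Let $\mathcal G$ be the intuitionistic sequent calculus over simply typed $\lambda$-terms with $\top,\bot,\wedge,\vee,\supset,\forall_\tau,\exists_\tau$, equality $=_\tau$ (whose left rule has one premise for every unifier), nominal constants and the quantifier $\nabla_\tau$, equivariant identity and cut rules, and stratified inductive definitions by clauses $\forall\bar x.(\nabla\bar z.\,A)\triangleq B$ (with right and left unfolding rules and a rule of simultaneous induction with arbitrary closed invariants). In $\mathcal G$, $o$ is an uninterpreted type whose connectives are constructors, and contexts are terms of the type $olist$ of lists, with constructors $nil$ and $::$. Sequents of $HH^\omega$ are encoded by the predicates $seq$, written $\{L\vdash G\}=seq\;L\;G$ and $\{L,[F]\vdash A\}=bc\;L\;F\;A$, defined by the clauses $$\begin{array}{l}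 \{L\vdash G_1\wedge G_2\}\triangleq\{L\vdash G_1\}\wedge\{L\vdash G_2\},\quad \{L\vdash F\Rightarrow G\}\triangleq\{F::L\vdash G\},\quad \{L\vdash\forall_\tau G\}\triangleq\nabla x{:}\tau.\{L\vdash G\,x\},\\ \{L\vdash A\}\triangleq\exists F.\ atomic\,A\wedge member\,F\,L\wedge\{L,[F]\vdash A\},\quad \{L\vdash A\}\triangleq\exists F.\ atomic\,A\wedge prog\,F\wedge\{L,[F]\vdash A\},\\ \{L,[F_1\wedge F_2]\vdash A\}\triangleq\{L,[F_1]\vdash A\}\vee\{L,[F_2]\vdash A\},\quad \{L,[G\Rightarrow F]\vdash A\}\triangleq\{L\vdash G\}\wedge\{L,[F]\vdash A\},\\ \{L,[\forall_\tau F]\vdash A\}\triangleq\exists t{:}\tau.\{L,[F\,t]\vdash A\},\quad \{L,[A]\vdash A\}\triangleq\top, \end{array}$$ with one clause for each $\tau$ where $\tau$ appears. Here $member$ is list membership, $prog\,F\triangleq\top$ for each $F\in\Theta$, and $atomic\,F$ says that $F$ is not of the form $\forall_\tau G$ (for any $\tau$), $G_1\wedge G_2$ or $G_1\Rightarrow G_2$.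 Theorem 2. For every signature and every program $\Theta$, the following formulas are provable in $\mathcal G$ from this encoding: 1. (cut) $\forall L,F,G.\ \{L\vdash F\}\supset\{F::L\vdash G\}\supset\{L\vdash G\}$; 2. (instantiation) $\forall L,G.\ \nabla x.\ \{L\,x\vdash G\,x\}\supset\forall t.\ \{L\,t\vdash G\,t\}$, where $x,t$ have type $\tau$, $L:\tau\to olist$ and $G:\tau\to o$, for every type $\tau$ of $HH^\omega$ whose target type is not $o$ (in particular for every $\tau$ not containing $o$); 3. (monotonicity) $\forall L,L',G.\ \{L\vdash G\}\supset(\forall F.\ member\,F\,L\supset member\,F\,L')\supset\{L'\vdash G\}$. As usual in $\mathcal G$, the proofs may use auxiliary inductive definitions: stratified, possibly infinite sets of clauses for new predicates, which add no clause to the predicates of the encoding. One choice of these, depending only on the signature and not on $\Theta$, serves for all three formulas. -/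

import Mathlib

namespace TwoLevel

/-! ## Simple types, signatures and terms -/

/-- Simple types over a set `B` of user-declared primitive types.  The type `o` of formulas of the
specification logic is primitive, and so is the type `olist` of lists of such formulas, which exists
only in the reasoning logic.  The type of formulas of the reasoning logic is not listed: no term may
have it in an argument type, so formulas of the reasoning logic form a separate syntactic class. -/
inductive Ty (B : Type) : Type
  | base (b : B) : Ty B
  | o : Ty B
  | olist : Ty B
  | arr (a b : Ty B) : Ty B

/-- The types of the specification logic: those without `olist`. -/
def Ty.IsSpec {B : Type} : Ty B → Prop
  | .base _ => True
  | .o => True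
  | .olist => False
  | .arr a b => a.IsSpec ∧ b.IsSpec

/-- The types over which the specification logic quantifies: its types that do not contain `o`. -/
def Ty.IsQuant {B : Type} : Ty B → Prop
  | .base _ => True
  | .o => False
  | .olist => False
  | .arr a b => a.IsQuant ∧ b.IsQuant

/-- The target (result type) of a type. -/
def Ty.target {B : Type} : Ty B → Ty B
  | .base b => .base b
  | .o => .o
  | .olist => .olist
  | .arr _ b => b.target

/-- A user-provided signature of the specification logic: primitive types other than `o`, and typed
non-logical constants. -/
structure HHSig where
  Base : Type
  Con : Type
  ty : Con → Ty Base
  ty_spec : ∀ c, (ty c).IsSpec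

/-- Typed de Bruijn variables. -/
inductive Var {α : Type} : List α → α → Type
  | z {Γ : List α} {a : α} : Var (a :: Γ) a
  | s {Γ : List α} {a b : α} (v : Var Γ a) : Var (b :: Γ) a

/-- Seen from a longer context `Δ ++ Γ`. -/
def Var.skip {α : Type} {Γ : List α} {a : α} : (Δ : List α) → Var Γ a → Var (Δ ++ Γ) a
  | [], v => v
  | _ :: Δ, v => .s (Var.skip Δ v)

/-- The constants available in terms: the non-logical constants of the signature, the logical
constants of the specification logic (which the reasoning logic treats as constructors of `o`), and
the list constructors. -/
inductive Cst (S : HHSig) : Ty S.Base → Type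
  | user (c : S.Con) : Cst S (S.ty c)
  | conj : Cst S (.arr .o (.arr .o .o))
  | impl : Cst S (.arr .o (.arr .o .o))
  | forall_ (τ : Ty S.Base) (h : τ.IsQuant) : Cst S (.arr (.arr τ .o) .o)
  | nil : Cst S .olist
  | cons : Cst S (.arr .o (.arr .olist .olist))

/-- Simply typed terms.  `Γ` holds the types of the free (eigen)variables; `nom n` at type `τ` is
the `n`-th nominal constant of that type. -/
inductive Tm (S : HHSig) : List (Ty S.Base) → Ty S.Base → Type
  | var {Γ : List (Ty S.Base)} {τ : Ty S.Base} (v : Var Γ τ) : Tm S Γ τ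
  | con {Γ : List (Ty S.Base)} {τ : Ty S.Base} (c : Cst S τ) : Tm S Γ τ
  | nom {Γ : List (Ty S.Base)} {τ : Ty S.Base} (n : ℕ) : Tm S Γ τ
  | app {Γ : List (Ty S.Base)} {σ τ : Ty S.Base} (f : Tm S Γ (.arr σ τ)) (a : Tm S Γ σ) : Tm S Γ τ
  | lam {Γ : List (Ty S.Base)} {σ τ : Ty S.Base} (b : Tm S (σ :: Γ) τ) : Tm S Γ (.arr σ τ)

variable {S : HHSig}

/-! ### Renaming and substitution -/

/-- Renamings. -/
def Ren (Γ Δ : List (Ty S.Base)) : Type := ∀ ⦃τ : Ty S.Base⦄, Var Γ τ → Var Δ τ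

def Ren.lift {Γ Δ : List (Ty S.Base)} {σ : Ty S.Base} (ρ : Ren Γ Δ) : Ren (σ :: Γ) (σ :: Δ)
  | _, .z => .z
  | _, .s v => .s (ρ v)

def Tm.rename : {Γ Δ : List (Ty S.Base)} → {τ : Ty S.Base} → Ren Γ Δ → Tm S Γ τ → Tm S Δ τ
  | _, _, _, ρ, .var v => .var (ρ v)
  | _, _, _, _, .con c => .con c
  | _, _, _, _, .nom n => .nom n
  | _, _, _, ρ, .app f a => .app (f.rename ρ) (a.rename ρ)
  | _, _, _, ρ, .lam b => .lam (b.rename ρ.lift)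

/-- Weakening by one variable. -/
def Tm.shift {Γ : List (Ty S.Base)} {σ τ : Ty S.Base} (t : Tm S Γ τ) : Tm S (σ :: Γ) τ :=
  t.rename (fun _ v => .s v)

variable (S) in
/-- Simultaneous substitutions: a term over `Δ` for every variable of `Γ`.  These also serve as
tuples of terms of types `Γ` (the arguments of an atomic formula). -/
def Sub (Γ Δ : List (Ty S.Base)) : Type := ∀ ⦃τ : Ty S.Base⦄, Var Γ τ → Tm S Δ τ

def Sub.nil {Δ : List (Ty S.Base)} : Sub S [] Δ := fun _ v => nomatch v

def Sub.cons {Γ Δ : List (Ty S.Base)} {σ : Ty S.Base} (t : Tm S Δ σ) (θ : Sub S Γ Δ) :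
    Sub S (σ :: Γ) Δ
  | _, .z => t
  | _, .s v => θ v

/-- The identity substitution. -/
def Sub.id {Γ : List (Ty S.Base)} : Sub S Γ Γ := fun _ v => .var v

/-- The inclusion of the variables of `Γ` into those of `σ :: Γ`. -/
def Sub.wk {Γ : List (Ty S.Base)} {σ : Ty S.Base} : Sub S Γ (σ :: Γ) := fun _ v => .var (.s v)

def Sub.lift {Γ Δ : List (Ty S.Base)} {σ : Ty S.Base} (θ : Sub S Γ Δ) : Sub S (σ :: Γ) (σ :: Δ) :=
  Sub.cons (.var .z) (fun _ v => (θ v).shift)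

/-- Juxtaposition of two substitutions with the same target. -/
def Sub.append {Γ Δ : List (Ty S.Base)} :
    (Z : List (Ty S.Base)) → Sub S Z Δ → Sub S Γ Δ → Sub S (Z ++ Γ) Δ
  | [], _, θ => θ
  | _ :: Z, η, θ => Sub.cons (η .z) (Sub.append Z (fun _ v => η (.s v)) θ)

/-- Capture-avoiding substitution of terms for free variables. -/
def Tm.subst : {Γ Δ : List (Ty S.Base)} → {τ : Ty S.Base} → Sub S Γ Δ → Tm S Γ τ → Tm S Δ τ
  | _, _, _, θ, .var v => θ v
  | _, _, _, _, .con c => .con c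
  | _, _, _, _, .nom n => .nom n
  | _, _, _, θ, .app f a => .app (f.subst θ) (a.subst θ)
  | _, _, _, θ, .lam b => .lam (b.subst θ.lift)

/-- `b[a/x]`, where `x` is the first variable. -/
def Tm.inst {Γ : List (Ty S.Base)} {σ τ : Ty S.Base} (b : Tm S (σ :: Γ) τ) (a : Tm S Γ σ) :
    Tm S Γ τ :=
  b.subst (Sub.cons a Sub.id)

/-- Composition of a tuple of terms with a substitution. -/
def Sub.comp {Γ Δ Ξ : List (Ty S.Base)} (η : Sub S Γ Δ) (θ : Sub S Δ Ξ) : Sub S Γ Ξ :=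
  fun _ v => (η v).subst θ

/-! ### Conversion, nominal constants and permutations -/

/-- Conversion by the rules `β` and `η` (`α` is syntactic identity here). -/
inductive Tm.Conv : {Γ : List (Ty S.Base)} → {τ : Ty S.Base} → Tm S Γ τ → Tm S Γ τ → Prop
  | refl {Γ : List (Ty S.Base)} {τ : Ty S.Base} (t : Tm S Γ τ) : Tm.Conv t t
  | symm {Γ : List (Ty S.Base)} {τ : Ty S.Base} {t u : Tm S Γ τ} : Tm.Conv t u → Tm.Conv u t
  | trans {Γ : List (Ty S.Base)} {τ : Ty S.Base} {t u w : Tm S Γ τ} :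
      Tm.Conv t u → Tm.Conv u w → Tm.Conv t w
  | app {Γ : List (Ty S.Base)} {σ τ : Ty S.Base} {f g : Tm S Γ (.arr σ τ)} {a b : Tm S Γ σ} :
      Tm.Conv f g → Tm.Conv a b → Tm.Conv (.app f a) (.app g b)
  | lam {Γ : List (Ty S.Base)} {σ τ : Ty S.Base} {b c : Tm S (σ :: Γ) τ} :
      Tm.Conv b c → Tm.Conv (.lam b) (.lam c)
  | beta {Γ : List (Ty S.Base)} {σ τ : Ty S.Base} (b : Tm S (σ :: Γ) τ) (a : Tm S Γ σ) :
      Tm.Conv (.app (.lam b) a) (b.inst a)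
  | eta {Γ : List (Ty S.Base)} {σ τ : Ty S.Base} (f : Tm S Γ (.arr σ τ)) :
      Tm.Conv (.lam (.app f.shift (.var .z))) f

variable (S) in
/-- Nominal constants: infinitely many of every type. -/
abbrev Nom : Type := Ty S.Base × ℕ

/-- The nominal constant `a` occurs in a term. -/
def Tm.Occ (a : Nom S) : {Γ : List (Ty S.Base)} → {τ : Ty S.Base} → Tm S Γ τ → Prop
  | _, _, .var _ => False
  | _, _, .con _ => False
  | _, τ, .nom n => a = (τ, n)
  | _, _, .app f b => f.Occ a ∨ b.Occ a
  | _, _, .lam b => b.Occ a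

/-- The nominal constant `a` occurs in one of the terms of a tuple or substitution. -/
def Sub.Occ (a : Nom S) {Γ Δ : List (Ty S.Base)} (θ : Sub S Γ Δ) : Prop :=
  ∃ (τ : Ty S.Base) (v : Var Γ τ), (θ v).Occ a

/-- The variable `v` occurs free in a term. -/
def Tm.HasVar {σ : Ty S.Base} :
    {Γ : List (Ty S.Base)} → {τ : Ty S.Base} → Tm S Γ τ → Var Γ σ → Prop
  | Γ, τ, .var w, v => (⟨τ, w⟩ : Σ τ : Ty S.Base, Var Γ τ) = ⟨σ, v⟩
  | _, _, .con _, _ => False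
  | _, _, .nom _, _ => False
  | _, _, .app f b, v => f.HasVar v ∨ b.HasVar v
  | _, _, .lam b, v => b.HasVar (.s v)

variable (S) in
/-- Type-preserving permutations of the nominal constants.  (A term contains finitely many of them,
so finiteness of the permutation makes no difference to its orbit.) -/
abbrev NPerm : Type := Ty S.Base → Equiv.Perm ℕ

def Tm.perm (π : NPerm S) : {Γ : List (Ty S.Base)} → {τ : Ty S.Base} → Tm S Γ τ → Tm S Γ τ
  | _, _, .var v => .var v
  | _, _, .con c => .con c
  | _, τ, .nom n => .nom (π τ n)
  | _, _, .app f b => .app (f.perm π) (b.perm π)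
  | _, _, .lam b => .lam (b.perm π)

/-- `c₁ → ⋯ → cₙ → τ`, for the types of the nominal constants `cs`. -/
def Ty.raise (cs : List (Nom S)) (τ : Ty S.Base) : Ty S.Base :=
  match cs with
  | [] => τ
  | c :: cs => .arr c.1 (Ty.raise cs τ)

/-- `f c₁ ⋯ cₙ`. -/
def Tm.appNoms {Γ : List (Ty S.Base)} {τ : Ty S.Base} :
    (cs : List (Nom S)) → Tm S Γ (Ty.raise cs τ) → Tm S Γ τ
  | [], f => f
  | c :: cs, f => Tm.appNoms cs (.app f (.nom c.2))

/-! ## The reasoning logic: formulas -/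

variable (S) in
/-- The defined predicates with the types of their arguments. -/
structure Lang where
  Pred : Type
  ar : Pred → List (Ty S.Base)

/-- Formulas of the reasoning logic with free variables in `Γ`. -/
inductive Fm (L : Lang S) : List (Ty S.Base) → Type
  | top {Γ : List (Ty S.Base)} : Fm L Γ
  | bot {Γ : List (Ty S.Base)} : Fm L Γ
  | and {Γ : List (Ty S.Base)} (A B : Fm L Γ) : Fm L Γ
  | or {Γ : List (Ty S.Base)} (A B : Fm L Γ) : Fm L Γ
  | imp {Γ : List (Ty S.Base)} (A B : Fm L Γ) : Fm L Γ
  | all {Γ : List (Ty S.Base)} (τ : Ty S.Base) (B : Fm L (τ :: Γ)) : Fm L Γ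
  | ex {Γ : List (Ty S.Base)} (τ : Ty S.Base) (B : Fm L (τ :: Γ)) : Fm L Γ
  | nab {Γ : List (Ty S.Base)} (τ : Ty S.Base) (B : Fm L (τ :: Γ)) : Fm L Γ
  | eq {Γ : List (Ty S.Base)} {τ : Ty S.Base} (s t : Tm S Γ τ) : Fm L Γ
  | atom {Γ : List (Ty S.Base)} (p : L.Pred) (args : Sub S (L.ar p) Γ) : Fm L Γ

variable {L : Lang S}

def Fm.subst : {Γ Δ : List (Ty S.Base)} → Sub S Γ Δ → Fm L Γ → Fm L Δ
  | _, _, _, .top => .top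
  | _, _, _, .bot => .bot
  | _, _, θ, .and A B => .and (A.subst θ) (B.subst θ)
  | _, _, θ, .or A B => .or (A.subst θ) (B.subst θ)
  | _, _, θ, .imp A B => .imp (A.subst θ) (B.subst θ)
  | _, _, θ, .all τ B => .all τ (B.subst θ.lift)
  | _, _, θ, .ex τ B => .ex τ (B.subst θ.lift)
  | _, _, θ, .nab τ B => .nab τ (B.subst θ.lift)
  | _, _, θ, .eq s t => .eq (s.subst θ) (t.subst θ)
  | _, _, θ, .atom p args => .atom p (args.comp θ)

/-- `B t`, for `B` abstracted over its first variable. -/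
def Fm.inst {Γ : List (Ty S.Base)} {σ : Ty S.Base} (B : Fm L (σ :: Γ)) (t : Tm S Γ σ) : Fm L Γ :=
  B.subst (Sub.cons t Sub.id)

/-- `B (h c₁ ⋯ cₙ)` for a new eigenvariable `h`, placed first in the context. -/
def Fm.raised {Γ : List (Ty S.Base)} {σ : Ty S.Base} (B : Fm L (σ :: Γ)) (cs : List (Nom S)) :
    Fm L (Ty.raise cs σ :: Γ) :=
  B.subst (Sub.cons (Tm.appNoms cs (.var .z)) Sub.wk)

/-- The nominal constant `a` occurs in a formula, that is, `a ∈ supp B`. -/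
def Fm.Occ (a : Nom S) : {Γ : List (Ty S.Base)} → Fm L Γ → Prop
  | _, .top => False
  | _, .bot => False
  | _, .and A B => A.Occ a ∨ B.Occ a
  | _, .or A B => A.Occ a ∨ B.Occ a
  | _, .imp A B => A.Occ a ∨ B.Occ a
  | _, .all _ B => B.Occ a
  | _, .ex _ B => B.Occ a
  | _, .nab _ B => B.Occ a
  | _, .eq s t => s.Occ a ∨ t.Occ a
  | _, .atom _ args => args.Occ a

/-- The variable `v` occurs free in a formula. -/
def Fm.HasVar {σ : Ty S.Base} : {Γ : List (Ty S.Base)} → Fm L Γ → Var Γ σ → Prop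
  | _, .top, _ => False
  | _, .bot, _ => False
  | _, .and A B, v => A.HasVar v ∨ B.HasVar v
  | _, .or A B, v => A.HasVar v ∨ B.HasVar v
  | _, .imp A B, v => A.HasVar v ∨ B.HasVar v
  | _, .all _ B, v => B.HasVar (.s v)
  | _, .ex _ B, v => B.HasVar (.s v)
  | _, .nab _ B, v => B.HasVar (.s v)
  | _, .eq s t, v => s.HasVar v ∨ t.HasVar v
  | _, .atom p args, v => ∃ (τ : Ty S.Base) (w : Var (L.ar p) τ), (args w).HasVar v

def Fm.perm (π : NPerm S) : {Γ : List (Ty S.Base)} → Fm L Γ → Fm L Γ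
  | _, .top => .top
  | _, .bot => .bot
  | _, .and A B => .and (A.perm π) (B.perm π)
  | _, .or A B => .or (A.perm π) (B.perm π)
  | _, .imp A B => .imp (A.perm π) (B.perm π)
  | _, .all τ B => .all τ (B.perm π)
  | _, .ex τ B => .ex τ (B.perm π)
  | _, .nab τ B => .nab τ (B.perm π)
  | _, .eq s t => .eq (s.perm π) (t.perm π)
  | _, .atom p args => .atom p (fun _ v => (args v).perm π)

/-- Conversion of formulas. -/
inductive Fm.Conv : {Γ : List (Ty S.Base)} → Fm L Γ → Fm L Γ → Prop
  | top {Γ : List (Ty S.Base)} : Fm.Conv (.top : Fm L Γ) .top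
  | bot {Γ : List (Ty S.Base)} : Fm.Conv (.bot : Fm L Γ) .bot
  | and {Γ : List (Ty S.Base)} {A A' B B' : Fm L Γ} :
      Fm.Conv A A' → Fm.Conv B B' → Fm.Conv (.and A B) (.and A' B')
  | or {Γ : List (Ty S.Base)} {A A' B B' : Fm L Γ} :
      Fm.Conv A A' → Fm.Conv B B' → Fm.Conv (.or A B) (.or A' B')
  | imp {Γ : List (Ty S.Base)} {A A' B B' : Fm L Γ} :
      Fm.Conv A A' → Fm.Conv B B' → Fm.Conv (.imp A B) (.imp A' B')
  | all {Γ : List (Ty S.Base)} {τ : Ty S.Base} {B B' : Fm L (τ :: Γ)} :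
      Fm.Conv B B' → Fm.Conv (.all τ B) (.all τ B')
  | ex {Γ : List (Ty S.Base)} {τ : Ty S.Base} {B B' : Fm L (τ :: Γ)} :
      Fm.Conv B B' → Fm.Conv (.ex τ B) (.ex τ B')
  | nab {Γ : List (Ty S.Base)} {τ : Ty S.Base} {B B' : Fm L (τ :: Γ)} :
      Fm.Conv B B' → Fm.Conv (.nab τ B) (.nab τ B')
  | eq {Γ : List (Ty S.Base)} {τ : Ty S.Base} {s s' t t' : Tm S Γ τ} :
      Tm.Conv s s' → Tm.Conv t t' → Fm.Conv (.eq s t) (.eq s' t')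
  | atom {Γ : List (Ty S.Base)} (p : L.Pred) {args args' : Sub S (L.ar p) Γ} :
      (∀ (τ : Ty S.Base) (v : Var (L.ar p) τ), Tm.Conv (args v) (args' v)) →
      Fm.Conv (.atom p args) (.atom p args')

/-- Equivariant equality: convertibility modulo a permutation of the nominal constants. -/
def Fm.Equi {Γ : List (Ty S.Base)} (B B' : Fm L Γ) : Prop :=
  ∃ π : NPerm S, Fm.Conv (B.perm π) B'

/-- `∇z̄. B`. -/
def Fm.nabs {Γ : List (Ty S.Base)} : (Z : List (Ty S.Base)) → Fm L (Z ++ Γ) → Fm L Γ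
  | [], B => B
  | z :: Z, B => Fm.nabs Z (.nab z B)

/-- The level of a formula, relative to levels of the predicates. -/
def Fm.level (lvl : L.Pred → ℕ) : {Γ : List (Ty S.Base)} → Fm L Γ → ℕ
  | _, .top => 0
  | _, .bot => 0
  | _, .and A B => max (A.level lvl) (B.level lvl)
  | _, .or A B => max (A.level lvl) (B.level lvl)
  | _, .imp A B => max (A.level lvl + 1) (B.level lvl)
  | _, .all _ B => B.level lvl
  | _, .ex _ B => B.level lvl
  | _, .nab _ B => B.level lvl
  | _, .eq _ _ => 0
  | _, .atom p _ => lvl p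

/-- Replace every atom `q t̄` whose predicate has level `ℓ` by `I_q t̄`. -/
def Fm.replace (lvl : L.Pred → ℕ) (ℓ : ℕ) (I : ∀ q : L.Pred, Fm L (L.ar q)) :
    {Γ : List (Ty S.Base)} → Fm L Γ → Fm L Γ
  | _, .top => .top
  | _, .bot => .bot
  | _, .and A B => .and (A.replace lvl ℓ I) (B.replace lvl ℓ I)
  | _, .or A B => .or (A.replace lvl ℓ I) (B.replace lvl ℓ I)
  | _, .imp A B => .imp (A.replace lvl ℓ I) (B.replace lvl ℓ I)
  | _, .all τ B => .all τ (B.replace lvl ℓ I)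
  | _, .ex τ B => .ex τ (B.replace lvl ℓ I)
  | _, .nab τ B => .nab τ (B.replace lvl ℓ I)
  | _, .eq s t => .eq s t
  | _, .atom q args => if lvl q = ℓ then (I q).subst args else .atom q args

/-! ## Definitions -/

/-- A definitional clause `∀x̄. (∇z̄. p t̄) ≜ B` for the predicate `p`: the types of `x̄` and `z̄`,
the tuple `t̄`, and the body `B`. -/
structure Clause (L : Lang S) (p : L.Pred) where
  xs : List (Ty S.Base)
  zs : List (Ty S.Base)
  head : Sub S (L.ar p) (zs ++ xs)
  body : Fm L xs

/-- A set of definitional clauses, possibly infinite, together with the levels of the predicates.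
All definitions are read inductively; predicates of the same level are defined simultaneously. -/
structure Defn (L : Lang S) where
  clauses : ∀ p : L.Pred, Set (Clause L p)
  lvl : L.Pred → ℕ

/-- The conditions on definitional clauses: no nominal constants; every free variable of the body
occurs in the head; and stratification: the level of the body is at most that of the predicate, so
that predicates of its level occur in the body only strictly positively. -/
def Defn.WellFormed (D : Defn L) : Prop :=
  ∀ p : L.Pred, ∀ c ∈ D.clauses p,
    (∀ a : Nom S, ¬ Sub.Occ a c.head ∧ ¬ Fm.Occ a c.body) ∧
    (∀ (τ : Ty S.Base) (v : Var c.xs τ), c.body.HasVar v →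
      ∃ (σ : Ty S.Base) (w : Var (L.ar p) σ), (c.head w).HasVar (v.skip c.zs)) ∧
    c.body.level D.lvl ≤ D.lvl p

/-- A choice of one nominal constant for each of the variables `z̄`. -/
def NomChoice (Z : List (Ty S.Base)) : Type := ∀ ⦃τ : Ty S.Base⦄, Var Z τ → ℕ

/-- The chosen nominal constants are pairwise distinct. -/
def NomChoice.Distinct {Z : List (Ty S.Base)} (d : NomChoice Z) : Prop :=
  ∀ ⦃τ : Ty S.Base⦄ (v w : Var Z τ), d v = d w → v = w

/-- The head of the clause, with terms `u` for `x̄` and the nominal constants `d` for `z̄`. -/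
def Clause.headAt {p : L.Pred} (c : Clause L p) {Γ : List (Ty S.Base)} (u : Sub S c.xs Γ)
    (d : NomChoice c.zs) : Sub S (L.ar p) Γ :=
  c.head.comp (Sub.append c.zs (fun _ v => .nom (d v)) u)

/-- The instance of the head of `c` given by `u` and `d` is convertible to `p args`, where the
nominal constants `d` are distinct and do not occur in `u`. -/
def Clause.Matches {p : L.Pred} (c : Clause L p) {Γ : List (Ty S.Base)} (u : Sub S c.xs Γ)
    (d : NomChoice c.zs) (args : Sub S (L.ar p) Γ) : Prop :=
  d.Distinct ∧
  (∀ (τ : Ty S.Base) (v : Var c.zs τ), ¬ Sub.Occ ((τ, d v) : Nom S) u) ∧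
  ∀ (τ : Ty S.Base) (v : Var (L.ar p) τ), Tm.Conv (c.headAt u d v) (args v)

/-! ## The reasoning logic: derivability -/

/-- No nominal constant of `θ` occurs in `B`.  A substitution for eigenvariables is applied to a
formula only under this condition (it never captures nominal constants). -/
def Fm.Avoids {Γ Δ : List (Ty S.Base)} (θ : Sub S Γ Δ) (B : Fm L Γ) : Prop :=
  ∀ a : Nom S, Sub.Occ a θ → ¬ Fm.Occ a B

/-- `Der D X Δ C` : the sequent `X ; Δ ⊩ C` is derivable in the reasoning logic with the
definitions `D`.  `X` lists the types of the eigenvariables.  The rules look at the list `Δ` only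
through membership, so it plays the role of a finite set. -/
inductive Der (D : Defn L) : (X : List (Ty S.Base)) → List (Fm L X) → Fm L X → Prop
  | id {X : List (Ty S.Base)} {Δ : List (Fm L X)} {B C : Fm L X} :
      B ∈ Δ → Fm.Equi B C → Der D X Δ C
  | cut {X : List (Ty S.Base)} {Δ : List (Fm L X)} {B B' C : Fm L X} :
      Der D X Δ B → Fm.Equi B B' → Der D X (B' :: Δ) C → Der D X Δ C
  | topR {X : List (Ty S.Base)} {Δ : List (Fm L X)} : Der D X Δ .top
  | botL {X : List (Ty S.Base)} {Δ : List (Fm L X)} {C : Fm L X} : .bot ∈ Δ → Der D X Δ C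
  | andR {X : List (Ty S.Base)} {Δ : List (Fm L X)} {A B : Fm L X} :
      Der D X Δ A → Der D X Δ B → Der D X Δ (.and A B)
  | andL {X : List (Ty S.Base)} {Δ : List (Fm L X)} {A B C : Fm L X} :
      .and A B ∈ Δ → Der D X (A :: B :: Δ) C → Der D X Δ C
  | orR₁ {X : List (Ty S.Base)} {Δ : List (Fm L X)} {A B : Fm L X} :
      Der D X Δ A → Der D X Δ (.or A B)
  | orR₂ {X : List (Ty S.Base)} {Δ : List (Fm L X)} {A B : Fm L X} :
      Der D X Δ B → Der D X Δ (.or A B)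
  | orL {X : List (Ty S.Base)} {Δ : List (Fm L X)} {A B C : Fm L X} :
      .or A B ∈ Δ → Der D X (A :: Δ) C → Der D X (B :: Δ) C → Der D X Δ C
  | impR {X : List (Ty S.Base)} {Δ : List (Fm L X)} {A B : Fm L X} :
      Der D X (A :: Δ) B → Der D X Δ (.imp A B)
  | impL {X : List (Ty S.Base)} {Δ : List (Fm L X)} {A B C : Fm L X} :
      .imp A B ∈ Δ → Der D X Δ A → Der D X (B :: Δ) C → Der D X Δ C
  | allL {X : List (Ty S.Base)} {Δ : List (Fm L X)} {C : Fm L X} {τ : Ty S.Base}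
      {B : Fm L (τ :: X)} (t : Tm S X τ) :
      .all τ B ∈ Δ → Der D X (B.inst t :: Δ) C → Der D X Δ C
  | allR {X : List (Ty S.Base)} {Δ : List (Fm L X)} {τ : Ty S.Base} {B : Fm L (τ :: X)}
      (cs : List (Nom S)) : cs.Nodup → (∀ a, a ∈ cs ↔ Fm.Occ a B) →
      Der D (Ty.raise cs τ :: X) (Δ.map (Fm.subst Sub.wk)) (B.raised cs) → Der D X Δ (.all τ B)
  | exL {X : List (Ty S.Base)} {Δ : List (Fm L X)} {C : Fm L X} {τ : Ty S.Base}
      {B : Fm L (τ :: X)} (cs : List (Nom S)) : .ex τ B ∈ Δ →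
      cs.Nodup → (∀ a, a ∈ cs ↔ Fm.Occ a B) →
      Der D (Ty.raise cs τ :: X) (B.raised cs :: Δ.map (Fm.subst Sub.wk)) (C.subst Sub.wk) →
      Der D X Δ C
  | exR {X : List (Ty S.Base)} {Δ : List (Fm L X)} {τ : Ty S.Base} {B : Fm L (τ :: X)}
      (t : Tm S X τ) : Der D X Δ (B.inst t) → Der D X Δ (.ex τ B)
  | nabL {X : List (Ty S.Base)} {Δ : List (Fm L X)} {C : Fm L X} {τ : Ty S.Base}
      {B : Fm L (τ :: X)} (n : ℕ) : .nab τ B ∈ Δ → ¬ Fm.Occ ((τ, n) : Nom S) B →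
      Der D X (B.inst (.nom n) :: Δ) C → Der D X Δ C
  | nabR {X : List (Ty S.Base)} {Δ : List (Fm L X)} {τ : Ty S.Base} {B : Fm L (τ :: X)}
      (n : ℕ) : ¬ Fm.Occ ((τ, n) : Nom S) B →
      Der D X Δ (B.inst (.nom n)) → Der D X Δ (.nab τ B)
  | eqR {X : List (Ty S.Base)} {Δ : List (Fm L X)} {τ : Ty S.Base} {s t : Tm S X τ} :
      Tm.Conv s t → Der D X Δ (.eq s t)
  /-- One premise for every unifier of `s` and `t`. -/
  | eqL {X : List (Ty S.Base)} {Δ : List (Fm L X)} {C : Fm L X} {τ : Ty S.Base}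
      {s t : Tm S X τ} : .eq s t ∈ Δ →
      (∀ (X' : List (Ty S.Base)) (θ : Sub S X X'),
        (∀ B ∈ Δ, Fm.Avoids θ B) → Fm.Avoids θ C →
        Tm.Conv (s.subst θ) (t.subst θ) →
        Der D X' (Δ.map (Fm.subst θ)) (C.subst θ)) →
      Der D X Δ C
  /-- Backchaining on a definitional clause. -/
  | defR {X : List (Ty S.Base)} {Δ : List (Fm L X)} (p : L.Pred) {args : Sub S (L.ar p) X}
      (c : Clause L p) (u : Sub S c.xs X) (d : NomChoice c.zs) : c ∈ D.clauses p →
      c.Matches u d args → Der D X Δ (c.body.subst u) → Der D X Δ (.atom p args)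
  /-- Case analysis: one premise for every clause and every way of unifying its head with the
  atom. -/
  | defL {X : List (Ty S.Base)} {Δ : List (Fm L X)} {C : Fm L X} (p : L.Pred)
      {args : Sub S (L.ar p) X} : .atom p args ∈ Δ →
      (∀ c ∈ D.clauses p, ∀ (X' : List (Ty S.Base)) (θ : Sub S X X') (u : Sub S c.xs X')
        (d : NomChoice c.zs), (∀ B ∈ Δ, Fm.Avoids θ B) → Fm.Avoids θ C →
        c.Matches u d (args.comp θ) →
        Der D X' (c.body.subst u :: Δ.map (Fm.subst θ)) (C.subst θ)) →
      Der D X Δ C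
  /-- Induction on `p args`, with one invariant for every predicate that is defined simultaneously
  with `p`. -/
  | ind {X : List (Ty S.Base)} {Δ : List (Fm L X)} {C : Fm L X} (p : L.Pred)
      {args : Sub S (L.ar p) X} (I : ∀ q : L.Pred, Fm L (L.ar q)) : .atom p args ∈ Δ →
      (∀ q, D.lvl q = D.lvl p → ∀ a : Nom S, ¬ Fm.Occ a (I q)) →
      (∀ q, D.lvl q = D.lvl p → ∀ c ∈ D.clauses q,
        Der D c.xs [c.body.replace D.lvl (D.lvl p) I] (Fm.nabs c.zs ((I q).subst c.head))) →
      Der D X ((I p).subst args :: Δ) C →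
      Der D X Δ C

/-- Provability of a closed formula. -/
def Provable (D : Defn L) (C : Fm L []) : Prop := Der D [] [] C

/-! ## The encoding of the specification logic -/

/-- The predicates of the encoding. -/
inductive HHPred : Type
  | member | prog | isForall | atomic | seq | bc

def HHPred.ar (S : HHSig) : HHPred → List (Ty S.Base)
  | .member => [.o, .olist]
  | .prog => [.o]
  | .isForall => [.o]
  | .atomic => [.o]
  | .seq => [.olist, .o]
  | .bc => [.olist, .o, .o]

def HHPred.lvl : HHPred → ℕ
  | .member => 0
  | .prog => 0
  | .isForall => 0
  | .atomic => 1
  | .seq => 2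
  | .bc => 2

/-- The predicates of the encoding together with auxiliary predicates. -/
def hhLang (A : Lang S) : Lang S where
  Pred := HHPred ⊕ A.Pred
  ar := Sum.elim (HHPred.ar S) A.ar

section Notions

variable {Γ : List (Ty S.Base)}

/-- `F ∧ G` in the specification logic. -/
def Tm.conj (F G : Tm S Γ .o) : Tm S Γ .o := .app (.app (.con .conj) F) G

/-- `F ⇒ G` in the specification logic. -/
def Tm.impl (F G : Tm S Γ .o) : Tm S Γ .o := .app (.app (.con .impl) F) G

/-- `∀_τ G` in the specification logic. -/
def Tm.sfall (τ : Ty S.Base) (h : τ.IsQuant) (G : Tm S Γ (.arr τ .o)) : Tm S Γ .o :=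
  .app (.con (.forall_ τ h)) G

/-- `F :: L`. -/
def Tm.cons (F : Tm S Γ .o) (K : Tm S Γ .olist) : Tm S Γ .olist := .app (.app (.con .cons) F) K

variable {A : Lang S}

def member (E : Tm S Γ .o) (K : Tm S Γ .olist) : Fm (hhLang A) Γ :=
  .atom (.inl .member) (Sub.cons E (Sub.cons K Sub.nil))

def prog (F : Tm S Γ .o) : Fm (hhLang A) Γ := .atom (.inl .prog) (Sub.cons F Sub.nil)

def isForall (F : Tm S Γ .o) : Fm (hhLang A) Γ := .atom (.inl .isForall) (Sub.cons F Sub.nil)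

def atomic (F : Tm S Γ .o) : Fm (hhLang A) Γ := .atom (.inl .atomic) (Sub.cons F Sub.nil)

/-- `{K ⊢ G}`. -/
def seq (K : Tm S Γ .olist) (G : Tm S Γ .o) : Fm (hhLang A) Γ :=
  .atom (.inl .seq) (Sub.cons K (Sub.cons G Sub.nil))

/-- `{K, [F] ⊢ G}`. -/
def bc (K : Tm S Γ .olist) (F G : Tm S Γ .o) : Fm (hhLang A) Γ :=
  .atom (.inl .bc) (Sub.cons K (Sub.cons F (Sub.cons G Sub.nil)))

/-- `¬ B`, that is, `B ⇒ ⊥`. -/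
def neg (B : Fm (hhLang A) Γ) : Fm (hhLang A) Γ := .imp B .bot

/-- The first four variables of a context. -/
def v0 {Γ : List (Ty S.Base)} {a : Ty S.Base} : Tm S (a :: Γ) a := .var .z
def v1 {Γ : List (Ty S.Base)} {a b : Ty S.Base} : Tm S (b :: a :: Γ) a := .var (.s .z)
def v2 {Γ : List (Ty S.Base)} {a b c : Ty S.Base} : Tm S (c :: b :: a :: Γ) a :=
  .var (.s (.s .z))
def v3 {Γ : List (Ty S.Base)} {a b c d : Ty S.Base} : Tm S (d :: c :: b :: a :: Γ) a :=
  .var (.s (.s (.s .z)))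

end Notions

section Clauses

variable (A : Lang S)

/-- `member E (E :: L) ≜ ⊤`, with `E, L = v0, v1`. -/
def memberHere : Clause (hhLang A) (.inl .member) where
  xs := [.o, .olist]
  zs := []
  head := Sub.cons v0 (Sub.cons (Tm.cons v0 v1) Sub.nil)
  body := .top

/-- `member E (F :: L) ≜ member E L`, with `E, F, L = v0, v1, v2`. -/
def memberThere : Clause (hhLang A) (.inl .member) where
  xs := [.o, .o, .olist]
  zs := []
  head := Sub.cons v0 (Sub.cons (Tm.cons v1 v2) Sub.nil)
  body := member v0 v2

/-- `prog F ≜ ⊤`. -/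
def progClause (F : Tm S [] .o) : Clause (hhLang A) (.inl .prog) where
  xs := []
  zs := []
  head := Sub.cons F Sub.nil
  body := .top

/-- `isForall (∀_τ G) ≜ ⊤`. -/
def isForallClause (τ : Ty S.Base) (h : τ.IsQuant) : Clause (hhLang A) (.inl .isForall) where
  xs := [.arr τ .o]
  zs := []
  head := Sub.cons (Tm.sfall τ h v0) Sub.nil
  body := .top

/-- `atomic F ≜ ¬ isForall F ∧ (∀ G₁ G₂. F = (G₁ ∧ G₂) ⇒ ⊥) ∧ (∀ G₁ G₂. F = (G₁ ⇒ G₂) ⇒ ⊥)`.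
Since `τ` ranges over infinitely many types, the condition that `F` is not of the form `∀_τ G` for
any `τ` is expressed through `isForall`. -/
def atomicClause : Clause (hhLang A) (.inl .atomic) where
  xs := [.o]
  zs := []
  head := Sub.cons v0 Sub.nil
  body := .and (neg (isForall v0))
    (.and (.all .o (.all .o (neg (.eq v2 (Tm.conj v1 v0)))))
      (.all .o (.all .o (neg (.eq v2 (Tm.impl v1 v0))))))

/-- `seq L (G₁ ∧ G₂) ≜ seq L G₁ ∧ seq L G₂`. -/
def seqConj : Clause (hhLang A) (.inl .seq) where
  xs := [.olist, .o, .o]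
  zs := []
  head := Sub.cons v0 (Sub.cons (Tm.conj v1 v2) Sub.nil)
  body := .and (seq v0 v1) (seq v0 v2)

/-- `seq L (F ⇒ G) ≜ seq (F :: L) G`. -/
def seqImpl : Clause (hhLang A) (.inl .seq) where
  xs := [.olist, .o, .o]
  zs := []
  head := Sub.cons v0 (Sub.cons (Tm.impl v1 v2) Sub.nil)
  body := seq (Tm.cons v1 v0) v2

/-- `seq L (∀_τ G) ≜ ∇x:τ. seq L (G x)`. -/
def seqForall (τ : Ty S.Base) (h : τ.IsQuant) : Clause (hhLang A) (.inl .seq) where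
  xs := [.olist, .arr τ .o]
  zs := []
  head := Sub.cons v0 (Sub.cons (Tm.sfall τ h v1) Sub.nil)
  body := .nab τ (seq v1 (.app v2 v0))

/-- `seq L A ≜ ∃F. atomic A ∧ member F L ∧ bc L F A`. -/
def seqDyn : Clause (hhLang A) (.inl .seq) where
  xs := [.olist, .o]
  zs := []
  head := Sub.cons v0 (Sub.cons v1 Sub.nil)
  body := .ex .o (.and (atomic v2) (.and (member v0 v1) (bc v1 v0 v2)))

/-- `seq L A ≜ ∃F. atomic A ∧ prog F ∧ bc L F A`. -/
def seqProg : Clause (hhLang A) (.inl .seq) where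
  xs := [.olist, .o]
  zs := []
  head := Sub.cons v0 (Sub.cons v1 Sub.nil)
  body := .ex .o (.and (atomic v2) (.and (prog v0) (bc v1 v0 v2)))

/-- `bc L (F₁ ∧ F₂) A ≜ bc L F₁ A ∨ bc L F₂ A`. -/
def bcConj : Clause (hhLang A) (.inl .bc) where
  xs := [.olist, .o, .o, .o]
  zs := []
  head := Sub.cons v0 (Sub.cons (Tm.conj v1 v2) (Sub.cons v3 Sub.nil))
  body := .or (bc v0 v1 v3) (bc v0 v2 v3)

/-- `bc L (G ⇒ F) A ≜ seq L G ∧ bc L F A`. -/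
def bcImpl : Clause (hhLang A) (.inl .bc) where
  xs := [.olist, .o, .o, .o]
  zs := []
  head := Sub.cons v0 (Sub.cons (Tm.impl v1 v2) (Sub.cons v3 Sub.nil))
  body := .and (seq v0 v1) (bc v0 v2 v3)

/-- `bc L (∀_τ F) A ≜ ∃t:τ. bc L (F t) A`. -/
def bcForall (τ : Ty S.Base) (h : τ.IsQuant) : Clause (hhLang A) (.inl .bc) where
  xs := [.olist, .arr τ .o, .o]
  zs := []
  head := Sub.cons v0 (Sub.cons (Tm.sfall τ h v1) (Sub.cons v2 Sub.nil))
  body := .ex τ (bc v1 (.app v2 v0) v3)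

/-- `bc L A A ≜ ⊤`. -/
def bcMatch : Clause (hhLang A) (.inl .bc) where
  xs := [.olist, .o]
  zs := []
  head := Sub.cons v0 (Sub.cons v1 (Sub.cons v1 Sub.nil))
  body := .top

/-- The clauses of the encoding, for the program `Θ`. -/
def hhClauses (Θ : List (Tm S [] .o)) :
    ∀ p : HHPred, Set (Clause (hhLang A) (.inl p))
  | .member => {memberHere A, memberThere A}
  | .prog => {c | ∃ F ∈ Θ, c = progClause A F}
  | .isForall => {c | ∃ τ h, c = isForallClause A τ h}
  | .atomic => {atomicClause A}
  | .seq => {seqConj A, seqImpl A, seqDyn A, seqProg A} ∪ {c | ∃ τ h, c = seqForall A τ h}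
  | .bc => {bcConj A, bcImpl A, bcMatch A} ∪ {c | ∃ τ h, c = bcForall A τ h}

end Clauses

variable (S) in
/-- Auxiliary definitions on top of the encoding: new predicates with clauses of their own.  They
may mention the predicates of the encoding, but add no clause to them. -/
structure AuxDefn where
  lang : Lang S
  clauses : ∀ p : lang.Pred, Set (Clause (hhLang lang) (.inr p))
  lvl : lang.Pred → ℕ

/-- The encoding of the specification logic with program `Θ`, with auxiliary definitions `E`. -/
def encoding (Θ : List (Tm S [] .o)) (E : AuxDefn S) : Defn (hhLang E.lang) where
  clauses
    | .inl p => hhClauses E.lang Θ p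
    | .inr p => E.clauses p
  lvl := Sum.elim HHPred.lvl E.lvl

/-! ## The three formulas -/

variable (A : Lang S)

/-- `∀ L F G. {L ⊢ F} ⇒ {F :: L ⊢ G} ⇒ {L ⊢ G}`. -/
def cutFormula : Fm (hhLang A) [] :=
  .all .olist <| .all .o <| .all .o <|
    .imp (seq v2 v1) <| .imp (seq (Tm.cons v1 v2) v0) <| seq v2 v0

/-- `∀ L G. ∇x. {L x ⊢ G x} ⇒ ∀ t. {L t ⊢ G t}`, with `x` and `t` of type `τ`. -/
def instFormula (τ : Ty S.Base) : Fm (hhLang A) [] :=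
  .all (.arr τ .olist) <| .all (.arr τ .o) <| .nab τ <|
    .imp (seq (.app v2 v0) (.app v1 v0)) <|
      .all τ <| seq (.app v3 v0) (.app v2 v0)

/-- `∀ L L' G. {L ⊢ G} ⇒ (∀ F. member F L ⇒ member F L') ⇒ {L' ⊢ G}`. -/
def monoFormula : Fm (hhLang A) [] :=
  .all .olist <| .all .olist <| .all .o <|
    .imp (seq v2 v0) <|
      .imp (.all .o (.imp (member v0 v3) (member v0 v2))) <| seq v1 v0

end TwoLevel

/-! The difficulty is to run height inductions inside a calculus whose induction rule only accepts
closed invariants without nominal constants. The proof moves these inductions to the metalevel. For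
each natural number `h` there are separate predicates `seqh h` and `bch h` for derivations of height
at most `h`. The predicates `seqAny` and `bcAny` have one clause for every `h`, so case analysis on
them has a family of premises for each `h`, in the manner of an omega rule. The induction rule of
the calculus is used only twice, to pass from `member` to `memAny` and from `seq` to `seqAny`
(`memAny_of_member`, `seqAny_of_seq`). After that a statement about derivations is a statement about
each fixed `h`, proved by strong induction on `h` in Lean.

Monotonicity (`mono_of_height`) is then a direct height induction, and so is instantiation
(`nsub_of_height`), which replaces a nominal constant `a` by a term throughout a derivation. Its
delicate point is `atomic_nsub`: atomicity is a negative condition, and it survives the replacement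
only because a term whose target type is not `o` cannot create an outermost logical constant. That
fact, and the injectivity and disjointness of the constructors modulo conversion, come from a
set-theoretic model in which elements of `o` and `olist` carry a tag for their outermost
constructor. No normalization theorem is needed: the full function spaces validate beta and eta
(`Tm.Conv.eval`), one logical relation (`Represents`) shows that tags describe terms correctly, and
another (`Similar`) shows that the replacement keeps the tag.

Cut uses Kripke-style reducibility rather than induction on the cut formula. A formula is reducible
as a goal or as a hypothesis, and the two notions alternate at the antecedent of an implication.
Reducibility is indexed by a depth `k` instead of by the structure of the formula. The index makes
the definition stratified, since the negative occurrence has smaller depth, and it applies to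
arbitrary terms of type `o`. A finite depth suffices because a derivation of height `h` inspects
formulas only to depth `h`.

Three facts carry the argument. Reducible goals are reducible hypotheses (`red_false_of_true`).
Members of the context and program formulas are reducible hypotheses of every depth (`red_of_ne`).
Derivations of height `h` are sound for reducibility at depths at least `h` (`reducible_of_height`).
Given derivations of heights `i` and `j` for the premises of a cut, all depths are bounded by `max i
j`: the first derivation makes the cut formula reducible to that depth, and the second is then
replayed with this formula removed from its context. -/

namespace TwoLevel
variable {S : HHSig}

/-! ## The calculus of substitutions -/

section Calculus

variable {Γ Δ Ξ : List (Ty S.Base)} {σ τ : Ty S.Base}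

variable (S) in
/-- Assignments of terms over `Δ` to the nominal constants. -/
abbrev NomSub (Δ : List (Ty S.Base)) : Type := ∀ τ : Ty S.Base, ℕ → Tm S Δ τ

def NomSub.id : NomSub S Δ := fun _ n => .nom n

/-- Simultaneous substitution for nominal constants and for free variables. -/
def Tm.gsub : {Γ Δ : List (Ty S.Base)} → {τ : Ty S.Base} →
    NomSub S Δ → Sub S Γ Δ → Tm S Γ τ → Tm S Δ τ
  | _, _, _, _, θ, .var v => θ v
  | _, _, _, _, _, .con c => .con c
  | _, _, τ, f, _, .nom n => f τ n
  | _, _, _, f, θ, .app g a => .app (g.gsub f θ) (a.gsub f θ)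
  | _, _, _, f, θ, .lam b => .lam (b.gsub (fun τ n => (f τ n).shift) θ.lift)

theorem Sub.ext_cons {θ η : Sub S (σ :: Γ) Δ} (hz : θ (.z : Var (σ :: Γ) σ) = η .z)
    (hs : ∀ (τ : Ty S.Base) (v : Var Γ τ), θ (.s v) = η (.s v)) : θ = η := by
  funext τ v
  cases v with
  | z => exact hz
  | s v => exact hs _ v

theorem Tm.rename_rename (t : Tm S Γ τ) : ∀ {Δ Ξ : List (Ty S.Base)} (ρ : Ren Γ Δ) (ρ' : Ren Δ Ξ),
    (t.rename ρ).rename ρ' = t.rename (fun _ v => ρ' (ρ v)) := by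
  induction t with
  | var v => intros; rfl
  | con c => intros; rfl
  | nom n => intros; rfl
  | app f a hf ha => intro Δ Ξ ρ ρ'; simp only [Tm.rename, hf, ha]
  | lam b hb =>
    intro Δ Ξ ρ ρ'
    simp only [Tm.rename, hb]
    congr 2
    funext τ v
    cases v <;> rfl

theorem Tm.gsub_rename (t : Tm S Γ τ) : ∀ {Δ Ξ : List (Ty S.Base)} (ρ : Ren Γ Δ) (f : NomSub S Ξ)
    (θ : Sub S Δ Ξ), (t.rename ρ).gsub f θ = t.gsub f (fun _ v => θ (ρ v)) := by
  induction t with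
  | var v => intros; rfl
  | con c => intros; rfl
  | nom n => intros; rfl
  | app f a hf ha => intro Δ Ξ ρ f θ; simp only [Tm.rename, Tm.gsub, hf, ha]
  | lam b hb =>
    intro Δ Ξ ρ f θ
    simp only [Tm.rename, Tm.gsub, hb]
    congr 2
    exact Sub.ext_cons rfl fun _ _ => rfl

theorem Tm.rename_shift (t : Tm S Γ τ) (ρ : Ren Γ Δ) :
    (t.shift (σ := σ)).rename ρ.lift = (t.rename ρ).shift := by
  exact (Tm.rename_rename ..).trans (Tm.rename_rename t ρ _).symm

theorem Tm.rename_gsub (t : Tm S Γ τ) : ∀ {Δ Ξ : List (Ty S.Base)} (f : NomSub S Δ)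
    (θ : Sub S Γ Δ) (ρ : Ren Δ Ξ), (t.gsub f θ).rename ρ =
      t.gsub (fun _ n => (f _ n).rename ρ) (fun _ v => (θ v).rename ρ) := by
  induction t with
  | var v => intros; rfl
  | con c => intros; rfl
  | nom n => intros; rfl
  | app f a hf ha => intro Δ Ξ f θ ρ; simp only [Tm.rename, Tm.gsub, hf, ha]
  | lam b hb =>
    intro Δ Ξ f θ ρ
    simp only [Tm.rename, Tm.gsub, hb, Tm.rename_shift]
    congr 2
    exact Sub.ext_cons rfl fun _ _ => Tm.rename_shift _ _

theorem Tm.gsub_shift_lift (t : Tm S Γ τ) (f : NomSub S Δ) (θ : Sub S Γ Δ) :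
    (t.shift (σ := σ)).gsub (fun _ n => (f _ n).shift) θ.lift = (t.gsub f θ).shift := by
  exact (Tm.gsub_rename ..).trans (Tm.rename_gsub t f θ _).symm

theorem Tm.gsub_gsub (t : Tm S Γ τ) : ∀ {Δ Ξ : List (Ty S.Base)} (f : NomSub S Δ)
    (θ : Sub S Γ Δ) (g : NomSub S Ξ) (η : Sub S Δ Ξ), (t.gsub f θ).gsub g η =
      t.gsub (fun _ n => (f _ n).gsub g η) (fun _ v => (θ v).gsub g η) := by
  induction t with
  | var v => intros; rfl
  | con c => intros; rfl
  | nom n => intros; rfl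
  | app f a hf ha => intro Δ Ξ f θ g η; simp only [Tm.gsub, hf, ha]
  | lam b hb =>
    intro Δ Ξ f θ g η
    simp only [Tm.gsub, hb, Tm.gsub_shift_lift]
    congr 2
    exact Sub.ext_cons rfl fun _ _ => Tm.gsub_shift_lift _ _ _

theorem Tm.subst_eq_gsub (t : Tm S Γ τ) : ∀ {Δ : List (Ty S.Base)} (θ : Sub S Γ Δ),
    t.subst θ = t.gsub NomSub.id θ := by
  induction t with
  | var v => intros; rfl
  | con c => intros; rfl
  | nom n => intros; rfl
  | app f a hf ha => intro Δ θ; simp only [Tm.subst, Tm.gsub, hf, ha]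
  | lam b hb => intro Δ θ; simp only [Tm.subst, Tm.gsub, hb]; rfl

theorem Tm.rename_eq_gsub (t : Tm S Γ τ) : ∀ {Δ : List (Ty S.Base)} (ρ : Ren Γ Δ),
    t.rename ρ = t.gsub NomSub.id (fun _ v => .var (ρ v)) := by
  induction t with
  | var v => intros; rfl
  | con c => intros; rfl
  | nom n => intros; rfl
  | app f a hf ha => intro Δ ρ; simp only [Tm.rename, Tm.gsub, hf, ha]
  | lam b hb =>
    intro Δ ρ
    simp only [Tm.rename, Tm.gsub, hb]
    congr 2
    exact Sub.ext_cons rfl fun _ _ => rfl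

theorem Tm.shift_eq_gsub (t : Tm S Γ τ) : t.shift (σ := σ) = t.gsub NomSub.id Sub.wk :=
  Tm.rename_eq_gsub t _

theorem Tm.gsub_id (t : Tm S Γ τ) : t.gsub NomSub.id Sub.id = t := by
  induction t with
  | var v => rfl
  | con c => rfl
  | nom n => rfl
  | app f a hf ha => simp only [Tm.gsub, hf, ha]
  | lam b hb =>
    simp only [Tm.gsub]
    conv_rhs => rw [← hb]
    congr 2
    exact Sub.ext_cons rfl fun _ _ => rfl

theorem Tm.subst_id (t : Tm S Γ τ) : t.subst Sub.id = t := by rw [Tm.subst_eq_gsub, Tm.gsub_id]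

theorem Tm.subst_subst (t : Tm S Γ τ) (θ : Sub S Γ Δ) (η : Sub S Δ Ξ) :
    (t.subst θ).subst η = t.subst (θ.comp η) := by
  rw [Tm.subst_eq_gsub, Tm.subst_eq_gsub, Tm.gsub_gsub, Tm.subst_eq_gsub]
  congr 1
  funext τ v
  exact (Tm.subst_eq_gsub _ _).symm

theorem Tm.shift_gsub (t : Tm S Γ τ) (f : NomSub S Δ) (θ : Sub S (σ :: Γ) Δ) :
    t.shift.gsub f θ = t.gsub f (fun _ v => θ (.s v)) := Tm.gsub_rename ..

theorem Tm.shift_subst (t : Tm S Γ τ) (θ : Sub S (σ :: Γ) Δ) :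
    t.shift.subst θ = t.subst (fun _ v => θ (.s v)) := by
  rw [Tm.subst_eq_gsub, Tm.shift_gsub]
  exact (Tm.subst_eq_gsub t _).symm

theorem Tm.shift_subst_cons (t : Tm S Γ τ) (a : Tm S Δ σ) (θ : Sub S Γ Δ) :
    t.shift.subst (Sub.cons a θ) = t.subst θ := Tm.shift_subst ..

theorem Sub.lift_comp_cons (θ : Sub S Γ Δ) (a : Tm S Ξ σ) (η : Sub S Δ Ξ) :
    θ.lift.comp (Sub.cons a η) = Sub.cons a (θ.comp η) :=
  Sub.ext_cons rfl fun _ _ => Tm.shift_subst_cons ..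

theorem Tm.shift_subst_lift (t : Tm S Γ τ) (θ : Sub S Γ Δ) :
    (t.shift (σ := σ)).subst θ.lift = (t.subst θ).shift := by
  rw [Tm.subst_eq_gsub, Tm.subst_eq_gsub]
  exact Tm.gsub_shift_lift t NomSub.id θ

theorem Sub.lift_comp_lift (θ : Sub S Γ Δ) (η : Sub S Δ Ξ) :
    (θ.lift (σ := σ)).comp η.lift = (θ.comp η).lift :=
  Sub.ext_cons rfl fun _ _ => Tm.shift_subst_lift ..

theorem Sub.cons_comp (a : Tm S Δ σ) (θ : Sub S Γ Δ) (η : Sub S Δ Ξ) :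
    (Sub.cons a θ).comp η = Sub.cons (a.subst η) (θ.comp η) :=
  Sub.ext_cons rfl fun _ _ => rfl

theorem Sub.nil_comp (η : Sub S Δ Ξ) : (Sub.nil : Sub S [] Δ).comp η = Sub.nil := by
  funext τ v; cases v

theorem Sub.comp_id (θ : Sub S Γ Δ) : θ.comp Sub.id = θ := by
  funext τ v; exact Tm.subst_id _

theorem Sub.comp_assoc {Υ : List (Ty S.Base)} (θ : Sub S Γ Δ) (η : Sub S Δ Ξ) (κ : Sub S Ξ Υ) :
    (θ.comp η).comp κ = θ.comp (η.comp κ) := by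
  funext τ v; exact Tm.subst_subst ..

/-- Both sides compose to the same simultaneous substitution. This is what the beta case of
`Tm.Conv.gsub` needs. -/
theorem Tm.gsub_inst (b : Tm S (σ :: Γ) τ) (a : Tm S Γ σ) (f : NomSub S Δ) (θ : Sub S Γ Δ) :
    (b.inst a).gsub f θ =
      (b.gsub (fun _ n => (f _ n).shift) θ.lift).inst (a.gsub f θ) := by
  simp only [Tm.inst, Tm.subst_eq_gsub, Tm.gsub_gsub]
  congr 1
  · funext τ n
    simp only [NomSub.id, Tm.gsub, Tm.shift_gsub]
    exact (Tm.gsub_id _).symm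
  · refine Sub.ext_cons rfl fun _ v => ?_
    simp only [Sub.cons, Sub.lift, Tm.shift_gsub]
    exact (Tm.gsub_id _).symm

theorem Tm.Conv.of_eq {t u : Tm S Γ τ} (h : t = u) : Tm.Conv t u := h ▸ .refl _

/-- Stability under substitution, under weakening and under replacement of a nominal constant are
all special cases. -/
theorem Tm.Conv.gsub {t u : Tm S Γ τ} (h : Tm.Conv t u) :
    ∀ {Δ : List (Ty S.Base)} (f : NomSub S Δ) (θ : Sub S Γ Δ),
      Tm.Conv (t.gsub f θ) (u.gsub f θ) := by
  induction h with
  | refl t => intros; exact .refl _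
  | symm _ ih => intro Δ f θ; exact (ih f θ).symm
  | trans _ _ ih₁ ih₂ => intro Δ f θ; exact (ih₁ f θ).trans (ih₂ f θ)
  | app _ _ ih₁ ih₂ => intro Δ f θ; exact .app (ih₁ f θ) (ih₂ f θ)
  | lam _ ih => intro Δ f θ; exact .lam (ih _ _)
  | beta b a =>
    intro Δ f θ
    rw [Tm.gsub_inst]
    exact .beta _ _
  | eta g =>
    intro Δ f θ
    simp only [Tm.gsub, Tm.gsub_shift_lift]
    exact .eta _

theorem Tm.Conv.subst {t u : Tm S Γ τ} (h : Tm.Conv t u) (θ : Sub S Γ Δ) :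
    Tm.Conv (t.subst θ) (u.subst θ) := by
  simp only [Tm.subst_eq_gsub]
  exact h.gsub _ _

theorem Tm.Conv.shift {t u : Tm S Γ τ} (h : Tm.Conv t u) :
    Tm.Conv (t.shift (σ := σ)) u.shift := by
  rw [Tm.shift_eq_gsub, Tm.shift_eq_gsub]
  exact h.gsub _ _

end Calculus

/-! ## Occurrences of nominal constants -/

section Occurrences

variable {Γ Δ Ξ : List (Ty S.Base)} {σ τ : Ty S.Base} {a : Nom S}

theorem Tm.gsub_congr (t : Tm S Γ τ) : ∀ {Δ : List (Ty S.Base)} {f g : NomSub S Δ}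
    (θ : Sub S Γ Δ), (∀ (τ : Ty S.Base) (n : ℕ), t.Occ (τ, n) → f τ n = g τ n) →
    t.gsub f θ = t.gsub g θ := by
  induction t with
  | var v => intros; rfl
  | con c => intros; rfl
  | nom n => intro Δ f g θ h; exact h _ _ rfl
  | app f a hf ha =>
    intro Δ f g θ h
    simp only [Tm.gsub]
    rw [hf θ fun τ n ho => h τ n (.inl ho), ha θ fun τ n ho => h τ n (.inr ho)]
  | lam b hb =>
    intro Δ f g θ h
    simp only [Tm.gsub]
    rw [hb θ.lift fun τ n ho => by rw [h τ n ho]]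

theorem Tm.occ_rename (t : Tm S Γ τ) : ∀ {Δ : List (Ty S.Base)} (ρ : Ren Γ Δ),
    (t.rename ρ).Occ a ↔ t.Occ a := by
  induction t with
  | var v => intros; rfl
  | con c => intros; rfl
  | nom n => intros; rfl
  | app f a hf ha => intro Δ ρ; simp only [Tm.rename, Tm.Occ, hf, ha]
  | lam b hb => intro Δ ρ; simp only [Tm.rename, Tm.Occ, hb]

theorem Tm.occ_shift (t : Tm S Γ τ) : (t.shift (σ := σ)).Occ a ↔ t.Occ a := Tm.occ_rename ..

theorem Sub.occ_lift {θ : Sub S Γ Δ} (h : Sub.Occ a (θ.lift (σ := σ))) : Sub.Occ a θ := by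
  obtain ⟨τ, v, h⟩ := h
  cases v with
  | z => exact h.elim
  | s v => exact ⟨_, v, (Tm.occ_shift _).1 h⟩

theorem Tm.occ_subst (t : Tm S Γ τ) : ∀ {Δ : List (Ty S.Base)} (θ : Sub S Γ Δ),
    (t.subst θ).Occ a → t.Occ a ∨ Sub.Occ a θ := by
  induction t with
  | var v => intro Δ θ h; exact .inr ⟨_, v, h⟩
  | con c => intro Δ θ h; exact h.elim
  | nom n => intro Δ θ h; exact .inl h
  | app f b hf hb =>
    intro Δ θ h
    rcases h with h | h
    · exact (hf θ h).imp_left .inl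
    · exact (hb θ h).imp_left .inr
  | lam b hb => intro Δ θ h; exact (hb θ.lift h).imp_right Sub.occ_lift

theorem Tm.finite_occ (t : Tm S Γ τ) : {a : Nom S | t.Occ a}.Finite := by
  induction t with
  | var v => exact Set.finite_empty
  | con c => exact Set.finite_empty
  | nom n => exact Set.finite_singleton _
  | app f a hf ha => exact hf.union ha
  | lam b hb => exact hb

theorem Sub.finite_occ : ∀ {Γ : List (Ty S.Base)} (θ : Sub S Γ Δ), {a : Nom S | Sub.Occ a θ}.Finite
  | [], θ => by
    convert Set.finite_empty (α := Nom S)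
    refine Set.eq_empty_iff_forall_notMem.2 ?_
    rintro a ⟨τ, v, _⟩
    cases v
  | τ :: Γ, θ => by
    refine ((Tm.finite_occ (θ .z)).union (Sub.finite_occ fun _ v => θ (.s v))).subset ?_
    rintro a ⟨τ, v, h⟩
    cases v with
    | z => exact .inl h
    | s v => exact .inr ⟨_, v, h⟩

theorem Fm.finite_occ {L : Lang S} (B : Fm L Γ) : {a : Nom S | B.Occ a}.Finite := by
  induction B with
  | top => exact Set.finite_empty
  | bot => exact Set.finite_empty
  | and A B hA hB => exact hA.union hB
  | or A B hA hB => exact hA.union hB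
  | imp A B hA hB => exact hA.union hB
  | all τ B hB => exact hB
  | ex τ B hB => exact hB
  | nab τ B hB => exact hB
  | eq s t => exact (Tm.finite_occ s).union (Tm.finite_occ t)
  | atom p args => exact Sub.finite_occ args

/-- A finite set of nominal constants contains no nominal constant of large index. -/
theorem exists_bound {A : Set (Nom S)} (hA : A.Finite) :
    ∃ N : ℕ, ∀ (τ : Ty S.Base) (n : ℕ), N ≤ n → (τ, n) ∉ A := by
  obtain ⟨N, hN⟩ := (hA.image Prod.snd).bddAbove
  refine ⟨N + 1, fun τ n hn h => ?_⟩
  have := hN ⟨_, h, rfl⟩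
  simp only at this
  omega

/-! ### Replacing a nominal constant by a term -/

open Classical in
/-- The assignment that maps `a` to `t` and all other nominal constants to themselves. -/
noncomputable def NomSub.single (a : Nom S) (t : Tm S Γ a.1) : NomSub S Γ :=
  fun τ n => if h : a = (τ, n) then cast (by rw [h]) t else .nom n

/-- `u[t/a]`, for a nominal constant `a`. -/
noncomputable def Tm.nsub (u : Tm S Γ τ) (a : Nom S) (t : Tm S Γ a.1) : Tm S Γ τ :=
  u.gsub (NomSub.single a t) Sub.id

theorem NomSub.single_self (τ : Ty S.Base) (n : ℕ) (t : Tm S Γ τ) :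
    NomSub.single (τ, n) t τ n = t := by
  simp [NomSub.single]

theorem NomSub.single_of_ne {a : Nom S} (t : Tm S Γ a.1) {n : ℕ} (h : a ≠ (τ, n)) :
    NomSub.single a t τ n = .nom n := by
  simp [NomSub.single, h]

theorem Tm.nsub_self (n : ℕ) (t : Tm S Γ τ) : (Tm.nom n : Tm S Γ τ).nsub (τ, n) t = t :=
  NomSub.single_self _ _ _

theorem Tm.nsub_nom_of_ne (t : Tm S Γ a.1) {n : ℕ} (h : a ≠ (τ, n)) :
    (Tm.nom n : Tm S Γ τ).nsub a t = .nom n := NomSub.single_of_ne t h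

theorem Tm.nsub_of_not_occ (t : Tm S Γ a.1) {u : Tm S Γ τ} (h : ¬ u.Occ a) : u.nsub a t = u := by
  unfold Tm.nsub
  rw [Tm.gsub_congr (g := NomSub.id), Tm.gsub_id]
  intro τ n ho
  exact NomSub.single_of_ne _ fun he => h (he ▸ ho)

theorem Tm.Conv.nsub {u w : Tm S Γ τ} (h : Tm.Conv u w) (a : Nom S) (t : Tm S Γ a.1) :
    Tm.Conv (u.nsub a t) (w.nsub a t) := h.gsub _ _

/-- If `θ` introduced `a`, the right side would replace these new occurrences too. The condition on
`θ` comes from `Fm.Avoids` in the case analysis rules, whenever `a` occurs in the formula analysed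
or in one that is kept. -/
theorem Tm.subst_nsub (u : Tm S Γ τ) (t : Tm S Γ a.1) {θ : Sub S Γ Δ} (h : ¬ Sub.Occ a θ) :
    (u.nsub a t).subst θ = (u.subst θ).nsub a (t.subst θ) := by
  simp only [Tm.nsub, Tm.subst_eq_gsub, Tm.gsub_gsub]
  congr 1
  · funext τ n
    simp only [NomSub.id, Tm.gsub]
    by_cases he : a = (τ, n)
    · subst he
      simp only [NomSub.single_self]
    · simp only [NomSub.single_of_ne _ he, Tm.gsub]; rfl
  · funext τ v
    exact (Tm.nsub_of_not_occ (t.gsub NomSub.id θ) fun ho => h ⟨_, _, ho⟩).symm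

/-- Terms of functional type that agree at a new nominal constant are convertible. -/
theorem Tm.Conv.of_app_nom {t u : Tm S Γ (.arr σ τ)} {n : ℕ} (ht : ¬ t.Occ (σ, n))
    (hu : ¬ u.Occ (σ, n)) (h : Tm.Conv (.app t (.nom n)) (.app u (.nom n))) : Tm.Conv t u := by
  -- Turn the nominal constant into a new variable, abstract over it, and contract by eta on both
  -- sides. Freshness ensures that the two functions themselves are unchanged.
  have key : ∀ w : Tm S Γ (.arr σ τ), ¬ w.Occ (σ, n) →
      (w.shift (σ := σ)).nsub (σ, n) (.var .z) = w.shift := fun w hw =>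
    Tm.nsub_of_not_occ (a := (σ, n)) _ fun ho => hw ((Tm.occ_shift _).1 ho)
  have h' := (h.shift (σ := σ)).nsub (σ, n) (.var .z)
  have e : ∀ w : Tm S Γ (.arr σ τ), ((Tm.app w (.nom n)).shift (σ := σ)).nsub (σ, n) (.var .z) =
      .app (w.shift.nsub (σ, n) (.var .z)) ((Tm.nom n).nsub (σ, n) (.var .z)) := fun _ => rfl
  rw [e, e, Tm.nsub_self, key t ht, key u hu] at h'
  exact (Tm.Conv.eta t).symm.trans (h'.lam.trans (Tm.Conv.eta u))

end Occurrences

/-! ## A set-theoretic model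

Types denote full function spaces over the terms modulo conversion; at the types `o` and `olist` an
element also records an outermost constructor.  The model separates the constructors of `o` and
`olist` and shows that they are injective up to conversion. -/

section Model

variable {X Γ : List (Ty S.Base)} {σ τ : Ty S.Base}

def Tm.convSetoid (X : List (Ty S.Base)) (τ : Ty S.Base) : Setoid (Tm S X τ) where
  r := Tm.Conv
  iseqv := ⟨.refl, .symm, .trans⟩

/-- Terms modulo conversion. -/
abbrev TmQ (X : List (Ty S.Base)) (τ : Ty S.Base) : Type := Quotient (Tm.convSetoid X τ)

def Tm.cls (t : Tm S X τ) : TmQ X τ := Quotient.mk _ t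

theorem Tm.cls_eq {t u : Tm S X τ} : t.cls = u.cls ↔ Tm.Conv t u :=
  Quotient.eq (r := Tm.convSetoid X τ)

/-- The outermost constructor of an element of `o` or `olist`, if any, with its arguments. -/
inductive Tag (X : List (Ty S.Base)) : Type
  | none
  | conj (F G : TmQ X (.o : Ty S.Base))
  | impl (F G : TmQ X (.o : Ty S.Base))
  | sfall (τ : Ty S.Base) (h : τ.IsQuant) (F : TmQ X (.arr τ .o))
  | cons (F : TmQ X (.o : Ty S.Base)) (K : TmQ X (.olist : Ty S.Base))

/-- The tag `d` describes the term `t`. -/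
def Tag.Describes : Tag X → Tm S X τ → Prop
  | .none, _ => True
  | .conj F G, t => ∃ F' G' : Tm S X .o, F'.cls = F ∧ G'.cls = G ∧
      ∃ h : .o = τ, Tm.Conv (h ▸ Tm.conj F' G') t
  | .impl F G, t => ∃ F' G' : Tm S X .o, F'.cls = F ∧ G'.cls = G ∧
      ∃ h : .o = τ, Tm.Conv (h ▸ Tm.impl F' G') t
  | .sfall σ hσ F, t => ∃ F' : Tm S X (.arr σ .o), F'.cls = F ∧
      ∃ h : .o = τ, Tm.Conv (h ▸ Tm.sfall σ hσ F') t
  | .cons F K, t => ∃ (F' : Tm S X .o) (K' : Tm S X .olist), F'.cls = F ∧ K'.cls = K ∧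
      ∃ h : .olist = τ, Tm.Conv (h ▸ Tm.cons F' K') t

theorem Tag.Describes.conv {d : Tag X} {t u : Tm S X τ} (h : Tm.Conv t u) (hd : d.Describes t) :
    d.Describes u := by
  cases d with
  | none => trivial
  | conj F G => obtain ⟨F', G', hF, hG, e, hc⟩ := hd; exact ⟨F', G', hF, hG, e, hc.trans h⟩
  | impl F G => obtain ⟨F', G', hF, hG, e, hc⟩ := hd; exact ⟨F', G', hF, hG, e, hc.trans h⟩
  | sfall σ hσ F => obtain ⟨F', hF, e, hc⟩ := hd; exact ⟨F', hF, e, hc.trans h⟩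
  | cons F K => obtain ⟨F', K', hF, hK, e, hc⟩ := hd; exact ⟨F', K', hF, hK, e, hc.trans h⟩

/-- The model. -/
def Sem (X : List (Ty S.Base)) : Ty S.Base → Type
  | .base b => TmQ X (.base b)
  | .o => TmQ X (.o : Ty S.Base) × Tag X
  | .olist => TmQ X (.olist : Ty S.Base) × Tag X
  | .arr a b => Sem X a → Sem X b

/-- The element `x` of the model represents the term `t`. -/
def Represents : (τ : Ty S.Base) → Sem X τ → Tm S X τ → Prop
  | .base _, x, t => x = t.cls
  | .o, x, t => x.1 = t.cls ∧ x.2.Describes t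
  | .olist, x, t => x.1 = t.cls ∧ x.2.Describes t
  | .arr a b, f, t => ∀ (x : Sem X a) (u : Tm S X a),
      Represents a x u → Represents b (f x) (.app t u)

open Classical in
/-- A term represented by `x`, if there is one. -/
noncomputable def pick (x : Sem X τ) : Tm S X τ :=
  -- The full function spaces contain elements that represent no term. The default for them is
  -- harmless, because `Represents` at a function type tests only arguments that represent some
  -- term.
  if h : ∃ t, Represents τ x t then h.choose else .nom 0

/-- The untagged element representing `t`. -/
noncomputable def liftSem : (τ : Ty S.Base) → Tm S X τ → Sem X τ
  | .base _, t => t.cls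
  | .o, t => (t.cls, .none)
  | .olist, t => (t.cls, .none)
  | .arr _ b, t => fun x => liftSem b (.app t (pick x))

theorem Represents.conv {t u : Tm S X τ} (h : Tm.Conv t u) {x : Sem X τ}
    (hx : Represents τ x t) : Represents τ x u := by
  induction τ with
  | base b => exact hx.trans (Tm.cls_eq.2 h)
  | o => exact ⟨hx.1.trans (Tm.cls_eq.2 h), hx.2.conv h⟩
  | olist => exact ⟨hx.1.trans (Tm.cls_eq.2 h), hx.2.conv h⟩
  | arr a b _ ihb => exact fun y w hy => ihb (.app h (.refl w)) (hx y w hy)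

/-- The two parts need each other. At a function type, existence uses uniqueness in the domain to
compare `pick x` with the given argument. Uniqueness applies both functions to a fresh nominal
constant, whose representative comes from existence in the domain. -/
theorem represents_lift_and_unique (τ : Ty S.Base) :
    (∀ t : Tm S X τ, Represents τ (liftSem τ t) t) ∧
    ∀ (x : Sem X τ) (t u : Tm S X τ), Represents τ x t → Represents τ x u → Tm.Conv t u := by
  induction τ with
  | base b => exact ⟨fun t => rfl, fun x t u ht hu => Tm.cls_eq.1 (ht.symm.trans hu)⟩
  | o => exact ⟨fun t => ⟨rfl, trivial⟩, fun x t u ht hu => Tm.cls_eq.1 (ht.1.symm.trans hu.1)⟩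
  | olist => exact ⟨fun t => ⟨rfl, trivial⟩, fun x t u ht hu => Tm.cls_eq.1 (ht.1.symm.trans hu.1)⟩
  | arr a b iha ihb =>
    refine ⟨fun t x u hx => ?_, fun f t u ht hu => ?_⟩
    · have he : ∃ t, Represents a x t := ⟨u, hx⟩
      have hp : Represents a x (pick x) := by
        unfold pick
        rw [dif_pos he]
        exact he.choose_spec
      exact (ihb.1 _).conv (.app (.refl t) (iha.2 x _ _ hp hx))
    · obtain ⟨n, hn⟩ := exists_bound ((Tm.finite_occ t).union (Tm.finite_occ u))
      have hf := hn a n le_rfl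
      simp only [Set.mem_union, Set.mem_ofPred_eq, not_or] at hf
      exact .of_app_nom hf.1 hf.2
        (ihb.2 _ _ _ (ht _ _ (iha.1 (.nom n))) (hu _ _ (iha.1 (.nom n))))

theorem represents_lift (t : Tm S X τ) : Represents τ (liftSem τ t) t :=
  (represents_lift_and_unique τ).1 t

theorem Represents.unique {x : Sem X τ} {t u : Tm S X τ} (ht : Represents τ x t)
    (hu : Represents τ x u) : Tm.Conv t u := (represents_lift_and_unique τ).2 x t u ht hu

theorem Represents.pick {x : Sem X τ} {t : Tm S X τ} (h : Represents τ x t) :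
    Tm.Conv (pick x) t := by
  have he : ∃ t, Represents τ x t := ⟨t, h⟩
  refine Represents.unique (x := x) ?_ h
  unfold TwoLevel.pick
  rw [dif_pos he]
  exact he.choose_spec

/-- The denotation of a constant. -/
noncomputable def Cst.sem : {τ : Ty S.Base} → Cst S τ → Sem X τ
  | _, .user c => liftSem _ (.con (.user c))
  | _, .conj => fun x y => ((Tm.conj (TwoLevel.pick x) (TwoLevel.pick y)).cls, .conj x.1 y.1)
  | _, .impl => fun x y => ((Tm.impl (TwoLevel.pick x) (TwoLevel.pick y)).cls, .impl x.1 y.1)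
  | _, .forall_ τ h => fun f =>
    ((Tm.sfall τ h (TwoLevel.pick f)).cls, .sfall τ h (TwoLevel.pick f).cls)
  | _, .nil => liftSem _ (.con .nil)
  | _, .cons => fun x y => ((Tm.cons (TwoLevel.pick x) (TwoLevel.pick y)).cls, .cons x.1 y.1)

theorem Represents.cst : ∀ {τ : Ty S.Base} (c : Cst S τ),
    Represents τ (c.sem : Sem X τ) (.con c)
  | _, .user c => represents_lift _
  | _, .conj => fun _ t hx _ u hy =>
      ⟨Tm.cls_eq.2 (.app (.app (.refl _) hx.pick) hy.pick), t, u, hx.1.symm, hy.1.symm, rfl,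
        .refl _⟩
  | _, .impl => fun _ t hx _ u hy =>
      ⟨Tm.cls_eq.2 (.app (.app (.refl _) hx.pick) hy.pick), t, u, hx.1.symm, hy.1.symm, rfl,
        .refl _⟩
  | _, .forall_ τ _ => fun _ t hf =>
      ⟨Tm.cls_eq.2 (.app (.refl _) (Represents.pick hf)), t,
        Tm.cls_eq.2 (Represents.pick hf).symm, rfl, .refl _⟩
  | _, .nil => represents_lift _
  | _, .cons => fun _ t hx _ u hy =>
      ⟨Tm.cls_eq.2 (.app (.app (.refl _) hx.pick) hy.pick), t, u, hx.1.symm, hy.1.symm, rfl,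
        .refl _⟩

/-- Valuations of the free variables. -/
def Val (X Γ : List (Ty S.Base)) : Type := ∀ ⦃τ : Ty S.Base⦄, Var Γ τ → Sem X τ

def Val.cons (x : Sem X σ) (ρ : Val X Γ) : Val X (σ :: Γ)
  | _, .z => x
  | _, .s v => ρ v

/-- The denotation of a term. -/
noncomputable def Tm.eval : {Γ : List (Ty S.Base)} → {τ : Ty S.Base} → Val X Γ → Tm S Γ τ → Sem X τ
  | _, _, ρ, .var v => ρ v
  | _, _, _, .con c => c.sem
  | _, τ, _, .nom n => liftSem τ (.nom n)
  | _, _, ρ, .app f a => f.eval ρ (a.eval ρ)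
  | _, _, ρ, .lam b => fun x => b.eval (Val.cons x ρ)

theorem Val.ext_cons {ρ ρ' : Val X (σ :: Γ)} (hz : ρ (.z : Var (σ :: Γ) σ) = ρ' .z)
    (hs : ∀ (τ : Ty S.Base) (v : Var Γ τ), ρ (.s v) = ρ' (.s v)) : ρ = ρ' := by
  funext τ v
  cases v with
  | z => exact hz
  | s v => exact hs _ v

theorem Tm.eval_rename (t : Tm S Γ τ) : ∀ {Δ : List (Ty S.Base)} (r : Ren Γ Δ) (ρ : Val X Δ),
    (t.rename r).eval ρ = t.eval (fun _ v => ρ (r v)) := by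
  induction t with
  | var v => intros; rfl
  | con c => intros; rfl
  | nom n => intros; rfl
  | app f a hf ha => intro Δ r ρ; simp only [Tm.rename, Tm.eval, hf, ha]
  | lam b hb =>
    intro Δ r ρ
    funext x
    refine (hb _ _).trans (congrArg (fun ρ => b.eval ρ) ?_)
    exact Val.ext_cons rfl fun _ _ => rfl

theorem Tm.eval_shift (t : Tm S Γ τ) (x : Sem X σ) (ρ : Val X Γ) :
    t.shift.eval (Val.cons x ρ) = t.eval ρ := Tm.eval_rename ..

theorem Tm.eval_subst (t : Tm S Γ τ) : ∀ {Δ : List (Ty S.Base)} (θ : Sub S Γ Δ) (ρ : Val X Δ),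
    (t.subst θ).eval ρ = t.eval (fun _ v => (θ v).eval ρ) := by
  induction t with
  | var v => intros; rfl
  | con c => intros; rfl
  | nom n => intros; rfl
  | app f a hf ha => intro Δ θ ρ; simp only [Tm.subst, Tm.eval, hf, ha]
  | lam b hb =>
    intro Δ θ ρ
    funext x
    refine (hb _ _).trans (congrArg (fun ρ => b.eval ρ) ?_)
    exact Val.ext_cons rfl fun _ _ => Tm.eval_shift ..

/-- Full function spaces with extensional equality validate beta and eta at every valuation,
including those with values that represent no term. -/
theorem Tm.Conv.eval {t u : Tm S Γ τ} (h : Tm.Conv t u) : ∀ ρ : Val X Γ, t.eval ρ = u.eval ρ := by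
  induction h with
  | refl t => intro ρ; rfl
  | symm _ ih => intro ρ; exact (ih ρ).symm
  | trans _ _ ih₁ ih₂ => intro ρ; exact (ih₁ ρ).trans (ih₂ ρ)
  | app _ _ ih₁ ih₂ => intro ρ; simp only [Tm.eval, ih₁, ih₂]
  | lam _ ih => intro ρ; funext x; exact ih _
  | beta b a =>
    intro ρ
    refine Eq.trans ?_ (Tm.eval_subst b _ ρ).symm
    refine congrArg (fun ρ => b.eval ρ) ?_
    exact Val.ext_cons rfl fun _ _ => rfl
  | eta f =>
    intro ρ
    funext x
    exact congrFun (Tm.eval_shift f x ρ) x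

/-- The fundamental lemma of the logical relation `Represents`. At an abstraction, `Represents.conv`
absorbs the beta step. -/
theorem represents_eval (t : Tm S Γ τ) : ∀ (ρ : Val X Γ) (θ : Sub S Γ X),
    (∀ (τ : Ty S.Base) (v : Var Γ τ), Represents τ (ρ v) (θ v)) →
    Represents τ (t.eval ρ) (t.subst θ) := by
  induction t with
  | var v => intro ρ θ h; exact h _ v
  | con c => intro ρ θ h; exact Represents.cst c
  | nom n => intro ρ θ h; exact represents_lift _
  | app f a hf ha => intro ρ θ h; exact hf ρ θ h _ _ (ha ρ θ h)
  | lam b hb =>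
    intro ρ θ h x u hx
    refine Represents.conv ?_ (hb (Val.cons x ρ) (Sub.cons u θ) ?_)
    · refine .trans (.of_eq ?_) (Tm.Conv.beta _ _).symm
      rw [Tm.inst, Tm.subst_subst, Sub.lift_comp_cons, Sub.comp_id]
    · intro τ v
      cases v with
      | z => exact hx
      | s v => exact h _ v

/-- The valuation that represents every variable by itself. -/
noncomputable def Val.std (X : List (Ty S.Base)) : Val X X := fun _ v => liftSem _ (.var v)

theorem represents_std (t : Tm S X τ) : Represents τ (t.eval (Val.std X)) t := by
  have := represents_eval t (Val.std X) Sub.id fun _ _ => represents_lift _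
  rwa [Tm.subst_id] at this

/-- The outermost constructor of a formula of the specification logic. -/
noncomputable def Tm.tag (F : Tm S X .o) : Tag X := (F.eval (Val.std X) : TmQ X .o × Tag X).2

/-- The outermost constructor of a list. -/
noncomputable def Tm.listTag (K : Tm S X .olist) : Tag X :=
  (K.eval (Val.std X) : TmQ X .olist × Tag X).2

/-- The tag is read off the denotation, so it is an invariant of conversion. Injectivity and
disjointness of the logical constants follow by comparing tags. -/
theorem Tm.Conv.tag {F G : Tm S X .o} (h : Tm.Conv F G) : F.tag = G.tag :=
  congrArg Prod.snd (h.eval (Val.std X))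

theorem Tm.describes_tag (F : Tm S X .o) : F.tag.Describes F := (represents_std F).2

theorem fst_eval (F : Tm S X .o) : (F.eval (Val.std X) : TmQ X .o × Tag X).1 = F.cls :=
  (represents_std F).1

theorem Tm.tag_conj (F G : Tm S X .o) : (Tm.conj F G).tag = .conj F.cls G.cls := by
  rw [← fst_eval F, ← fst_eval G]; rfl

theorem Tm.tag_impl (F G : Tm S X .o) : (Tm.impl F G).tag = .impl F.cls G.cls := by
  rw [← fst_eval F, ← fst_eval G]; rfl

theorem Tm.tag_sfall (h : τ.IsQuant) (F : Tm S X (.arr τ .o)) :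
    (Tm.sfall τ h F).tag = .sfall τ h F.cls := by
  have : F.cls = (TwoLevel.pick (F.eval (Val.std X))).cls :=
    Tm.cls_eq.2 (represents_std F).pick.symm
  rw [this]; rfl

theorem Tm.listTag_cons (F : Tm S X .o) (K : Tm S X .olist) :
    (Tm.cons F K).listTag = .cons F.cls K.cls := by
  rw [← fst_eval F, ← (represents_std K).1]; rfl

/-! ### Injectivity of the constructors -/

theorem Tm.Conv.conj_inj {F G F' G' : Tm S X .o} (h : Tm.Conv (Tm.conj F G) (Tm.conj F' G')) :
    Tm.Conv F F' ∧ Tm.Conv G G' := by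
  have := h.tag
  simpa only [Tm.tag_conj, Tag.conj.injEq, Tm.cls_eq] using this

theorem Tm.Conv.impl_inj {F G F' G' : Tm S X .o} (h : Tm.Conv (Tm.impl F G) (Tm.impl F' G')) :
    Tm.Conv F F' ∧ Tm.Conv G G' := by
  have := h.tag
  simpa only [Tm.tag_impl, Tag.impl.injEq, Tm.cls_eq] using this

theorem Tm.Conv.sfall_inj {hσ : σ.IsQuant} {hτ : τ.IsQuant} {F : Tm S X (.arr σ .o)}
    {G : Tm S X (.arr τ .o)} (h : Tm.Conv (Tm.sfall σ hσ F) (Tm.sfall τ hτ G)) :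
    ∃ e : σ = τ, Tm.Conv (e ▸ F) G := by
  have := h.tag
  simp only [Tm.tag_sfall, Tag.sfall.injEq] at this
  obtain ⟨rfl, h⟩ := this
  exact ⟨rfl, Tm.cls_eq.1 (eq_of_heq h)⟩

theorem Tm.Conv.cons_inj {F F' : Tm S X .o} {K K' : Tm S X .olist}
    (h : Tm.Conv (Tm.cons F K) (Tm.cons F' K')) : Tm.Conv F F' ∧ Tm.Conv K K' := by
  have : (Tm.cons F K).listTag = (Tm.cons F' K').listTag :=
    congrArg Prod.snd (h.eval (Val.std X))
  simpa only [Tm.listTag_cons, Tag.cons.injEq, Tm.cls_eq] using this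

theorem Tm.not_conv_conj_impl {F G F' G' : Tm S X .o} :
    ¬ Tm.Conv (Tm.conj F G) (Tm.impl F' G') := fun h => by
  have := h.tag
  simp [Tm.tag_conj, Tm.tag_impl] at this

theorem Tm.not_conv_conj_sfall {F G : Tm S X .o} {hτ : τ.IsQuant} {H : Tm S X (.arr τ .o)} :
    ¬ Tm.Conv (Tm.conj F G) (Tm.sfall τ hτ H) := fun h => by
  have := h.tag
  simp [Tm.tag_conj, Tm.tag_sfall] at this

theorem Tm.not_conv_impl_sfall {F G : Tm S X .o} {hτ : τ.IsQuant} {H : Tm S X (.arr τ .o)} :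
    ¬ Tm.Conv (Tm.impl F G) (Tm.sfall τ hτ H) := fun h => by
  have := h.tag
  simp [Tm.tag_impl, Tm.tag_sfall] at this

/-! ### Replacing a nominal constant keeps the outermost constructor -/

/-- Two tags have the same constructor. -/
def Tag.Same : Tag X → Tag X → Prop
  | .none, .none => True
  | .conj _ _, .conj _ _ => True
  | .impl _ _, .impl _ _ => True
  | .sfall σ _ _, .sfall τ _ _ => σ = τ
  | .cons _ _, .cons _ _ => True
  | _, _ => False

/-- The logical relation generated by the equality of outermost constructors at type `o`. -/
def Similar : (τ : Ty S.Base) → Sem X τ → Sem X τ → Prop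
  | .base _, _, _ => True
  | .o, x, y => x.2.Same y.2
  | .olist, _, _ => True
  | .arr a b, f, g => ∀ x y : Sem X a, Similar a x y → Similar b (f x) (g y)

theorem similar_lift (t u : Tm S X τ) : Similar τ (liftSem τ t) (liftSem τ u) := by
  induction τ with
  | base b => trivial
  | o => trivial
  | olist => trivial
  | arr a b _ ihb => exact fun x y _ => ihb _ _

/-- The relation at a function type bottoms out at the target, where it is trivial unless the target
is `o`. This is where the restriction on the type in the instantiation formula enters. -/
theorem similar_of_target_ne (h : τ.target ≠ .o) (x y : Sem X τ) : Similar τ x y := by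
  induction τ with
  | base b => trivial
  | o => exact absurd rfl h
  | olist => trivial
  | arr a b _ ihb => exact fun u w _ => ihb h _ _

theorem Cst.similar : ∀ {τ : Ty S.Base} (c : Cst S τ), Similar τ (c.sem : Sem X τ) c.sem
  | _, .user _ => similar_lift _ _
  | _, .conj => fun _ _ _ _ _ _ => trivial
  | _, .impl => fun _ _ _ _ _ _ => trivial
  | _, .forall_ _ _ => fun _ _ _ => rfl
  | _, .nil => trivial
  | _, .cons => fun _ _ _ _ _ _ => trivial

/-- The fundamental lemma for `Similar`, relating a term to its image when nominal constants and
variables are mapped to similar values. -/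
theorem Tm.similar_gsub (t : Tm S Γ τ) : ∀ {Δ : List (Ty S.Base)} (f : NomSub S Δ) (θ : Sub S Γ Δ)
    (ρ : Val X Γ) (ρ' : Val X Δ),
    (∀ (τ : Ty S.Base) (v : Var Γ τ), Similar τ (ρ v) ((θ v).eval ρ')) →
    (∀ (τ : Ty S.Base) (n : ℕ), Similar τ (liftSem τ (.nom n)) ((f τ n).eval ρ')) →
    Similar τ (t.eval ρ) ((t.gsub f θ).eval ρ') := by
  induction t with
  | var v => intro Δ f θ ρ ρ' hθ _; exact hθ _ v
  | con c => intros; exact c.similar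
  | nom n => intro Δ f θ ρ ρ' _ hf; exact hf _ n
  | app g a hg ha => intro Δ f θ ρ ρ' hθ hf; exact hg f θ ρ ρ' hθ hf _ _ (ha f θ ρ ρ' hθ hf)
  | lam b hb =>
    intro Δ f θ ρ ρ' hθ hf x y hxy
    refine hb _ _ _ _ ?_ ?_
    · intro τ v
      cases v with
      | z => exact hxy
      | s v =>
        refine (congrArg (Similar _ _) (Tm.eval_shift (θ v) y ρ')).mpr (hθ _ v)
    · intro τ n
      exact (congrArg (Similar _ _) (Tm.eval_shift (f τ n) y ρ')).mpr (hf τ n)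

theorem Tm.same_tag_nsub (a : Nom S) (ha : a.1.target ≠ .o) (t : Tm S X a.1) (F : Tm S X .o) :
    F.tag.Same (F.nsub a t).tag := by
  refine Tm.similar_gsub F (NomSub.single a t) Sub.id (Val.std X) (Val.std X) (fun τ v => ?_)
    (fun τ n => ?_)
  · exact similar_lift _ _
  · by_cases h : a = (τ, n)
    · subst h
      exact similar_of_target_ne ha _ _
    · rw [NomSub.single_of_ne t h]
      exact similar_lift _ _

/-- The replacement cannot create a conjunction: `F` has a tag with the same constructor, and its
tag describes `F` itself. -/
theorem Tm.conv_conj_of_nsub {a : Nom S} (ha : a.1.target ≠ .o) {t : Tm S X a.1}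
    {F G H : Tm S X .o} (h : Tm.Conv (F.nsub a t) (Tm.conj G H)) :
    ∃ G' H' : Tm S X .o, Tm.Conv F (Tm.conj G' H') := by
  have hs := Tm.same_tag_nsub a ha t F
  have hd := Tm.describes_tag F
  rw [h.tag, Tm.tag_conj] at hs
  revert hs hd
  cases F.tag with
  | conj _ _ => rintro - ⟨G', H', -, -, e, hc⟩; exact ⟨G', H', Tm.Conv.symm hc⟩
  | _ => exact fun hs => hs.elim

theorem Tm.conv_impl_of_nsub {a : Nom S} (ha : a.1.target ≠ .o) {t : Tm S X a.1}
    {F G H : Tm S X .o} (h : Tm.Conv (F.nsub a t) (Tm.impl G H)) :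
    ∃ G' H' : Tm S X .o, Tm.Conv F (Tm.impl G' H') := by
  have hs := Tm.same_tag_nsub a ha t F
  have hd := Tm.describes_tag F
  rw [h.tag, Tm.tag_impl] at hs
  revert hs hd
  cases F.tag with
  | impl _ _ => rintro - ⟨G', H', -, -, e, hc⟩; exact ⟨G', H', Tm.Conv.symm hc⟩
  | _ => exact fun hs => hs.elim

theorem Tm.conv_sfall_of_nsub {a : Nom S} (ha : a.1.target ≠ .o) {t : Tm S X a.1}
    {F : Tm S X .o} {hτ : τ.IsQuant} {H : Tm S X (.arr τ .o)}
    (h : Tm.Conv (F.nsub a t) (Tm.sfall τ hτ H)) :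
    ∃ H' : Tm S X (.arr τ .o), Tm.Conv F (Tm.sfall τ hτ H') := by
  have hs := Tm.same_tag_nsub a ha t F
  have hd := Tm.describes_tag F
  rw [h.tag, Tm.tag_sfall] at hs
  revert hs hd
  cases F.tag with
  | sfall σ _ _ => rintro (rfl : σ = τ) ⟨H', -, e, hc⟩; exact ⟨H', Tm.Conv.symm hc⟩
  | _ => exact fun hs => hs.elim

end Model

/-! ## Derived rules of the reasoning logic -/

section DerivedRules

variable {L : Lang S} {D : Defn L} {X X' Γ Δ Ξ : List (Ty S.Base)} {σ τ : Ty S.Base}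

theorem Tm.perm_one (t : Tm S Γ τ) : t.perm (fun _ => 1) = t := by
  induction t with
  | var v => rfl
  | con c => rfl
  | nom n => rfl
  | app f a hf ha => simp only [Tm.perm, hf, ha]
  | lam b hb => simp only [Tm.perm, hb]

theorem Fm.perm_one (B : Fm L Γ) : B.perm (fun _ => 1) = B := by
  induction B with
  | top => rfl
  | bot => rfl
  | and A B hA hB => simp only [Fm.perm, hA, hB]
  | or A B hA hB => simp only [Fm.perm, hA, hB]
  | imp A B hA hB => simp only [Fm.perm, hA, hB]
  | all τ B hB => simp only [Fm.perm, hB]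
  | ex τ B hB => simp only [Fm.perm, hB]
  | nab τ B hB => simp only [Fm.perm, hB]
  | eq s t => simp only [Fm.perm, Tm.perm_one]
  | atom p args => simp only [Fm.perm, Tm.perm_one]

theorem Fm.Conv.refl (B : Fm L Γ) : Fm.Conv B B := by
  induction B with
  | top => exact .top
  | bot => exact .bot
  | and A B hA hB => exact .and hA hB
  | or A B hA hB => exact .or hA hB
  | imp A B hA hB => exact .imp hA hB
  | all τ B hB => exact .all hB
  | ex τ B hB => exact .ex hB
  | nab τ B hB => exact .nab hB
  | eq s t => exact .eq (.refl _) (.refl _)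
  | atom p args => exact .atom p fun _ _ => .refl _

theorem Fm.Conv.equi {B C : Fm L Γ} (h : Fm.Conv B C) : Fm.Equi B C :=
  ⟨fun _ => 1, by rwa [Fm.perm_one]⟩

theorem Fm.Equi.refl (B : Fm L Γ) : Fm.Equi B B := (Fm.Conv.refl B).equi

theorem Fm.subst_subst (B : Fm L Γ) : ∀ {Δ Ξ : List (Ty S.Base)} (θ : Sub S Γ Δ) (η : Sub S Δ Ξ),
    (B.subst θ).subst η = B.subst (θ.comp η) := by
  induction B with
  | top => intros; rfl
  | bot => intros; rfl
  | and A B hA hB => intro Δ Ξ θ η; simp only [Fm.subst, hA, hB]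
  | or A B hA hB => intro Δ Ξ θ η; simp only [Fm.subst, hA, hB]
  | imp A B hA hB => intro Δ Ξ θ η; simp only [Fm.subst, hA, hB]
  | all τ B hB => intro Δ Ξ θ η; simp only [Fm.subst, hB, Sub.lift_comp_lift]
  | ex τ B hB => intro Δ Ξ θ η; simp only [Fm.subst, hB, Sub.lift_comp_lift]
  | nab τ B hB => intro Δ Ξ θ η; simp only [Fm.subst, hB, Sub.lift_comp_lift]
  | eq s t => intro Δ Ξ θ η; simp only [Fm.subst, Tm.subst_subst]
  | atom p args => intro Δ Ξ θ η; simp only [Fm.subst, Sub.comp_assoc]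

theorem Sub.lift_id : (Sub.id : Sub S Γ Γ).lift (σ := σ) = Sub.id := Sub.ext_cons rfl fun _ _ => rfl

theorem Fm.subst_id (B : Fm L Γ) : B.subst Sub.id = B := by
  induction B with
  | top => rfl
  | bot => rfl
  | and A B hA hB => simp only [Fm.subst, hA, hB]
  | or A B hA hB => simp only [Fm.subst, hA, hB]
  | imp A B hA hB => simp only [Fm.subst, hA, hB]
  | all τ B hB => simp only [Fm.subst, Sub.lift_id, hB]
  | ex τ B hB => simp only [Fm.subst, Sub.lift_id, hB]
  | nab τ B hB => simp only [Fm.subst, Sub.lift_id, hB]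
  | eq s t => simp only [Fm.subst, Tm.subst_id]
  | atom p args => simp only [Fm.subst, Sub.comp_id]

theorem Fm.subst_lift_cons (B : Fm L (τ :: Γ)) (u : Sub S Γ Δ) (t : Tm S Ξ τ) (θ : Sub S Δ Ξ) :
    (B.subst u.lift).subst (Sub.cons t θ) = B.subst (Sub.cons t (u.comp θ)) := by
  rw [Fm.subst_subst, Sub.lift_comp_cons]

theorem Fm.inst_subst_lift (B : Fm L (τ :: Γ)) (u : Sub S Γ Δ) (t : Tm S Δ τ) :
    (B.subst u.lift).inst t = B.subst (Sub.cons t u) := by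
  rw [Fm.inst, Fm.subst_lift_cons, Sub.comp_id]

theorem Fm.exists_support (B : Fm L Γ) :
    ∃ cs : List (Nom S), cs.Nodup ∧ ∀ a, a ∈ cs ↔ Fm.Occ a B := by
  classical
  refine ⟨(Fm.finite_occ B).toFinset.toList, Finset.nodup_toList _, fun a => ?_⟩
  simp

namespace Der

/-- Enlarging a context only restricts the substitutions for which `eqL` and `defL` demand a
premise, because more formulas must be avoided. -/
theorem weaken {Θ : List (Fm L X)} {C : Fm L X} (h : Der D X Θ C) :
    ∀ {Θ' : List (Fm L X)}, Θ ⊆ Θ' → Der D X Θ' C := by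
  induction h with
  | id hB he => intro Θ' hs; exact .id (hs hB) he
  | cut _ he _ ih₁ ih₂ => intro Θ' hs; exact .cut (ih₁ hs) he (ih₂ (List.cons_subset_cons _ hs))
  | topR => intros; exact .topR
  | botL hB => intro Θ' hs; exact .botL (hs hB)
  | andR _ _ ih₁ ih₂ => intro Θ' hs; exact .andR (ih₁ hs) (ih₂ hs)
  | andL hB _ ih =>
    intro Θ' hs
    exact .andL (hs hB) (ih (List.cons_subset_cons _ (List.cons_subset_cons _ hs)))
  | orR₁ _ ih => intro Θ' hs; exact .orR₁ (ih hs)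
  | orR₂ _ ih => intro Θ' hs; exact .orR₂ (ih hs)
  | orL hB _ _ ih₁ ih₂ =>
    intro Θ' hs
    exact .orL (hs hB) (ih₁ (List.cons_subset_cons _ hs)) (ih₂ (List.cons_subset_cons _ hs))
  | impR _ ih => intro Θ' hs; exact .impR (ih (List.cons_subset_cons _ hs))
  | impL hB _ _ ih₁ ih₂ =>
    intro Θ' hs
    exact .impL (hs hB) (ih₁ hs) (ih₂ (List.cons_subset_cons _ hs))
  | allL t hB _ ih => intro Θ' hs; exact .allL t (hs hB) (ih (List.cons_subset_cons _ hs))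
  | allR cs hn hc _ ih => intro Θ' hs; exact .allR cs hn hc (ih (List.map_subset _ hs))
  | exL cs hB hn hc _ ih =>
    intro Θ' hs
    exact .exL cs (hs hB) hn hc (ih (List.cons_subset_cons _ (List.map_subset _ hs)))
  | exR t _ ih => intro Θ' hs; exact .exR t (ih hs)
  | nabL n hB hn _ ih => intro Θ' hs; exact .nabL n (hs hB) hn (ih (List.cons_subset_cons _ hs))
  | nabR n hn _ ih => intro Θ' hs; exact .nabR n hn (ih hs)
  | eqR h => intros; exact .eqR h
  | eqL hB _ ih =>
    intro Θ' hs
    exact .eqL (hs hB) fun X' θ ha hC hc => ih X' θ (fun B hB => ha B (hs hB)) hC hc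
      (List.map_subset _ hs)
  | defR p c u d hc hm _ ih => intro Θ' hs; exact .defR p c u d hc hm (ih hs)
  | defL p hB _ ih =>
    intro Θ' hs
    exact .defL p (hs hB) fun c hc X' θ u d ha hC hm =>
      ih c hc X' θ u d (fun B hB => ha B (hs hB)) hC hm
        (List.cons_subset_cons _ (List.map_subset _ hs))
  | ind p I hB hI hcl _ _ ih =>
    intro Θ' hs
    exact .ind p I (hs hB) hI hcl (ih (List.cons_subset_cons _ hs))

variable {Θ Hs : List (Fm L X)} {A B C : Fm L X}

theorem ax (h : B ∈ Θ) : Der D X Θ B := .id h (.refl B)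

theorem cut' (h : Der D X Θ B) (h' : Der D X (B :: Θ) C) : Der D X Θ C := .cut h (.refl B) h'

theorem of_list : ∀ {Hs Θ : List (Fm L X)}, (∀ B ∈ Hs, Der D X Θ B) →
    Der D X (Hs ++ Θ) C → Der D X Θ C
  | [], _, _, h => h
  | B :: Hs, Θ, hHs, h => by
    refine cut' (hHs B (.head _)) (of_list (Hs := Hs) (fun A hA => ?_) (h.weaken ?_))
    · exact (hHs A (.tail _ hA)).weaken (List.subset_cons_self _ _)
    · intro A
      simp only [List.cons_append, List.mem_cons, List.mem_append]
      tauto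

/-- Cut against finitely many derivable formulas. -/
theorem cut_list (hHs : ∀ B ∈ Hs, Der D X Θ B) (h : Der D X Hs C) : Der D X Θ C :=
  of_list hHs (h.weaken (List.subset_append_left _ _))

theorem conv (h : Der D X Θ B) (hc : Fm.Conv B C) : Der D X Θ C := cut' h (.id (.head _) hc.equi)

theorem bot_elim (h : Der D X Θ .bot) : Der D X Θ C := cut' h (.botL (.head _))

theorem and_left (h : Der D X Θ (.and A B)) : Der D X Θ A :=
  cut' h (.andL (.head _) (ax (.head _)))

theorem and_right (h : Der D X Θ (.and A B)) : Der D X Θ B :=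
  cut' h (.andL (.head _) (ax (.tail _ (.head _))))

theorem or_elim (h : Der D X Θ (.or A B)) (hA : Der D X (A :: Θ) C) (hB : Der D X (B :: Θ) C) :
    Der D X Θ C :=
  cut' h (.orL (.head _)
    (hA.weaken (List.cons_subset_cons _ (List.subset_cons_self _ _)))
    (hB.weaken (List.cons_subset_cons _ (List.subset_cons_self _ _))))

theorem imp_elim (h : Der D X Θ (.imp A B)) (hA : Der D X Θ A) : Der D X Θ B :=
  cut' h (.impL (.head _) (hA.weaken (List.subset_cons_self _ _)) (ax (.head _)))

/-- The body and the substitution are kept apart because unfolding a clause yields its body under a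
substitution. Nested quantifiers then just extend `u` by one term at a time. -/
theorem all_elim {B : Fm L (τ :: Γ)} {u : Sub S Γ X} (t : Tm S X τ)
    (h : Der D X Θ ((Fm.all τ B).subst u)) : Der D X Θ (B.subst (Sub.cons t u)) := by
  refine cut' h (.allL t (.head _) ?_)
  rw [Fm.inst_subst_lift]
  exact ax (.head _)

theorem ex_intro {B : Fm L (τ :: Γ)} {u : Sub S Γ X} (t : Tm S X τ)
    (h : Der D X Θ (B.subst (Sub.cons t u))) : Der D X Θ ((Fm.ex τ B).subst u) := by
  refine .exR t ?_
  rwa [Fm.inst_subst_lift]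

theorem nab_elim {B : Fm L (τ :: Γ)} {u : Sub S Γ X} {n : ℕ}
    (hn : ¬ Fm.Occ ((τ, n) : Nom S) (B.subst u.lift))
    (h : Der D X Θ ((Fm.nab τ B).subst u)) : Der D X Θ (B.subst (Sub.cons (.nom n) u)) := by
  refine cut' h (.nabL n (.head _) hn ?_)
  rw [Fm.inst_subst_lift]
  exact ax (.head _)

theorem nab_intro {B : Fm L (τ :: Γ)} {u : Sub S Γ X} {n : ℕ}
    (hn : ¬ Fm.Occ ((τ, n) : Nom S) (B.subst u.lift))
    (h : Der D X Θ (B.subst (Sub.cons (.nom n) u))) : Der D X Θ ((Fm.nab τ B).subst u) := by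
  refine .nabR n hn ?_
  rwa [Fm.inst_subst_lift]

theorem not_occ_wk (a : Nom S) : ¬ Sub.Occ a (Sub.wk : Sub S Γ (σ :: Γ)) := by
  rintro ⟨_, _, h⟩
  exact h

/-- Introduction of `∀`, keeping the derivable formulas `Hs`. -/
theorem all_intro {B : Fm L (τ :: Γ)} {u : Sub S Γ X} (Hs : List (Fm L X))
    (hHs : ∀ B ∈ Hs, Der D X Θ B)
    (h : ∀ (X' : List (Ty S.Base)) (θ : Sub S X X') (t : Tm S X' τ) (Θ' : List (Fm L X')),
      (∀ a : Nom S, ¬ Sub.Occ a θ) → (∀ B ∈ Hs, Der D X' Θ' (B.subst θ)) →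
      Der D X' Θ' (B.subst (Sub.cons t (u.comp θ)))) :
    Der D X Θ ((Fm.all τ B).subst u) := by
  -- The cut turns the derivable formulas `Hs` into members of the context, which the rule itself
  -- substitutes into. Closure of derivability under substitution is thus never needed.
  refine cut_list hHs ?_
  obtain ⟨cs, hn, hc⟩ := (B.subst u.lift).exists_support
  refine .allR cs hn hc ?_
  rw [Fm.raised, Fm.subst_lift_cons]
  -- The hypothesis covers an arbitrary term, so the raised eigenvariable applied to the support is
  -- one instance and raising disappears from later proofs.
  exact h _ Sub.wk _ _ not_occ_wk fun B hB => ax (List.mem_map_of_mem hB)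

/-- Elimination of `∃`, keeping the derivable formulas `Hs`. -/
theorem ex_elim {B : Fm L (τ :: Γ)} {u : Sub S Γ X} (Hs : List (Fm L X))
    (hHs : ∀ B ∈ Hs, Der D X Θ B) (hex : Der D X Θ ((Fm.ex τ B).subst u))
    (h : ∀ (X' : List (Ty S.Base)) (θ : Sub S X X') (t : Tm S X' τ) (Θ' : List (Fm L X')),
      (∀ a : Nom S, ¬ Sub.Occ a θ) → (∀ B ∈ Hs, Der D X' Θ' (B.subst θ)) →
      Der D X' Θ' (B.subst (Sub.cons t (u.comp θ))) → Der D X' Θ' (C.subst θ)) :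
    Der D X Θ C := by
  refine cut_list (Hs := (Fm.ex τ B).subst u :: Hs) ?_ ?_
  · simpa using ⟨hex, hHs⟩
  · obtain ⟨cs, hn, hc⟩ := (B.subst u.lift).exists_support
    refine .exL cs (.head _) hn hc ?_
    rw [Fm.raised, Fm.subst_lift_cons]
    exact h _ Sub.wk _ _ not_occ_wk
      (fun B hB => ax (.tail _ (List.mem_map_of_mem (.tail _ hB)))) (ax (.head _))

/-- Case analysis on an atom, keeping the derivable formulas `Hs`. -/
theorem def_elim_avoids (p : L.Pred) {args : Sub S (L.ar p) X} (Hs : List (Fm L X))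
    (hHs : ∀ B ∈ Hs, Der D X Θ B) (hp : Der D X Θ (.atom p args))
    (h : ∀ c ∈ D.clauses p, ∀ (X' : List (Ty S.Base)) (θ : Sub S X X') (u : Sub S c.xs X')
      (d : NomChoice c.zs) (Θ' : List (Fm L X')), Fm.Avoids θ (.atom p args : Fm L X) →
      (∀ B ∈ Hs, Fm.Avoids θ B) → c.Matches u d (args.comp θ) →
      (∀ B ∈ Hs, Der D X' Θ' (B.subst θ)) →
      Der D X' Θ' (c.body.subst u) → Der D X' Θ' (C.subst θ)) :
    Der D X Θ C := by
  refine cut_list (Hs := .atom p args :: Hs) ?_ ?_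
  · simpa using ⟨hp, hHs⟩
  · exact .defL p (.head _) fun c hc X' θ u d ha _ hm =>
      h c hc X' θ u d _ (ha _ (.head _)) (fun B hB => ha B (.tail _ hB)) hm
        (fun B hB => ax (.tail _ (List.mem_map_of_mem (.tail _ hB)))) (ax (.head _))

theorem def_elim (p : L.Pred) {args : Sub S (L.ar p) X} (Hs : List (Fm L X))
    (hHs : ∀ B ∈ Hs, Der D X Θ B) (hp : Der D X Θ (.atom p args))
    (h : ∀ c ∈ D.clauses p, ∀ (X' : List (Ty S.Base)) (θ : Sub S X X') (u : Sub S c.xs X')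
      (d : NomChoice c.zs) (Θ' : List (Fm L X')), Fm.Avoids θ (.atom p args : Fm L X) →
      c.Matches u d (args.comp θ) → (∀ B ∈ Hs, Der D X' Θ' (B.subst θ)) →
      Der D X' Θ' (c.body.subst u) → Der D X' Θ' (C.subst θ)) :
    Der D X Θ C :=
  def_elim_avoids p Hs hHs hp fun c hc X' θ u d Θ' ha _ => h c hc X' θ u d Θ' ha

/-- Case analysis on an equation, keeping the derivable formulas `Hs`. -/
theorem eq_elim {s t : Tm S X τ} (Hs : List (Fm L X)) (hHs : ∀ B ∈ Hs, Der D X Θ B)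
    (he : Der D X Θ (.eq s t))
    (h : ∀ (X' : List (Ty S.Base)) (θ : Sub S X X') (Θ' : List (Fm L X')),
      (∀ B ∈ Hs, Fm.Avoids θ B) → Tm.Conv (s.subst θ) (t.subst θ) →
      (∀ B ∈ Hs, Der D X' Θ' (B.subst θ)) → Der D X' Θ' (C.subst θ)) :
    Der D X Θ C := by
  refine cut_list (Hs := .eq s t :: Hs) ?_ ?_
  · simpa using ⟨he, hHs⟩
  · exact .eqL (.head _) fun X' θ ha _ hc =>
      h X' θ _ (fun B hB => ha B (.tail _ hB)) hc
        (fun B hB => ax (List.mem_map_of_mem (.tail _ hB)))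

theorem hyps_one (hA : Der D X Θ A) : ∀ F ∈ [A], Der D X Θ F := by simpa using hA

theorem hyps_two (hA : Der D X Θ A) (hB : Der D X Θ B) : ∀ F ∈ [A, B], Der D X Θ F := by
  simpa using ⟨hA, hB⟩

theorem hyps_three (hA : Der D X Θ A) (hB : Der D X Θ B) (hC : Der D X Θ C) :
    ∀ F ∈ [A, B, C], Der D X Θ F := by simpa using ⟨hA, hB, hC⟩

theorem hyps_four {E : Fm L X} (hA : Der D X Θ A) (hB : Der D X Θ B) (hC : Der D X Θ C)
    (hE : Der D X Θ E) : ∀ F ∈ [A, B, C, E], Der D X Θ F := by simpa using ⟨hA, hB, hC, hE⟩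

end Der

end DerivedRules

/-! ## Auxiliary definitions -/

/-- The auxiliary predicates: derivations of bounded height (`memh`, `seqh`, `bch`) and of some
height (`memAny`, `seqAny`, `bcAny`); immediate components of formulas (`dec`, `isImp`); inclusion
of lists (`sub`);
reducibility of goals (`red true`) and of hypotheses (`red false`) up to a given depth, with the
reducibility of the members of a context (`hyp`, `env`); and usability as a hypothesis (`ne`). -/
inductive AuxPred : Type
  | memh (h : ℕ) | memAny | seqh (h : ℕ) | bch (h : ℕ) | seqAny | bcAny
  | dec | isImp | sub | red (b : Bool) (k : ℕ)
  | hyp (h N : ℕ) | env (h N : ℕ) | ne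

def AuxPred.ar (S : HHSig) : AuxPred → List (Ty S.Base)
  | .memh _ => [.o, .olist]
  | .memAny => [.o, .olist]
  | .seqh _ => [.olist, .o]
  | .bch _ => [.olist, .o, .o]
  | .seqAny => [.olist, .o]
  | .bcAny => [.olist, .o, .o]
  | .dec => [.o, .o]
  | .isImp => [.o, .o, .o]
  | .sub => [.olist, .olist]
  | .red _ _ => [.olist, .o]
  | .hyp _ _ => [.olist, .o]
  | .env _ _ => [.olist, .olist]
  | .ne => [.olist, .o]

/-- Levels other than 0 and 2 keep the auxiliary predicates out of the simultaneous inductions with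
`member` and with `seq`. An atom to the left of an implication costs one level, hence level 1 for
`sub`, level 3 for `ne` and the growth with `k` for `red`. The predicates `hyp` and `env` sit at the
level of the deepest `red` that they may use. -/
def AuxPred.lvl : AuxPred → ℕ
  | .dec => 1
  | .isImp => 1
  | .sub => 1
  | .red _ k => 3 + k
  | .hyp _ N => 3 + N
  | .env _ N => 3 + N
  | _ => 3

variable (S) in
/-- The language of the auxiliary predicates. -/
abbrev auxLang : Lang S where
  Pred := AuxPred
  ar := AuxPred.ar S

section Atoms

variable {Γ : List (Ty S.Base)}

variable (S) in
abbrev XFm (Γ : List (Ty S.Base)) : Type := Fm (hhLang (auxLang S)) Γ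

/-- `E` is one of the first `h + 1` members of `K`. -/
def memh (h : ℕ) (E : Tm S Γ .o) (K : Tm S Γ .olist) : XFm S Γ :=
  .atom (.inr (.memh h)) (Sub.cons E (Sub.cons K Sub.nil))

def memAny (E : Tm S Γ .o) (K : Tm S Γ .olist) : XFm S Γ :=
  .atom (.inr .memAny) (Sub.cons E (Sub.cons K Sub.nil))

/-- `{K ⊢ G}` has a derivation of height at most `h`. -/
def seqh (h : ℕ) (K : Tm S Γ .olist) (G : Tm S Γ .o) : XFm S Γ :=
  .atom (.inr (.seqh h)) (Sub.cons K (Sub.cons G Sub.nil))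

/-- `{K, [F] ⊢ G}` has a derivation of height at most `h`. -/
def bch (h : ℕ) (K : Tm S Γ .olist) (F G : Tm S Γ .o) : XFm S Γ :=
  .atom (.inr (.bch h)) (Sub.cons K (Sub.cons F (Sub.cons G Sub.nil)))

def seqAny (K : Tm S Γ .olist) (G : Tm S Γ .o) : XFm S Γ :=
  .atom (.inr .seqAny) (Sub.cons K (Sub.cons G Sub.nil))

def bcAny (K : Tm S Γ .olist) (F G : Tm S Γ .o) : XFm S Γ :=
  .atom (.inr .bcAny) (Sub.cons K (Sub.cons F (Sub.cons G Sub.nil)))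

/-- `H` is a conjunct or an instance of `F`. -/
def dec (F H : Tm S Γ .o) : XFm S Γ := .atom (.inr .dec) (Sub.cons F (Sub.cons H Sub.nil))

/-- `F` is `G ⇒ H`. -/
def isImp (F G H : Tm S Γ .o) : XFm S Γ :=
  .atom (.inr .isImp) (Sub.cons F (Sub.cons G (Sub.cons H Sub.nil)))

/-- Every member of `K` is a member of `K'`. -/
def sub (K K' : Tm S Γ .olist) : XFm S Γ := .atom (.inr .sub) (Sub.cons K (Sub.cons K' Sub.nil))

/-- The formula `F` is reducible in context `K`, up to depth `k`, as a goal (`b = true`) or as a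
hypothesis (`b = false`). -/
def red (b : Bool) (k : ℕ) (K : Tm S Γ .olist) (F : Tm S Γ .o) : XFm S Γ :=
  .atom (.inr (.red b k)) (Sub.cons K (Sub.cons F Sub.nil))

/-- `F` is reducible in context `K` as a hypothesis, up to some depth between `h` and `N`. -/
def hyp (h N : ℕ) (K : Tm S Γ .olist) (F : Tm S Γ .o) : XFm S Γ :=
  .atom (.inr (.hyp h N)) (Sub.cons K (Sub.cons F Sub.nil))

/-- Every member of `K` satisfies `hyp h N K'`. -/
def env (h N : ℕ) (K K' : Tm S Γ .olist) : XFm S Γ :=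
  .atom (.inr (.env h N)) (Sub.cons K (Sub.cons K' Sub.nil))

/-- Every atomic formula that follows from the focused formula `F`, in an extension of `K`, follows
in that extension. -/
def ne (K : Tm S Γ .olist) (F : Tm S Γ .o) : XFm S Γ :=
  .atom (.inr .ne) (Sub.cons K (Sub.cons F Sub.nil))

def v4 {a b c d e : Ty S.Base} : Tm S (e :: d :: c :: b :: a :: Γ) a :=
  .var (.s (.s (.s (.s .z))))

end Atoms

section AuxClauses

def memhHere (h : ℕ) : Clause (hhLang (auxLang S)) (.inr (.memh h)) where
  xs := [.o, .olist]
  zs := []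
  head := Sub.cons v0 (Sub.cons (Tm.cons v0 v1) Sub.nil)
  body := .top

/-- Every `i < h` gives a clause, so `h` is an upper bound and case analysis supports strong
induction. The same holds for `seqh` and `bch`. -/
def memhThere (h i : ℕ) : Clause (hhLang (auxLang S)) (.inr (.memh h)) where
  xs := [.o, .o, .olist]
  zs := []
  head := Sub.cons v0 (Sub.cons (Tm.cons v1 v2) Sub.nil)
  body := memh i v0 v2

def memAnyClause (h : ℕ) : Clause (hhLang (auxLang S)) (.inr .memAny) where
  xs := [.o, .olist]
  zs := []
  head := Sub.cons v0 (Sub.cons v1 Sub.nil)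
  body := memh h v0 v1

def seqhConj (h i j : ℕ) : Clause (hhLang (auxLang S)) (.inr (.seqh h)) where
  xs := [.olist, .o, .o]
  zs := []
  head := Sub.cons v0 (Sub.cons (Tm.conj v1 v2) Sub.nil)
  body := .and (seqh i v0 v1) (seqh j v0 v2)

def seqhImpl (h i : ℕ) : Clause (hhLang (auxLang S)) (.inr (.seqh h)) where
  xs := [.olist, .o, .o]
  zs := []
  head := Sub.cons v0 (Sub.cons (Tm.impl v1 v2) Sub.nil)
  body := seqh i (Tm.cons v1 v0) v2

def seqhForall (h i : ℕ) (τ : Ty S.Base) (hτ : τ.IsQuant) :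
    Clause (hhLang (auxLang S)) (.inr (.seqh h)) where
  xs := [.olist, .arr τ .o]
  zs := []
  head := Sub.cons v0 (Sub.cons (Tm.sfall τ hτ v1) Sub.nil)
  body := .nab τ (seqh i v1 (.app v2 v0))

def seqhAtom (h i : ℕ) : Clause (hhLang (auxLang S)) (.inr (.seqh h)) where
  xs := [.olist, .o]
  zs := []
  head := Sub.cons v0 (Sub.cons v1 Sub.nil)
  body := .ex .o (.and (atomic v2) (.and (.or (member v0 v1) (prog v0)) (bch i v1 v0 v2)))

/-- Focusing on a conjunction and on a universal formula both pass to a component with the context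
unchanged. One clause through `dec` treats them, over all types, uniformly. -/
def bchDec (h i : ℕ) : Clause (hhLang (auxLang S)) (.inr (.bch h)) where
  xs := [.olist, .o, .o]
  zs := []
  head := Sub.cons v0 (Sub.cons v1 (Sub.cons v2 Sub.nil))
  body := .ex .o (.and (dec v2 v0) (bch i v1 v0 v3))

def bchImpl (h i j : ℕ) : Clause (hhLang (auxLang S)) (.inr (.bch h)) where
  xs := [.olist, .o, .o, .o]
  zs := []
  head := Sub.cons v0 (Sub.cons (Tm.impl v1 v2) (Sub.cons v3 Sub.nil))
  body := .and (seqh i v0 v1) (bch j v0 v2 v3)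

def bchMatch (h : ℕ) : Clause (hhLang (auxLang S)) (.inr (.bch h)) where
  xs := [.olist, .o]
  zs := []
  head := Sub.cons v0 (Sub.cons v1 (Sub.cons v1 Sub.nil))
  body := .top

def seqAnyClause (h : ℕ) : Clause (hhLang (auxLang S)) (.inr .seqAny) where
  xs := [.olist, .o]
  zs := []
  head := Sub.cons v0 (Sub.cons v1 Sub.nil)
  body := seqh h v0 v1

def bcAnyClause (h : ℕ) : Clause (hhLang (auxLang S)) (.inr .bcAny) where
  xs := [.olist, .o, .o]
  zs := []
  head := Sub.cons v0 (Sub.cons v1 (Sub.cons v2 Sub.nil))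
  body := bch h v0 v1 v2

def decLeft : Clause (hhLang (auxLang S)) (.inr .dec) where
  xs := [.o, .o]
  zs := []
  head := Sub.cons (Tm.conj v0 v1) (Sub.cons v0 Sub.nil)
  body := .top

def decRight : Clause (hhLang (auxLang S)) (.inr .dec) where
  xs := [.o, .o]
  zs := []
  head := Sub.cons (Tm.conj v0 v1) (Sub.cons v1 Sub.nil)
  body := .top

def decForall (τ : Ty S.Base) (hτ : τ.IsQuant) : Clause (hhLang (auxLang S)) (.inr .dec) where
  xs := [.arr τ .o, τ]
  zs := []
  head := Sub.cons (Tm.sfall τ hτ v0) (Sub.cons (.app v0 v1) Sub.nil)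
  body := .top

def isImpClause : Clause (hhLang (auxLang S)) (.inr .isImp) where
  xs := [.o, .o]
  zs := []
  head := Sub.cons (Tm.impl v0 v1) (Sub.cons v0 (Sub.cons v1 Sub.nil))
  body := .top

def subClause : Clause (hhLang (auxLang S)) (.inr .sub) where
  xs := [.olist, .olist]
  zs := []
  head := Sub.cons v0 (Sub.cons v1 Sub.nil)
  body := .all .o (.imp (member v0 v1) (member v0 v2))

/-- Reducibility at depth `0`. -/
def redBase {Γ : List (Ty S.Base)} (b : Bool) (K : Tm S Γ .olist) (F : Tm S Γ .o) : XFm S Γ :=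
  match b with
  | true => seq K F
  | false => .imp (atomic F) (seq K F)

/-- Reducibility of the immediate components. -/
def redStep (b : Bool) (k : ℕ) : XFm S [.olist, .o] :=
  .and (.all .o (.imp (dec v2 v0) (red b k v1 v0)))
    (.all .olist (.all .o (.all .o (.imp (isImp v4 v1 v0) (.imp (sub v3 v2)
      (.imp (red (!b) k v2 v1) (red b k v2 v0)))))))

/-- The recursion is on `k`, not on the formula. A predicate without depth would occur to the left
of an implication in its own clause. -/
def redClause (b : Bool) (k : ℕ) : Clause (hhLang (auxLang S)) (.inr (.red b k)) where
  xs := [.olist, .o]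
  zs := []
  head := Sub.cons v0 (Sub.cons v1 Sub.nil)
  body :=
    match k with
    | 0 => redBase b v0 v1
    | k + 1 => .and (redBase b v0 v1) (redStep b k)

/-- Different members of a context may be reducible to different depths, so the depth varies. The
bound `N` keeps the levels finite. -/
def hypClause (h N k : ℕ) : Clause (hhLang (auxLang S)) (.inr (.hyp h N)) where
  xs := [.olist, .o]
  zs := []
  head := Sub.cons v0 (Sub.cons v1 Sub.nil)
  body := red false k v0 v1

def envClause (h N : ℕ) : Clause (hhLang (auxLang S)) (.inr (.env h N)) where
  xs := [.olist, .olist]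
  zs := []
  head := Sub.cons v0 (Sub.cons v1 Sub.nil)
  body := .all .o (.imp (member v0 v1) (hyp h N v2 v0))

def neClause : Clause (hhLang (auxLang S)) (.inr .ne) where
  xs := [.olist, .o]
  zs := []
  head := Sub.cons v0 (Sub.cons v1 Sub.nil)
  body := .all .olist (.all .o (.imp (sub v2 v1)
    (.imp (bc v1 v3 v0) (.imp (atomic v0) (seq v1 v0)))))

variable (S) in
def auxClauses : ∀ p : AuxPred, Set (Clause (hhLang (auxLang S)) (.inr p))
  | .memh h => {c | c = memhHere h ∨ ∃ i < h, c = memhThere h i}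
  | .memAny => {c | ∃ h, c = memAnyClause h}
  | .seqh h => {c | ∃ i < h, (∃ j < h, c = seqhConj h i j) ∨ c = seqhImpl h i ∨
      (∃ τ hτ, c = seqhForall h i τ hτ) ∨ c = seqhAtom h i}
  | .bch h => {c | c = bchMatch h ∨ ∃ i < h, c = bchDec h i ∨ ∃ j < h, c = bchImpl h i j}
  | .seqAny => {c | ∃ h, c = seqAnyClause h}
  | .bcAny => {c | ∃ h, c = bcAnyClause h}
  | .dec => {c | c = decLeft ∨ c = decRight ∨ ∃ τ hτ, c = decForall τ hτ}
  | .isImp => {isImpClause}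
  | .sub => {subClause}
  | .red b k => {redClause b k}
  | .hyp h N => {c | ∃ k, h ≤ k ∧ k ≤ N ∧ c = hypClause h N k}
  | .env h N => {envClause h N}
  | .ne => {neClause}

variable (S) in
/-- The auxiliary definitions. -/
abbrev auxDefn : AuxDefn S where
  lang := auxLang S
  clauses := auxClauses S
  lvl := AuxPred.lvl

end AuxClauses

/-! ### Well-formedness -/

section WellFormed

theorem Var.forall_nil {α : Type} {P : ∀ τ : α, Var ([] : List α) τ → Prop} : ∀ τ v, P τ v :=
  fun _ v => nomatch v

theorem Var.forall_cons {α : Type} {Γ : List α} {a : α} {P : ∀ τ : α, Var (a :: Γ) τ → Prop}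
    (z : P a .z) (s : ∀ τ v, P τ (.s v)) : ∀ τ v, P τ v
  | _, .z => z
  | _, .s v => s _ v

variable {Γ Δ : List (Ty S.Base)} {σ τ : Ty S.Base}

theorem Sub.not_occ_nil (a : Nom S) : ¬ Sub.Occ a (Sub.nil : Sub S [] Δ) := by
  rintro ⟨_, v, _⟩
  cases v

theorem Sub.not_occ_cons {a : Nom S} {t : Tm S Δ σ} {θ : Sub S Γ Δ} (ht : ¬ t.Occ a)
    (hθ : ¬ Sub.Occ a θ) : ¬ Sub.Occ a (Sub.cons t θ) := by
  rintro ⟨_, v, h⟩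
  cases v with
  | z => exact ht h
  | s v => exact hθ ⟨_, v, h⟩

/-- The conditions on a clause in a well-formed definition. -/
def Clause.WellFormed {L : Lang S} (lvl : L.Pred → ℕ) {p : L.Pred} (c : Clause L p) : Prop :=
  (∀ a : Nom S, ¬ Sub.Occ a c.head ∧ ¬ Fm.Occ a c.body) ∧
  (∀ (τ : Ty S.Base) (v : Var c.xs τ),
    ∃ (σ : Ty S.Base) (w : Var (L.ar p) σ), (c.head w).HasVar (v.skip c.zs)) ∧
  c.body.level lvl ≤ lvl p

theorem encoding_wellFormed {Θ : List (Tm S [] .o)}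
    (hΘ : ∀ F ∈ Θ, ∀ a : Nom S, ¬ Tm.Occ a F) : (encoding Θ (auxDefn S)).WellFormed := by
  -- Every clause here has all its variables in the head, so the occurrence condition needs no
  -- inspection of the body.
  suffices h : ∀ p, ∀ c ∈ (encoding Θ (auxDefn S)).clauses p,
      c.WellFormed (encoding Θ (auxDefn S)).lvl from
    fun p c hc => ⟨(h p c hc).1, fun τ v _ => (h p c hc).2.1 τ v, (h p c hc).2.2⟩
  rintro (p | p) c hc
  · cases p
    case prog =>
      obtain ⟨F, hF, rfl⟩ := hc
      exact ⟨fun a => ⟨Sub.not_occ_cons (hΘ F hF a) (Sub.not_occ_nil a), not_false⟩,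
        Var.forall_nil, le_rfl⟩
    case' member => rcases hc with rfl | rfl
    case' isForall => obtain ⟨τ, h, rfl⟩ := hc
    case' atomic => obtain rfl := hc
    case' seq => rcases hc with (rfl | rfl | rfl | rfl) | ⟨τ, h, rfl⟩
    case' bc => rcases hc with (rfl | rfl | rfl) | ⟨τ, h, rfl⟩
    all_goals refine ⟨fun a => ⟨?_, ?_⟩, ?_, ?_⟩
    all_goals first
      | (repeat' first
          | exact not_false
          | exact Sub.not_occ_nil _
          | refine Sub.not_occ_cons ?_ ?_
          | refine not_or.2 ⟨?_, ?_⟩)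
        done
      | (repeat' first
          | exact Var.forall_nil
          | refine Var.forall_cons ?_ ?_)
        <;> first
          | exact ⟨_, .z, rfl⟩
          | exact ⟨_, .z, .inr rfl⟩
          | exact ⟨_, .z, .inl (.inr rfl)⟩
          | exact ⟨_, .s .z, rfl⟩
          | exact ⟨_, .s .z, .inr rfl⟩
          | exact ⟨_, .s .z, .inl (.inr rfl)⟩
          | exact ⟨_, .s (.s .z), rfl⟩
      | exact Nat.le_of_ble_eq_true rfl
  · cases p
    case' memh h => rcases hc with rfl | ⟨i, hi, rfl⟩
    case' memAny => obtain ⟨h, rfl⟩ := hc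
    case' seqh h => rcases hc with ⟨i, hi, ⟨j, hj, rfl⟩ | rfl | ⟨τ, h, rfl⟩ | rfl⟩
    case' bch h => rcases hc with rfl | ⟨i, hi, rfl | ⟨j, hj, rfl⟩⟩
    case' seqAny => obtain ⟨h, rfl⟩ := hc
    case' bcAny => obtain ⟨h, rfl⟩ := hc
    case' dec => rcases hc with rfl | rfl | ⟨τ, h, rfl⟩
    case' isImp => obtain rfl := hc
    case' sub => obtain rfl := hc
    case' red b k => obtain rfl := hc; rcases k with _ | k <;> cases b
    case' hyp h N => obtain ⟨k, hk, hN, rfl⟩ := hc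
    case' env h N => obtain rfl := hc
    case' ne => obtain rfl := hc
    all_goals refine ⟨fun a => ⟨?_, ?_⟩, ?_, ?_⟩
    all_goals first
      | (repeat' first
          | exact not_false
          | exact Sub.not_occ_nil _
          | refine Sub.not_occ_cons ?_ ?_
          | refine not_or.2 ⟨?_, ?_⟩)
        done
      | (repeat' first
          | exact Var.forall_nil
          | refine Var.forall_cons ?_ ?_)
        <;> first
          | exact ⟨_, .z, rfl⟩
          | exact ⟨_, .z, .inr rfl⟩
          | exact ⟨_, .z, .inl (.inr rfl)⟩
          | exact ⟨_, .s .z, rfl⟩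
          | exact ⟨_, .s .z, .inr rfl⟩
          | exact ⟨_, .s .z, .inl (.inr rfl)⟩
          | exact ⟨_, .s (.s .z), rfl⟩
      | (repeat' first
          | exact Nat.le_of_ble_eq_true rfl
          | exact Nat.le_refl _
          | exact Nat.le_succ _
          | exact Nat.add_le_add_left ‹_ ≤ _› 3
          | exact Nat.le_trans (Nat.le_of_ble_eq_true rfl : _ ≤ 3) (Nat.le_add_right 3 _)
          | refine max_le ?_ ?_)

end WellFormed

/-! ## Introduction and case analysis for the predicates -/

section Substitution

variable {Γ Δ : List (Ty S.Base)} {σ τ ρ : Ty S.Base} {A : Lang S}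

theorem Sub.one_comp (s : Tm S Γ σ) (θ : Sub S Γ Δ) :
    (Sub.cons s Sub.nil).comp θ = Sub.cons (s.subst θ) Sub.nil := by
  rw [Sub.cons_comp, Sub.nil_comp]

theorem Sub.two_comp (s : Tm S Γ σ) (t : Tm S Γ τ) (θ : Sub S Γ Δ) :
    (Sub.cons s (Sub.cons t Sub.nil)).comp θ =
      Sub.cons (s.subst θ) (Sub.cons (t.subst θ) Sub.nil) := by
  rw [Sub.cons_comp, Sub.one_comp]

theorem Sub.three_comp (s : Tm S Γ σ) (t : Tm S Γ τ) (w : Tm S Γ ρ) (θ : Sub S Γ Δ) :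
    (Sub.cons s (Sub.cons t (Sub.cons w Sub.nil))).comp θ =
      Sub.cons (s.subst θ) (Sub.cons (t.subst θ) (Sub.cons (w.subst θ) Sub.nil)) := by
  rw [Sub.cons_comp, Sub.two_comp]

variable (θ : Sub S Γ Δ)

theorem member_subst (E : Tm S Γ .o) (K : Tm S Γ .olist) :
    (member E K : Fm (hhLang A) Γ).subst θ = member (E.subst θ) (K.subst θ) :=
  congrArg (Fm.atom _) (Sub.two_comp E K θ)

theorem prog_subst (F : Tm S Γ .o) : (prog F : Fm (hhLang A) Γ).subst θ = prog (F.subst θ) :=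
  congrArg (Fm.atom _) (Sub.one_comp F θ)

theorem atomic_subst (F : Tm S Γ .o) :
    (atomic F : Fm (hhLang A) Γ).subst θ = atomic (F.subst θ) :=
  congrArg (Fm.atom _) (Sub.one_comp F θ)

theorem seq_subst (K : Tm S Γ .olist) (G : Tm S Γ .o) :
    (seq K G : Fm (hhLang A) Γ).subst θ = seq (K.subst θ) (G.subst θ) :=
  congrArg (Fm.atom _) (Sub.two_comp K G θ)

theorem bc_subst (K : Tm S Γ .olist) (F G : Tm S Γ .o) :
    (bc K F G : Fm (hhLang A) Γ).subst θ = bc (K.subst θ) (F.subst θ) (G.subst θ) :=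
  congrArg (Fm.atom _) (Sub.three_comp K F G θ)

theorem seqh_subst (h : ℕ) (K : Tm S Γ .olist) (G : Tm S Γ .o) :
    (seqh h K G).subst θ = seqh h (K.subst θ) (G.subst θ) :=
  congrArg (Fm.atom _) (Sub.two_comp K G θ)

theorem bch_subst (h : ℕ) (K : Tm S Γ .olist) (F G : Tm S Γ .o) :
    (bch h K F G).subst θ = bch h (K.subst θ) (F.subst θ) (G.subst θ) :=
  congrArg (Fm.atom _) (Sub.three_comp K F G θ)

theorem seqAny_subst (K : Tm S Γ .olist) (G : Tm S Γ .o) :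
    (seqAny K G).subst θ = seqAny (K.subst θ) (G.subst θ) :=
  congrArg (Fm.atom _) (Sub.two_comp K G θ)

theorem bcAny_subst (K : Tm S Γ .olist) (F G : Tm S Γ .o) :
    (bcAny K F G).subst θ = bcAny (K.subst θ) (F.subst θ) (G.subst θ) :=
  congrArg (Fm.atom _) (Sub.three_comp K F G θ)

theorem dec_subst (F H : Tm S Γ .o) : (dec F H).subst θ = dec (F.subst θ) (H.subst θ) :=
  congrArg (Fm.atom _) (Sub.two_comp F H θ)

theorem isImp_subst (F G H : Tm S Γ .o) :
    (isImp F G H).subst θ = isImp (F.subst θ) (G.subst θ) (H.subst θ) :=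
  congrArg (Fm.atom _) (Sub.three_comp F G H θ)

theorem sub_subst (K K' : Tm S Γ .olist) : (sub K K').subst θ = sub (K.subst θ) (K'.subst θ) :=
  congrArg (Fm.atom _) (Sub.two_comp K K' θ)

theorem red_subst (b : Bool) (k : ℕ) (K : Tm S Γ .olist) (F : Tm S Γ .o) :
    (red b k K F).subst θ = red b k (K.subst θ) (F.subst θ) :=
  congrArg (Fm.atom _) (Sub.two_comp K F θ)

theorem hyp_subst (h N : ℕ) (K : Tm S Γ .olist) (F : Tm S Γ .o) :
    (hyp h N K F).subst θ = hyp h N (K.subst θ) (F.subst θ) :=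
  congrArg (Fm.atom _) (Sub.two_comp K F θ)

theorem env_subst (h N : ℕ) (K K' : Tm S Γ .olist) :
    (env h N K K').subst θ = env h N (K.subst θ) (K'.subst θ) :=
  congrArg (Fm.atom _) (Sub.two_comp K K' θ)

theorem ne_subst (K : Tm S Γ .olist) (F : Tm S Γ .o) :
    (ne K F).subst θ = ne (K.subst θ) (F.subst θ) :=
  congrArg (Fm.atom _) (Sub.two_comp K F θ)

end Substitution

/-! ### Backchaining and case analysis for lists, programs and atomic formulas. -/

section Interface

variable {X X' Γ Δ Ξ : List (Ty S.Base)} {σ τ ρ : Ty S.Base}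

theorem Sub.occ_comp {a : Nom S} {θ : Sub S Γ Δ} {η : Sub S Δ Ξ} (h : Sub.Occ a (θ.comp η)) :
    Sub.Occ a θ ∨ Sub.Occ a η := by
  obtain ⟨_, v, h⟩ := h
  exact (Tm.occ_subst _ _ h).imp_left fun h => ⟨_, v, h⟩

theorem Var.forall_one {P : ∀ κ, Var [σ] κ → Prop} (h₀ : P σ .z) : ∀ κ v, P κ v :=
  Var.forall_cons h₀ Var.forall_nil

theorem Var.forall_two {P : ∀ κ, Var [σ, τ] κ → Prop} (h₀ : P σ .z) (h₁ : P τ (.s .z)) :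
    ∀ κ v, P κ v := Var.forall_cons h₀ (Var.forall_one h₁)

theorem Var.forall_three {P : ∀ κ, Var [σ, τ, ρ] κ → Prop} (h₀ : P σ .z) (h₁ : P τ (.s .z))
    (h₂ : P ρ (.s (.s .z))) : ∀ κ v, P κ v := Var.forall_cons h₀ (Var.forall_two h₁ h₂)

theorem Der.atom_conv {L : Lang S} {D : Defn L} {Θ : List (Fm L X)} {p : L.Pred}
    {args args' : Sub S (L.ar p) X} (h : Der D X Θ (.atom p args))
    (hc : ∀ (τ : Ty S.Base) (v : Var (L.ar p) τ), Tm.Conv (args v) (args' v)) :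
    Der D X Θ (.atom p args') := h.conv (.atom p hc)

/-- Backchaining on a clause without nominal variables. -/
theorem Der.def_intro {L : Lang S} {D : Defn L} {Θ : List (Fm L X)} {p : L.Pred}
    {args : Sub S (L.ar p) X} {xs : List (Ty S.Base)} {head : Sub S (L.ar p) xs} {body : Fm L xs}
    (u : Sub S xs X) (hc : ⟨xs, [], head, body⟩ ∈ D.clauses p)
    (hm : ∀ (τ : Ty S.Base) (v : Var (L.ar p) τ), Tm.Conv ((head v).subst u) (args v))
    (hb : Der D X Θ (body.subst u)) : Der D X Θ (.atom p args) :=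
  .defR p ⟨xs, [], head, body⟩ u (fun _ v => nomatch v) hc
    ⟨fun _ v => (nomatch v), fun _ v => (nomatch v), hm⟩ hb

/-- The encoding with the auxiliary definitions. -/
abbrev HH (P : List (Tm S [] .o)) : Defn (hhLang (auxLang S)) := encoding P (auxDefn S)

variable {P : List (Tm S [] .o)} {Θ : List (XFm S X)} {C : XFm S X}

/-! ### Lists and atomic formulas -/

theorem member_here (E : Tm S X .o) (K : Tm S X .olist) :
    Der (HH P) X Θ (member E (Tm.cons E K)) :=
  .def_intro (Sub.cons E (Sub.cons K Sub.nil)) (.inl rfl)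
    (Var.forall_two (.refl E) (.refl (Tm.cons E K))) .topR

theorem member_there {E : Tm S X .o} {K : Tm S X .olist} (F : Tm S X .o)
    (h : Der (HH P) X Θ (member E K)) : Der (HH P) X Θ (member E (Tm.cons F K)) :=
  .def_intro (Sub.cons E (Sub.cons F (Sub.cons K Sub.nil))) (.inr rfl)
    (Var.forall_two (.refl E) (.refl (Tm.cons F K))) (by
      refine (congrArg (Der _ _ _) (member_subst (A := auxLang S) _ v0 v2)).mpr h)

/-- Case analysis on membership. -/
theorem member_elim {E : Tm S X .o} {K : Tm S X .olist} (Hs : List (XFm S X))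
    (hHs : ∀ B ∈ Hs, Der (HH P) X Θ B) (hp : Der (HH P) X Θ (member E K))
    (h : ∀ (X' : List (Ty S.Base)) (θ : Sub S X X') (Θ' : List (XFm S X'))
      (F : Tm S X' .o) (K' : Tm S X' .olist), Fm.Avoids θ (member E K : XFm S X) →
      (∀ B ∈ Hs, Der (HH P) X' Θ' (B.subst θ)) → Tm.Conv (K.subst θ) (Tm.cons F K') →
      (Tm.Conv (E.subst θ) F ∨ Der (HH P) X' Θ' (member (E.subst θ) K')) →
      Der (HH P) X' Θ' (C.subst θ)) :
    Der (HH P) X Θ C := by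
  refine Der.def_elim (.inl .member) Hs hHs hp ?_
  rintro c (rfl | rfl) X' θ u d Θ' ha hm hF hb
  · have h0 : Tm.Conv (u .z) (E.subst θ) := hm.2.2 _ .z
    have h1 : Tm.Conv (Tm.cons (u .z) (u (.s .z))) (K.subst θ) := hm.2.2 _ (.s .z)
    exact h _ θ _ _ _ ha hF h1.symm (.inl h0.symm)
  · have h0 : Tm.Conv (u .z) (E.subst θ) := hm.2.2 _ .z
    have h1 : Tm.Conv (Tm.cons (u (.s .z)) (u (.s (.s .z)))) (K.subst θ) := hm.2.2 _ (.s .z)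
    have hb' : Der (HH P) X' Θ' (member (u .z) (u (.s (.s .z)))) :=
      (congrArg (Der _ _ _) (member_subst (A := auxLang S) u v0 v2)).mp hb
    exact h _ θ _ _ _ ha hF h1.symm (.inr (hb'.atom_conv (Var.forall_two h0 (.refl _))))

theorem prog_elim {F : Tm S X .o} (Hs : List (XFm S X))
    (hHs : ∀ B ∈ Hs, Der (HH P) X Θ B) (hp : Der (HH P) X Θ (prog F))
    (h : ∀ (X' : List (Ty S.Base)) (θ : Sub S X X') (Θ' : List (XFm S X')),
      Fm.Avoids θ (prog F : XFm S X) → (∀ B ∈ Hs, Der (HH P) X' Θ' (B.subst θ)) →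
      (∃ F₀ ∈ P, Tm.Conv (F₀.subst Sub.nil) (F.subst θ)) → Der (HH P) X' Θ' (C.subst θ)) :
    Der (HH P) X Θ C := by
  refine Der.def_elim (.inl .prog) Hs hHs hp ?_
  rintro c ⟨F₀, hF₀, rfl⟩ X' θ u d Θ' ha hm hF -
  have h0 : Tm.Conv (F₀.subst u) (F.subst θ) := hm.2.2 _ .z
  have e : u = Sub.nil := by funext τ v; cases v
  subst e
  exact h _ θ _ ha hF ⟨F₀, hF₀, h0⟩

theorem prog_intro {F : Tm S X .o} {F₀ : Tm S [] .o} (hF₀ : F₀ ∈ P)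
    (h : Tm.Conv (F₀.subst Sub.nil) F) : Der (HH P) X Θ (prog F) :=
  .def_intro (xs := []) Sub.nil ⟨F₀, hF₀, rfl⟩ (Var.forall_one h) .topR

/-- Not of the form `∀_τ G`, `G₁ ∧ G₂` or `G₁ ⇒ G₂`. -/
def Tm.NotCompound (F : Tm S X .o) : Prop :=
  (∀ G H : Tm S X .o, ¬ Tm.Conv F (Tm.conj G H)) ∧ (∀ G H : Tm S X .o, ¬ Tm.Conv F (Tm.impl G H)) ∧
  ∀ (τ : Ty S.Base) (hτ : τ.IsQuant) (G : Tm S X (.arr τ .o)), ¬ Tm.Conv F (Tm.sfall τ hτ G)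

/-- An atomic formula that is a compound one proves everything. -/
theorem atomic_elim {F : Tm S X .o} (hp : Der (HH P) X Θ (atomic F)) (hF : ¬ F.NotCompound) :
    Der (HH P) X Θ C := by
  refine Der.def_elim (.inl .atomic) [] (by simp) hp ?_
  rintro c rfl X' θ u d Θ' - hm - hb
  have h0 : Tm.Conv (u .z) (F.subst θ) := hm.2.2 _ .z
  simp only [Tm.NotCompound, not_and_or, not_forall, not_not] at hF
  have hb₁ := hb.and_left
  have hb₂ := hb.and_right
  refine Der.bot_elim ?_
  rcases hF with ⟨G, H, hc⟩ | ⟨G, H, hc⟩ | ⟨τ, hτ, G, hc⟩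
  · refine Der.imp_elim (Der.all_elim (H.subst θ) (Der.all_elim (G.subst θ) hb₂.and_left)) ?_
    exact .eqR (h0.trans (hc.subst θ))
  · refine Der.imp_elim (Der.all_elim (H.subst θ) (Der.all_elim (G.subst θ) hb₂.and_right)) ?_
    exact .eqR (h0.trans (hc.subst θ))
  · refine Der.imp_elim hb₁ ?_
    refine .def_intro (Sub.cons (G.subst θ) Sub.nil) ⟨τ, hτ, rfl⟩ ?_ .topR
    exact Var.forall_one (h0.trans (hc.subst θ)).symm

end Interface

/-! ### Specification derivations and their height-bounded versions inside the reasoning logic. -/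

section Derivations

variable {X X' Γ Δ Ξ : List (Ty S.Base)} {σ τ ρ : Ty S.Base}

theorem Der.cast {L : Lang S} {D : Defn L} {Θ : List (Fm L X)} {B C : Fm L X}
    (h : Der D X Θ B) (e : B = C) : Der D X Θ C := e ▸ h

theorem Der.uncast {L : Lang S} {D : Defn L} {Θ : List (Fm L X)} {B C : Fm L X}
    (e : B = C) (h : Der D X Θ C) : Der D X Θ B := e ▸ h

/-- All large indices are offered at once, so that a later step can choose one that is also fresh
for other terms. -/
theorem Der.nab_elim_large {L : Lang S} {D : Defn L} {Θ : List (Fm L X)} {B : Fm L (τ :: Γ)}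
    {u : Sub S Γ X} (h : Der D X Θ ((Fm.nab τ B).subst u)) :
    ∃ N, ∀ n, N ≤ n → Der D X Θ (B.subst (Sub.cons (.nom n) u)) := by
  obtain ⟨N, hN⟩ := exists_bound (Fm.finite_occ (B.subst u.lift))
  exact ⟨N, fun n hn => Der.nab_elim (hN _ _ hn) h⟩

variable {P : List (Tm S [] .o)} {Θ : List (XFm S X)} {C : XFm S X}

/-! ### Derivations of the specification logic -/

/-- The premises of a right rule of the specification logic. -/
inductive SeqCase (P : List (Tm S [] .o)) (Θ : List (XFm S X)) (K : Tm S X .olist)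
    (G : Tm S X .o) : Prop
  | conj (F H : Tm S X .o) : Tm.Conv G (Tm.conj F H) → Der (HH P) X Θ (seq K F) →
      Der (HH P) X Θ (seq K H) → SeqCase P Θ K G
  | impl (F H : Tm S X .o) : Tm.Conv G (Tm.impl F H) →
      Der (HH P) X Θ (seq (Tm.cons F K) H) → SeqCase P Θ K G
  | sfall (τ : Ty S.Base) (hτ : τ.IsQuant) (F : Tm S X (.arr τ .o)) (N : ℕ) :
      Tm.Conv G (Tm.sfall τ hτ F) →
      (∀ n, N ≤ n → Der (HH P) X Θ (seq K (.app F (.nom n)))) → SeqCase P Θ K G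
  | atom (F : Tm S X .o) : Der (HH P) X Θ (atomic G) →
      Der (HH P) X Θ (.or (member F K) (prog F)) → Der (HH P) X Θ (bc K F G) → SeqCase P Θ K G

theorem exists_fresh (K : Tm S X σ) (F : Tm S X τ) (N : ℕ) :
    ∃ M, N ≤ M ∧ ∀ n, M ≤ n → ∀ κ, ¬ K.Occ (κ, n) ∧ ¬ F.Occ (κ, n) := by
  obtain ⟨M, hM⟩ := exists_bound ((Tm.finite_occ K).union (Tm.finite_occ F))
  refine ⟨max N M, le_max_left _ _, fun n hn κ => ?_⟩
  have := hM κ n ((le_max_right _ _).trans hn)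
  simpa only [Set.mem_union, Set.mem_ofPred_eq, not_or] using this

theorem not_occ_app_shift {K : Tm S X σ} {F : Tm S X (.arr τ ρ)} {a : Nom S} (hK : ¬ K.Occ a)
    (hF : ¬ F.Occ a) : ¬ Sub.Occ a (Sub.cons (K.shift (σ := τ))
      (Sub.cons (.app F.shift (.var .z)) Sub.nil)) :=
  Sub.not_occ_cons (fun h => hK ((Tm.occ_shift _).1 h))
    (Sub.not_occ_cons (not_or.2 ⟨fun h => hF ((Tm.occ_shift _).1 h), not_false⟩)
      (Sub.not_occ_nil a))

theorem SeqCase.der {K : Tm S X .olist} {G : Tm S X .o} (h : SeqCase P Θ K G) :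
    Der (HH P) X Θ (seq K G) := by
  rcases h with ⟨F, H, hG, hF, hH⟩ | ⟨F, H, hG, hF⟩ | ⟨τ, hτ, F, N, hG, hF⟩ | ⟨F, hA, hM, hF⟩
  · exact .def_intro (Sub.cons K (Sub.cons F (Sub.cons H Sub.nil))) (.inl (.inl rfl))
      (Var.forall_two (.refl K) hG.symm)
      (.andR (.uncast (seq_subst ..) hF)
        (.uncast (seq_subst ..) hH))
  · exact .def_intro (Sub.cons K (Sub.cons F (Sub.cons H Sub.nil))) (.inl (.inr (.inl rfl)))
      (Var.forall_two (.refl K) hG.symm)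
      (.uncast (seq_subst ..) hF)
  · obtain ⟨n, hn, hf⟩ := exists_fresh K F N
    have hf := hf n le_rfl τ
    refine .def_intro (Sub.cons K (Sub.cons F Sub.nil)) (.inr ⟨τ, hτ, rfl⟩)
      (Var.forall_two (.refl K) hG.symm) (.nab_intro (n := n) ?_ ?_)
    · rw [seq_subst (A := auxLang S)]
      exact not_occ_app_shift hf.1 hf.2
    · exact .uncast (seq_subst ..) (hF n hn)
  · refine .or_elim hM ?_ ?_
    · refine .def_intro (Sub.cons K (Sub.cons G Sub.nil)) (.inl (.inr (.inr (.inl rfl))))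
        (Var.forall_two (.refl K) (.refl G)) (.ex_intro F (.andR ?_ (.andR ?_ ?_)))
      · exact .uncast (atomic_subst ..) (hA.weaken (List.subset_cons_self _ _))
      · exact .uncast (member_subst ..) (.ax (.head _))
      · exact .uncast (bc_subst ..) (hF.weaken (List.subset_cons_self _ _))
    · refine .def_intro (Sub.cons K (Sub.cons G Sub.nil)) (.inl (.inr (.inr (.inr rfl))))
        (Var.forall_two (.refl K) (.refl G)) (.ex_intro F (.andR ?_ (.andR ?_ ?_)))
      · exact .uncast (atomic_subst ..) (hA.weaken (List.subset_cons_self _ _))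
      · exact .uncast (prog_subst ..) (.ax (.head _))
      · exact .uncast (bc_subst ..) (hF.weaken (List.subset_cons_self _ _))

theorem bc_match {K : Tm S X .olist} {F A : Tm S X .o} (h : Tm.Conv F A) :
    Der (HH P) X Θ (bc K F A) :=
  .def_intro (Sub.cons K (Sub.cons A Sub.nil)) (.inl (.inr (.inr rfl)))
    (Var.forall_three (.refl K) h.symm (.refl A)) .topR

theorem bc_conj {K : Tm S X .olist} {F F₁ F₂ A : Tm S X .o} (hF : Tm.Conv F (Tm.conj F₁ F₂))
    (h : Der (HH P) X Θ (bc K F₁ A) ∨ Der (HH P) X Θ (bc K F₂ A)) : Der (HH P) X Θ (bc K F A) := by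
  refine .def_intro (Sub.cons K (Sub.cons F₁ (Sub.cons F₂ (Sub.cons A Sub.nil))))
    (.inl (.inl rfl)) (Var.forall_three (.refl K) hF.symm (.refl A)) ?_
  rcases h with h | h
  · exact .orR₁ (.uncast (bc_subst ..) h)
  · exact .orR₂ (.uncast (bc_subst ..) h)

theorem bc_impl {K : Tm S X .olist} {F G F' A : Tm S X .o} (hF : Tm.Conv F (Tm.impl G F'))
    (hG : Der (HH P) X Θ (seq K G)) (h : Der (HH P) X Θ (bc K F' A)) :
    Der (HH P) X Θ (bc K F A) :=
  .def_intro (Sub.cons K (Sub.cons G (Sub.cons F' (Sub.cons A Sub.nil))))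
    (.inl (.inr (.inl rfl))) (Var.forall_three (.refl K) hF.symm (.refl A))
    (.andR (.uncast (seq_subst ..) hG) (.uncast (bc_subst ..) h))

theorem bc_sfall {hτ : τ.IsQuant} {K : Tm S X .olist} {F A : Tm S X .o} {F' : Tm S X (.arr τ .o)}
    (hF : Tm.Conv F (Tm.sfall τ hτ F')) (t : Tm S X τ)
    (h : Der (HH P) X Θ (bc K (.app F' t) A)) : Der (HH P) X Θ (bc K F A) :=
  .def_intro (Sub.cons K (Sub.cons F' (Sub.cons A Sub.nil))) (.inr ⟨τ, hτ, rfl⟩)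
    (Var.forall_three (.refl K) hF.symm (.refl A)) (.ex_intro t (.uncast (bc_subst ..) h))

/-! ### Components of formulas -/

/-- The forms of `F` and of a component `H`. -/
inductive DecCase (F H : Tm S X .o) : Prop
  | left (G : Tm S X .o) : Tm.Conv F (Tm.conj H G) → DecCase F H
  | right (G : Tm S X .o) : Tm.Conv F (Tm.conj G H) → DecCase F H
  | inst (τ : Ty S.Base) (hτ : τ.IsQuant) (G : Tm S X (.arr τ .o)) (t : Tm S X τ) :
      Tm.Conv F (Tm.sfall τ hτ G) → Tm.Conv H (.app G t) → DecCase F H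

theorem DecCase.der {F H : Tm S X .o} (h : DecCase F H) : Der (HH P) X Θ (dec F H) := by
  rcases h with ⟨G, hF⟩ | ⟨G, hF⟩ | ⟨τ, hτ, G, t, hF, hH⟩
  · exact .def_intro (Sub.cons H (Sub.cons G Sub.nil)) (.inl rfl)
      (Var.forall_two hF.symm (.refl H)) .topR
  · exact .def_intro (Sub.cons G (Sub.cons H Sub.nil)) (.inr (.inl rfl))
      (Var.forall_two hF.symm (.refl H)) .topR
  · exact .def_intro (Sub.cons G (Sub.cons t Sub.nil)) (.inr (.inr ⟨τ, hτ, rfl⟩))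
      (Var.forall_two hF.symm hH.symm) .topR

theorem dec_elim {F H : Tm S X .o} (Hs : List (XFm S X))
    (hHs : ∀ B ∈ Hs, Der (HH P) X Θ B) (hp : Der (HH P) X Θ (dec F H))
    (h : ∀ (X' : List (Ty S.Base)) (θ : Sub S X X') (Θ' : List (XFm S X')),
      Fm.Avoids θ (dec F H) → (∀ B ∈ Hs, Der (HH P) X' Θ' (B.subst θ)) →
      DecCase (F.subst θ) (H.subst θ) → Der (HH P) X' Θ' (C.subst θ)) :
    Der (HH P) X Θ C := by
  refine Der.def_elim (.inr .dec) Hs hHs hp ?_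
  rintro c (rfl | rfl | ⟨τ, hτ, rfl⟩) X' θ u d Θ' ha hm hF -
  · have h0 : Tm.Conv (Tm.conj (u .z) (u (.s .z))) (F.subst θ) := hm.2.2 _ .z
    have h1 : Tm.Conv (u .z) (H.subst θ) := hm.2.2 _ (.s .z)
    exact h _ θ _ ha hF (.left _ (h0.symm.trans (.app (.app (.refl _) h1) (.refl _))))
  · have h0 : Tm.Conv (Tm.conj (u .z) (u (.s .z))) (F.subst θ) := hm.2.2 _ .z
    have h1 : Tm.Conv (u (.s .z)) (H.subst θ) := hm.2.2 _ (.s .z)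
    exact h _ θ _ ha hF (.right _ (h0.symm.trans (.app (.refl _) h1)))
  · have h0 : Tm.Conv (Tm.sfall τ hτ (u .z)) (F.subst θ) := hm.2.2 _ .z
    have h1 : Tm.Conv (.app (u .z) (u (.s .z))) (H.subst θ) := hm.2.2 _ (.s .z)
    exact h _ θ _ ha hF (.inst τ hτ _ _ h0.symm h1.symm)

theorem isImp_intro {F G H : Tm S X .o} (h : Tm.Conv F (Tm.impl G H)) :
    Der (HH P) X Θ (isImp F G H) :=
  .def_intro (Sub.cons G (Sub.cons H Sub.nil)) rfl
    (Var.forall_three h.symm (.refl G) (.refl H)) .topR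

theorem isImp_elim {F G H : Tm S X .o} (Hs : List (XFm S X))
    (hHs : ∀ B ∈ Hs, Der (HH P) X Θ B) (hp : Der (HH P) X Θ (isImp F G H))
    (h : ∀ (X' : List (Ty S.Base)) (θ : Sub S X X') (Θ' : List (XFm S X')),
      (∀ B ∈ Hs, Der (HH P) X' Θ' (B.subst θ)) →
      Tm.Conv (F.subst θ) (Tm.impl (G.subst θ) (H.subst θ)) → Der (HH P) X' Θ' (C.subst θ)) :
    Der (HH P) X Θ C := by
  refine Der.def_elim (.inr .isImp) Hs hHs hp ?_
  rintro c rfl X' θ u d Θ' ha hm hF -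
  have h0 : Tm.Conv (Tm.impl (u .z) (u (.s .z))) (F.subst θ) := hm.2.2 _ .z
  have h1 : Tm.Conv (u .z) (G.subst θ) := hm.2.2 _ (.s .z)
  have h2 : Tm.Conv (u (.s .z)) (H.subst θ) := hm.2.2 _ (.s (.s .z))
  exact h _ θ _ hF (h0.symm.trans (.app (.app (.refl _) h1) h2))

/-! ### Derivations of bounded height -/

/-- The premises of a right rule, with derivations of height less than `h`. -/
inductive SeqhCase (P : List (Tm S [] .o)) (Θ : List (XFm S X)) (h : ℕ) (K : Tm S X .olist)
    (G : Tm S X .o) : Prop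
  | conj (i j : ℕ) (F H : Tm S X .o) : i < h → j < h → Tm.Conv G (Tm.conj F H) →
      Der (HH P) X Θ (seqh i K F) → Der (HH P) X Θ (seqh j K H) → SeqhCase P Θ h K G
  | impl (i : ℕ) (F H : Tm S X .o) : i < h → Tm.Conv G (Tm.impl F H) →
      Der (HH P) X Θ (seqh i (Tm.cons F K) H) → SeqhCase P Θ h K G
  | sfall (i : ℕ) (τ : Ty S.Base) (hτ : τ.IsQuant) (F : Tm S X (.arr τ .o)) (N : ℕ) : i < h →
      Tm.Conv G (Tm.sfall τ hτ F) →
      (∀ n, N ≤ n → Der (HH P) X Θ (seqh i K (.app F (.nom n)))) → SeqhCase P Θ h K G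
  | atom (i : ℕ) (F : Tm S X .o) : i < h → Der (HH P) X Θ (atomic G) →
      Der (HH P) X Θ (.or (member F K) (prog F)) → Der (HH P) X Θ (bch i K F G) →
      SeqhCase P Θ h K G

/-- A single fresh nominal constant suffices to introduce the quantifier. `seqAny_sfall` uses this
form, because the height it finds belongs to one chosen constant. -/
theorem seqh_sfall {h i : ℕ} {hτ : τ.IsQuant} {K : Tm S X .olist} {G : Tm S X .o}
    {F : Tm S X (.arr τ .o)} {n : ℕ} (hi : i < h) (hG : Tm.Conv G (Tm.sfall τ hτ F))
    (hK : ¬ K.Occ (τ, n)) (hF : ¬ F.Occ (τ, n))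
    (hd : Der (HH P) X Θ (seqh i K (.app F (.nom n)))) : Der (HH P) X Θ (seqh h K G) := by
  refine .def_intro (Sub.cons K (Sub.cons F Sub.nil)) ⟨i, hi, .inr (.inr (.inl ⟨τ, hτ, rfl⟩))⟩
    (Var.forall_two (.refl K) hG.symm) (.nab_intro (n := n) ?_ ?_)
  · rw [seqh_subst]
    exact not_occ_app_shift hK hF
  · exact .uncast (seqh_subst ..) hd

theorem SeqhCase.der {h : ℕ} {K : Tm S X .olist} {G : Tm S X .o} (hc : SeqhCase P Θ h K G) :
    Der (HH P) X Θ (seqh h K G) := by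
  rcases hc with ⟨i, j, F, H, hi, hj, hG, hF, hH⟩ | ⟨i, F, H, hi, hG, hF⟩ |
    ⟨i, τ, hτ, F, N, hi, hG, hF⟩ | ⟨i, F, hi, hA, hM, hF⟩
  · exact .def_intro (Sub.cons K (Sub.cons F (Sub.cons H Sub.nil)))
      ⟨i, hi, .inl ⟨j, hj, rfl⟩⟩ (Var.forall_two (.refl K) hG.symm)
      (.andR (.uncast (seqh_subst ..) hF) (.uncast (seqh_subst ..) hH))
  · exact .def_intro (Sub.cons K (Sub.cons F (Sub.cons H Sub.nil)))
      ⟨i, hi, .inr (.inl rfl)⟩ (Var.forall_two (.refl K) hG.symm)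
      (.uncast (seqh_subst ..) hF)
  · obtain ⟨n, hn, hf⟩ := exists_fresh K F N
    have hf := hf n le_rfl τ
    exact seqh_sfall hi hG hf.1 hf.2 (hF n hn)
  · refine .def_intro (Sub.cons K (Sub.cons G Sub.nil)) ⟨i, hi, .inr (.inr (.inr rfl))⟩
      (Var.forall_two (.refl K) (.refl G)) (.ex_intro F (.andR ?_ (.andR ?_ ?_)))
    · exact .uncast (atomic_subst ..) hA
    · exact .uncast (congrArg₂ Fm.or (member_subst ..) (prog_subst ..)) hM
    · exact .uncast (bch_subst ..) hF

theorem Fm.Avoids.comp {L : Lang S} {θ : Sub S X Δ} {η : Sub S Δ Ξ} {B : Fm L X}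
    (h : Fm.Avoids θ B) (hη : ∀ a : Nom S, ¬ Sub.Occ a η) : Fm.Avoids (θ.comp η) B :=
  fun a ha => h a ((Sub.occ_comp ha).resolve_right (hη a))

theorem seqh_elim {h : ℕ} {K : Tm S X .olist} {G : Tm S X .o} (Hs : List (XFm S X))
    (hHs : ∀ B ∈ Hs, Der (HH P) X Θ B) (hp : Der (HH P) X Θ (seqh h K G))
    (hcase : ∀ (X' : List (Ty S.Base)) (θ : Sub S X X') (Θ' : List (XFm S X')),
      Fm.Avoids θ (seqh h K G) → (∀ B ∈ Hs, Der (HH P) X' Θ' (B.subst θ)) →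
      SeqhCase P Θ' h (K.subst θ) (G.subst θ) → Der (HH P) X' Θ' (C.subst θ)) :
    Der (HH P) X Θ C := by
  refine Der.def_elim (.inr (.seqh h)) Hs hHs hp ?_
  rintro c ⟨i, hi, ⟨j, hj, rfl⟩ | rfl | ⟨τ, hτ, rfl⟩ | rfl⟩ X' θ u d Θ' ha hm hF hb
  · have h0 : Tm.Conv (u .z) (K.subst θ) := hm.2.2 _ .z
    have h1 : Tm.Conv (Tm.conj (u (.s .z)) (u (.s (.s .z)))) (G.subst θ) := hm.2.2 _ (.s .z)
    refine hcase _ θ _ ha hF (.conj i j _ _ hi hj h1.symm ?_ ?_)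
    · exact (hb.and_left.cast (seqh_subst ..)).atom_conv (Var.forall_two h0 (.refl _))
    · exact (hb.and_right.cast (seqh_subst ..)).atom_conv (Var.forall_two h0 (.refl _))
  · have h0 : Tm.Conv (u .z) (K.subst θ) := hm.2.2 _ .z
    have h1 : Tm.Conv (Tm.impl (u (.s .z)) (u (.s (.s .z)))) (G.subst θ) := hm.2.2 _ (.s .z)
    refine hcase _ θ _ ha hF (.impl i _ _ hi h1.symm ?_)
    exact (hb.cast (seqh_subst ..)).atom_conv (Var.forall_two (.app (.refl _) h0) (.refl _))
  · have h0 : Tm.Conv (u .z) (K.subst θ) := hm.2.2 _ .z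
    have h1 : Tm.Conv (Tm.sfall τ hτ (u (.s .z))) (G.subst θ) := hm.2.2 _ (.s .z)
    obtain ⟨N, hN⟩ := hb.nab_elim_large
    refine hcase _ θ _ ha hF (.sfall i τ hτ _ N hi h1.symm fun n hn => ?_)
    exact ((hN n hn).cast (seqh_subst ..)).atom_conv (Var.forall_two h0 (.refl _))
  · have h0 : Tm.Conv (u .z) (K.subst θ) := hm.2.2 _ .z
    have h1 : Tm.Conv (u (.s .z)) (G.subst θ) := hm.2.2 _ (.s .z)
    -- Opening the existential brings a second substitution. It contains no nominal constants, so
    -- the composite still satisfies the avoidance condition.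
    refine Der.ex_elim (Hs.map (Fm.subst θ)) (by simpa using hF) hb ?_
    intro X'' η F Θ'' hη hF' hb'
    have h0' := h0.subst η
    have h1' := h1.subst η
    rw [Tm.subst_subst] at h0' h1'
    rw [Fm.subst_subst]
    refine hcase _ (θ.comp η) _ (ha.comp hη)
      (by simpa only [List.forall_mem_map, Fm.subst_subst] using hF') (.atom i F hi ?_ ?_ ?_)
    · exact (hb'.and_left.cast (atomic_subst ..)).atom_conv (Var.forall_one h1')
    · refine .or_elim hb'.and_right.and_left (.orR₁ ?_) (.orR₂ ?_)
      · exact ((Der.ax (.head _)).cast (member_subst ..)).atom_conv (Var.forall_two (.refl _) h0')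
      · exact (Der.ax (.head _)).cast (prog_subst ..)
    · exact (hb'.and_right.and_right.cast (bch_subst ..)).atom_conv
        (Var.forall_three h0' (.refl _) h1')

/-- The premises of a left rule, with derivations of height less than `h`. -/
inductive BchCase (P : List (Tm S [] .o)) (Θ : List (XFm S X)) (h : ℕ) (K : Tm S X .olist)
    (F A : Tm S X .o) : Prop
  | match : Tm.Conv F A → BchCase P Θ h K F A
  | dec (i : ℕ) (H : Tm S X .o) : i < h → Der (HH P) X Θ (dec F H) →
      Der (HH P) X Θ (bch i K H A) → BchCase P Θ h K F A
  | impl (i j : ℕ) (G H : Tm S X .o) : i < h → j < h → Tm.Conv F (Tm.impl G H) →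
      Der (HH P) X Θ (seqh i K G) → Der (HH P) X Θ (bch j K H A) → BchCase P Θ h K F A

theorem BchCase.der {h : ℕ} {K : Tm S X .olist} {F A : Tm S X .o} (hc : BchCase P Θ h K F A) :
    Der (HH P) X Θ (bch h K F A) := by
  rcases hc with hF | ⟨i, H, hi, hF, hH⟩ | ⟨i, j, G, H, hi, hj, hF, hG, hH⟩
  · exact .def_intro (Sub.cons K (Sub.cons A Sub.nil)) (.inl rfl)
      (Var.forall_three (.refl K) hF.symm (.refl A)) .topR
  · exact .def_intro (Sub.cons K (Sub.cons F (Sub.cons A Sub.nil))) (.inr ⟨i, hi, .inl rfl⟩)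
      (Var.forall_three (.refl K) (.refl F) (.refl A))
      (.ex_intro H (.andR (.uncast (dec_subst ..) hF) (.uncast (bch_subst ..) hH)))
  · exact .def_intro (Sub.cons K (Sub.cons G (Sub.cons H (Sub.cons A Sub.nil))))
      (.inr ⟨i, hi, .inr ⟨j, hj, rfl⟩⟩) (Var.forall_three (.refl K) hF.symm (.refl A))
      (.andR (.uncast (seqh_subst ..) hG) (.uncast (bch_subst ..) hH))

theorem bch_elim {h : ℕ} {K : Tm S X .olist} {F A : Tm S X .o} (Hs : List (XFm S X))
    (hHs : ∀ B ∈ Hs, Der (HH P) X Θ B) (hp : Der (HH P) X Θ (bch h K F A))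
    (hcase : ∀ (X' : List (Ty S.Base)) (θ : Sub S X X') (Θ' : List (XFm S X')),
      Fm.Avoids θ (bch h K F A) → (∀ B ∈ Hs, Der (HH P) X' Θ' (B.subst θ)) →
      BchCase P Θ' h (K.subst θ) (F.subst θ) (A.subst θ) → Der (HH P) X' Θ' (C.subst θ)) :
    Der (HH P) X Θ C := by
  refine Der.def_elim (.inr (.bch h)) Hs hHs hp ?_
  rintro c (rfl | ⟨i, hi, rfl | ⟨j, hj, rfl⟩⟩) X' θ u d Θ' ha hm hF hb
  · have h1 : Tm.Conv (u (.s .z)) (F.subst θ) := hm.2.2 _ (.s .z)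
    have h2 : Tm.Conv (u (.s .z)) (A.subst θ) := hm.2.2 _ (.s (.s .z))
    exact hcase _ θ _ ha hF (.match (h1.symm.trans h2))
  · have h0 : Tm.Conv (u .z) (K.subst θ) := hm.2.2 _ .z
    have h1 : Tm.Conv (u (.s .z)) (F.subst θ) := hm.2.2 _ (.s .z)
    have h2 : Tm.Conv (u (.s (.s .z))) (A.subst θ) := hm.2.2 _ (.s (.s .z))
    refine Der.ex_elim (Hs.map (Fm.subst θ)) (by simpa using hF) hb ?_
    intro X'' η H Θ'' hη hF' hb'
    have h0' := h0.subst η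
    have h1' := h1.subst η
    have h2' := h2.subst η
    rw [Tm.subst_subst] at h0' h1' h2'
    rw [Fm.subst_subst]
    refine hcase _ (θ.comp η) _ (ha.comp hη)
      (by simpa only [List.forall_mem_map, Fm.subst_subst] using hF') (.dec i H hi ?_ ?_)
    · exact (hb'.and_left.cast (dec_subst ..)).atom_conv (Var.forall_two h1' (.refl _))
    · exact (hb'.and_right.cast (bch_subst ..)).atom_conv (Var.forall_three h0' (.refl _) h2')
  · have h0 : Tm.Conv (u .z) (K.subst θ) := hm.2.2 _ .z
    have h1 : Tm.Conv (Tm.impl (u (.s .z)) (u (.s (.s .z)))) (F.subst θ) := hm.2.2 _ (.s .z)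
    have h2 : Tm.Conv (u (.s (.s (.s .z)))) (A.subst θ) := hm.2.2 _ (.s (.s .z))
    refine hcase _ θ _ ha hF (.impl i j _ _ hi hj h1.symm ?_ ?_)
    · exact (hb.and_left.cast (seqh_subst ..)).atom_conv (Var.forall_two h0 (.refl _))
    · exact (hb.and_right.cast (bch_subst ..)).atom_conv (Var.forall_three h0 (.refl _) h2)

theorem seqAny_intro {K : Tm S X .olist} {G : Tm S X .o} (h : ℕ)
    (hd : Der (HH P) X Θ (seqh h K G)) : Der (HH P) X Θ (seqAny K G) :=
  .def_intro (Sub.cons K (Sub.cons G Sub.nil)) ⟨h, rfl⟩ (Var.forall_two (.refl K) (.refl G))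
    (.uncast (seqh_subst ..) hd)

theorem seqAny_elim {K : Tm S X .olist} {G : Tm S X .o} (Hs : List (XFm S X))
    (hHs : ∀ B ∈ Hs, Der (HH P) X Θ B) (hp : Der (HH P) X Θ (seqAny K G))
    (hcase : ∀ (X' : List (Ty S.Base)) (θ : Sub S X X') (Θ' : List (XFm S X')),
      Fm.Avoids θ (seqAny K G) → (∀ B ∈ Hs, Der (HH P) X' Θ' (B.subst θ)) →
      ∀ h, Der (HH P) X' Θ' (seqh h (K.subst θ) (G.subst θ)) → Der (HH P) X' Θ' (C.subst θ)) :
    Der (HH P) X Θ C := by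
  refine Der.def_elim (.inr .seqAny) Hs hHs hp ?_
  rintro c ⟨h, rfl⟩ X' θ u d Θ' ha hm hF hb
  have h0 : Tm.Conv (u .z) (K.subst θ) := hm.2.2 _ .z
  have h1 : Tm.Conv (u (.s .z)) (G.subst θ) := hm.2.2 _ (.s .z)
  exact hcase _ θ _ ha hF h ((hb.cast (seqh_subst ..)).atom_conv (Var.forall_two h0 h1))

theorem bcAny_intro {K : Tm S X .olist} {F A : Tm S X .o} (h : ℕ)
    (hd : Der (HH P) X Θ (bch h K F A)) : Der (HH P) X Θ (bcAny K F A) :=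
  .def_intro (Sub.cons K (Sub.cons F (Sub.cons A Sub.nil))) ⟨h, rfl⟩
    (Var.forall_three (.refl K) (.refl F) (.refl A)) (.uncast (bch_subst ..) hd)

theorem bcAny_elim {K : Tm S X .olist} {F A : Tm S X .o} (Hs : List (XFm S X))
    (hHs : ∀ B ∈ Hs, Der (HH P) X Θ B) (hp : Der (HH P) X Θ (bcAny K F A))
    (hcase : ∀ (X' : List (Ty S.Base)) (θ : Sub S X X') (Θ' : List (XFm S X')),
      (∀ B ∈ Hs, Der (HH P) X' Θ' (B.subst θ)) →
      ∀ h, Der (HH P) X' Θ' (bch h (K.subst θ) (F.subst θ) (A.subst θ)) →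
      Der (HH P) X' Θ' (C.subst θ)) :
    Der (HH P) X Θ C := by
  refine Der.def_elim (.inr .bcAny) Hs hHs hp ?_
  rintro c ⟨h, rfl⟩ X' θ u d Θ' ha hm hF hb
  have h0 : Tm.Conv (u .z) (K.subst θ) := hm.2.2 _ .z
  have h1 : Tm.Conv (u (.s .z)) (F.subst θ) := hm.2.2 _ (.s .z)
  have h2 : Tm.Conv (u (.s (.s .z))) (A.subst θ) := hm.2.2 _ (.s (.s .z))
  exact hcase _ θ _ hF h ((hb.cast (bch_subst ..)).atom_conv (Var.forall_three h0 h1 h2))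

end Derivations

/-! ### Equivalence of derivability with derivability at some height. -/

section BoundedHeight

variable {X X' Γ Δ Ξ : List (Ty S.Base)} {σ τ ρ : Ty S.Base}
variable {P : List (Tm S [] .o)} {Θ : List (XFm S X)} {C : XFm S X}

theorem memh_subst (θ : Sub S Γ Δ) (h : ℕ) (E : Tm S Γ .o) (K : Tm S Γ .olist) :
    (memh h E K).subst θ = memh h (E.subst θ) (K.subst θ) :=
  congrArg (Fm.atom _) (Sub.two_comp E K θ)

theorem memAny_subst (θ : Sub S Γ Δ) (E : Tm S Γ .o) (K : Tm S Γ .olist) :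
    (memAny E K).subst θ = memAny (E.subst θ) (K.subst θ) :=
  congrArg (Fm.atom _) (Sub.two_comp E K θ)

/-! ### Every derivation has a height -/

theorem memh_here (h : ℕ) (E : Tm S X .o) (K : Tm S X .olist) :
    Der (HH P) X Θ (memh h E (Tm.cons E K)) :=
  .def_intro (Sub.cons E (Sub.cons K Sub.nil)) (.inl rfl)
    (Var.forall_two (.refl E) (.refl (Tm.cons E K))) .topR

theorem memh_there {h i : ℕ} (hi : i < h) {E : Tm S X .o} {K : Tm S X .olist} (F : Tm S X .o)
    (hd : Der (HH P) X Θ (memh i E K)) : Der (HH P) X Θ (memh h E (Tm.cons F K)) :=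
  .def_intro (Sub.cons E (Sub.cons F (Sub.cons K Sub.nil))) (.inr ⟨i, hi, rfl⟩)
    (Var.forall_two (.refl E) (.refl (Tm.cons F K))) (.uncast (memh_subst ..) hd)

theorem memh_elim {h : ℕ} {E : Tm S X .o} {K : Tm S X .olist} (Hs : List (XFm S X))
    (hHs : ∀ B ∈ Hs, Der (HH P) X Θ B) (hp : Der (HH P) X Θ (memh h E K))
    (hcase : ∀ (X' : List (Ty S.Base)) (θ : Sub S X X') (Θ' : List (XFm S X'))
      (F : Tm S X' .o) (K' : Tm S X' .olist), Fm.Avoids θ (memh h E K) →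
      (∀ B ∈ Hs, Der (HH P) X' Θ' (B.subst θ)) → Tm.Conv (K.subst θ) (Tm.cons F K') →
      (Tm.Conv (E.subst θ) F ∨ ∃ i < h, Der (HH P) X' Θ' (memh i (E.subst θ) K')) →
      Der (HH P) X' Θ' (C.subst θ)) :
    Der (HH P) X Θ C := by
  refine Der.def_elim (.inr (.memh h)) Hs hHs hp ?_
  rintro c (rfl | ⟨i, hi, rfl⟩) X' θ u d Θ' ha hm hF hb
  · have h0 : Tm.Conv (u .z) (E.subst θ) := hm.2.2 _ .z
    have h1 : Tm.Conv (Tm.cons (u .z) (u (.s .z))) (K.subst θ) := hm.2.2 _ (.s .z)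
    exact hcase _ θ _ _ _ ha hF h1.symm (.inl h0.symm)
  · have h0 : Tm.Conv (u .z) (E.subst θ) := hm.2.2 _ .z
    have h1 : Tm.Conv (Tm.cons (u (.s .z)) (u (.s (.s .z)))) (K.subst θ) := hm.2.2 _ (.s .z)
    exact hcase _ θ _ _ _ ha hF h1.symm
      (.inr ⟨i, hi, (hb.cast (memh_subst ..)).atom_conv (Var.forall_two h0 (.refl _))⟩)

theorem memAny_intro {E : Tm S X .o} {K : Tm S X .olist} (h : ℕ)
    (hd : Der (HH P) X Θ (memh h E K)) : Der (HH P) X Θ (memAny E K) :=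
  .def_intro (Sub.cons E (Sub.cons K Sub.nil)) ⟨h, rfl⟩ (Var.forall_two (.refl E) (.refl K))
    (.uncast (memh_subst ..) hd)

theorem memAny_elim {E : Tm S X .o} {K : Tm S X .olist} (Hs : List (XFm S X))
    (hHs : ∀ B ∈ Hs, Der (HH P) X Θ B) (hp : Der (HH P) X Θ (memAny E K))
    (hcase : ∀ (X' : List (Ty S.Base)) (θ : Sub S X X') (Θ' : List (XFm S X')),
      Fm.Avoids θ (memAny E K) → (∀ B ∈ Hs, Der (HH P) X' Θ' (B.subst θ)) →
      ∀ h, Der (HH P) X' Θ' (memh h (E.subst θ) (K.subst θ)) → Der (HH P) X' Θ' (C.subst θ)) :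
    Der (HH P) X Θ C := by
  refine Der.def_elim (.inr .memAny) Hs hHs hp ?_
  rintro c ⟨h, rfl⟩ X' θ u d Θ' ha hm hF hb
  have h0 : Tm.Conv (u .z) (E.subst θ) := hm.2.2 _ .z
  have h1 : Tm.Conv (u (.s .z)) (K.subst θ) := hm.2.2 _ (.s .z)
  exact hcase _ θ _ ha hF h ((hb.cast (memh_subst ..)).atom_conv (Var.forall_two h0 h1))

theorem memAny_there {E : Tm S X .o} {K : Tm S X .olist} (F : Tm S X .o)
    (h : Der (HH P) X Θ (memAny E K)) : Der (HH P) X Θ (memAny E (Tm.cons F K)) := by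
  refine memAny_elim [] (by simp) h fun X' θ Θ' _ _ h hd => ?_
  exact .uncast (memAny_subst ..) (memAny_intro (h + 1) (memh_there h.lt_succ_self _ hd))

/-- The invariant for the induction on membership. -/
def memberInv : ∀ q : HHPred ⊕ AuxPred, XFm S (Sum.elim (HHPred.ar S) (AuxPred.ar S) q)
  | .inl .member => memAny v0 v1
  | _ => .top

/-- An induction inside the calculus with invariant `memAny`. The other predicates of level 0 are
formally simultaneous with `member`, and get the trivial invariant. -/
theorem memAny_of_member {E : Tm S X .o} {K : Tm S X .olist}
    (h : Der (HH P) X Θ (member E K)) : Der (HH P) X Θ (memAny E K) := by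
  refine h.cut' (.ind (.inl .member) memberInv (.head _) ?_ ?_
    ((Der.ax (.head _)).cast (memAny_subst ..)))
  · rintro (q | q) hq a
    · cases q
      case member =>
        exact Sub.not_occ_cons not_false (Sub.not_occ_cons not_false (Sub.not_occ_nil a))
      all_goals exact not_false
    · exact not_false
  · rintro (q | q) hq c hc
    · cases q
      case member =>
        rcases hc with rfl | rfl
        · exact .uncast (memAny_subst ..) (memAny_intro 0 (memh_here ..))
        · refine .uncast (memAny_subst ..) (memAny_there _ ?_)
          exact (Der.ax (.head _)).cast ((if_pos rfl).trans (memAny_subst ..))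
      case prog => obtain ⟨F, -, rfl⟩ := hc; exact .topR
      case isForall => obtain ⟨τ, hτ, rfl⟩ := hc; exact .topR
      all_goals exact absurd hq (by simp [encoding, HHPred.lvl])
    · exfalso
      cases q <;> simp [encoding, AuxPred.lvl, HHPred.lvl] at hq

/-- Two nested case analyses expose the heights of the premises, and `max i j + 1` strictly exceeds
both. -/
theorem seqAny_conj {K : Tm S X .olist} {G F H : Tm S X .o} (hG : Tm.Conv G (Tm.conj F H))
    (hF : Der (HH P) X Θ (seqAny K F)) (hH : Der (HH P) X Θ (seqAny K H)) :
    Der (HH P) X Θ (seqAny K G) := by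
  refine seqAny_elim [seqAny K H] (Der.hyps_one hH) hF fun X₁ θ₁ Θ₁ _ hs₁ i hi => ?_
  refine .uncast (seqAny_subst ..) (seqAny_elim [_] (Der.hyps_one hi)
    ((hs₁ _ (.head _)).cast (seqAny_subst ..)) fun X₂ θ₂ Θ₂ _ hs₂ j hj => ?_)
  refine .uncast (seqAny_subst ..) (seqAny_intro (max i j + 1) (SeqhCase.der ?_))
  exact .conj i j _ _ (by omega) (by omega) ((hG.subst θ₁).subst θ₂)
    ((hs₂ _ (.head _)).cast (seqh_subst ..)) hj

theorem seqAny_impl {K : Tm S X .olist} {G F H : Tm S X .o} (hG : Tm.Conv G (Tm.impl F H))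
    (hH : Der (HH P) X Θ (seqAny (Tm.cons F K) H)) : Der (HH P) X Θ (seqAny K G) :=
  seqAny_elim [] (by simp) hH fun _ θ _ _ _ i hi =>
    .uncast (seqAny_subst ..) (seqAny_intro (i + 1) (SeqhCase.der
      (.impl i _ _ i.lt_succ_self (hG.subst θ) hi)))

theorem seqAny_sfall {hτ : τ.IsQuant} {K : Tm S X .olist} {G : Tm S X .o}
    {F : Tm S X (.arr τ .o)} {n : ℕ} (hG : Tm.Conv G (Tm.sfall τ hτ F))
    (hK : ¬ K.Occ (τ, n)) (hF : ¬ F.Occ (τ, n))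
    (hd : Der (HH P) X Θ (seqAny K (.app F (.nom n)))) : Der (HH P) X Θ (seqAny K G) := by
  refine seqAny_elim [] (by simp) hd fun X' θ Θ' ha _ i hi => ?_
  -- The constant occurs in the analysed atom, as the argument of `F`. The unifying substitution
  -- therefore avoids it, and its freshness survives.
  have hθ : ¬ Sub.Occ (τ, n) θ := fun h => ha _ h ⟨_, .s .z, .inr rfl⟩
  refine .uncast (seqAny_subst ..) (seqAny_intro (i + 1)
    (seqh_sfall i.lt_succ_self (hG.subst θ) (fun h => ?_) (fun h => ?_) hi))
  · exact (Tm.occ_subst _ _ h).elim hK hθ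
  · exact (Tm.occ_subst _ _ h).elim hF hθ

theorem seqAny_atom {K : Tm S X .olist} {F G : Tm S X .o} (hA : Der (HH P) X Θ (atomic G))
    (hM : Der (HH P) X Θ (.or (member F K) (prog F))) (hd : Der (HH P) X Θ (bcAny K F G)) :
    Der (HH P) X Θ (seqAny K G) := by
  refine bcAny_elim [_, _] (Der.hyps_two hA hM) hd fun X' θ Θ' hs i hi => ?_
  refine .uncast (seqAny_subst ..) (seqAny_intro (i + 1) (SeqhCase.der
    (.atom i (F.subst θ) i.lt_succ_self ?_ ?_ hi)))
  · exact (hs _ (.head _)).cast (atomic_subst ..)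
  · exact (hs _ (.tail _ (.head _))).cast (congrArg₂ Fm.or (member_subst ..) (prog_subst ..))

theorem bcAny_dec {K : Tm S X .olist} {F H A : Tm S X .o} (hF : Der (HH P) X Θ (dec F H))
    (hd : Der (HH P) X Θ (bcAny K H A)) : Der (HH P) X Θ (bcAny K F A) :=
  bcAny_elim [_] (Der.hyps_one hF) hd fun _ _ _ hs i hi =>
    .uncast (bcAny_subst ..) (bcAny_intro (i + 1) (BchCase.der
      (.dec i _ i.lt_succ_self ((hs _ (.head _)).cast (dec_subst ..)) hi)))

theorem bcAny_impl {K : Tm S X .olist} {F G H A : Tm S X .o} (hF : Tm.Conv F (Tm.impl G H))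
    (hG : Der (HH P) X Θ (seqAny K G)) (hd : Der (HH P) X Θ (bcAny K H A)) :
    Der (HH P) X Θ (bcAny K F A) := by
  refine bcAny_elim [_] (Der.hyps_one hG) hd fun X₁ θ₁ Θ₁ hs₁ i hi => ?_
  refine .uncast (bcAny_subst ..) (seqAny_elim [_] (Der.hyps_one hi)
    ((hs₁ _ (.head _)).cast (seqAny_subst ..)) fun X₂ θ₂ Θ₂ _ hs₂ j hj => ?_)
  refine .uncast (bcAny_subst ..) (bcAny_intro (max i j + 1) (BchCase.der ?_))
  exact .impl j i _ _ (by omega) (by omega) ((hF.subst θ₁).subst θ₂) hj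
    ((hs₂ _ (.head _)).cast (bch_subst ..))

/-- The invariants for the induction on derivations. -/
def seqInv : ∀ q : HHPred ⊕ AuxPred, XFm S (Sum.elim (HHPred.ar S) (AuxPred.ar S) q)
  | .inl .seq => seqAny v0 v1
  | .inl .bc => bcAny v0 v1 v2
  | _ => .top

theorem replace_seq (K : Tm S Γ .olist) (G : Tm S Γ .o) :
    (seq K G : XFm S Γ).replace (HH P).lvl 2 seqInv = seqAny K G :=
  (if_pos rfl).trans (seqAny_subst ..)

theorem replace_bc (K : Tm S Γ .olist) (F G : Tm S Γ .o) :
    (bc K F G : XFm S Γ).replace (HH P).lvl 2 seqInv = bcAny K F G :=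
  (if_pos rfl).trans (bcAny_subst ..)

theorem not_occ_seqInv (a : Nom S) (q : HHPred ⊕ AuxPred) : ¬ (seqInv q : XFm S _).Occ a := by
  rcases q with q | q
  · cases q
    case seq => exact Sub.not_occ_cons not_false (Sub.not_occ_cons not_false (Sub.not_occ_nil a))
    case bc =>
      exact Sub.not_occ_cons not_false (Sub.not_occ_cons not_false
        (Sub.not_occ_cons not_false (Sub.not_occ_nil a)))
    all_goals exact not_false
  · exact not_false

/-- Each clause of `seq` and `bc` is matched by the corresponding rule for `seqAny` and `bcAny`.
`Fm.replace` has put these invariants in place of the recursive atoms. -/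
theorem seqInv_closed (q : HHPred ⊕ AuxPred) (hq : (HH P).lvl q = 2)
    (c : Clause (hhLang (auxLang S)) q) (hc : c ∈ (HH P).clauses q) :
    Der (HH P) c.xs [c.body.replace (HH P).lvl 2 seqInv]
      (Fm.nabs c.zs ((seqInv q).subst c.head)) := by
  rcases q with q | q
  · cases q
    case seq =>
      rcases hc with (rfl | rfl | rfl | rfl) | ⟨τ, hτ, rfl⟩
      · have hb := (Der.ax (D := HH P) (.head [])).cast
          (congrArg₂ Fm.and (replace_seq (P := P) (Γ := [.olist, .o, .o]) v0 v1)
            (replace_seq (P := P) (Γ := [.olist, .o, .o]) v0 v2))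
        exact .uncast (seqAny_subst ..)
          (seqAny_conj (.refl (Tm.conj v1 v2)) hb.and_left hb.and_right)
      · have hb := (Der.ax (D := HH P) (.head [])).cast
          (replace_seq (P := P) (Γ := [.olist, .o, .o]) (Tm.cons v1 v0) v2)
        exact .uncast (seqAny_subst ..) (seqAny_impl (.refl (Tm.impl v1 v2)) hb)
      · refine Der.ex_elim (u := Sub.id) [] (by simp)
          ((Der.ax (.head [])).cast (Fm.subst_id _).symm) ?_
        intro X' θ F Θ' _ _ hb
        refine .uncast ((congrArg _ (seqAny_subst ..)).trans (seqAny_subst ..))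
          (seqAny_atom (F := F) (hb.and_left.cast (atomic_subst ..))
          (.orR₁ (hb.and_right.and_left.cast (member_subst ..))) ?_)
        exact hb.and_right.and_right.cast ((congrArg _ (replace_bc ..)).trans (bcAny_subst ..))
      · refine Der.ex_elim (u := Sub.id) [] (by simp)
          ((Der.ax (.head [])).cast (Fm.subst_id _).symm) ?_
        intro X' θ F Θ' _ _ hb
        refine .uncast ((congrArg _ (seqAny_subst ..)).trans (seqAny_subst ..))
          (seqAny_atom (F := F) (hb.and_left.cast (atomic_subst ..))
          (.orR₂ (hb.and_right.and_left.cast (prog_subst ..))) ?_)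
        exact hb.and_right.and_right.cast ((congrArg _ (replace_bc ..)).trans (bcAny_subst ..))
      · obtain ⟨N, hN⟩ := Der.nab_elim_large (u := Sub.id)
          ((Der.ax (D := HH P) (.head [])).cast (Fm.subst_id _).symm)
        -- In a clause the context and the abstracted formula are variables, so every nominal
        -- constant is fresh for them.
        refine .uncast (seqAny_subst ..) (seqAny_sfall (n := N) (.refl (Tm.sfall τ hτ v1))
          not_false not_false ?_)
        exact (hN N le_rfl).cast ((congrArg _ (replace_seq ..)).trans (seqAny_subst ..))
    case bc =>
      rcases hc with (rfl | rfl | rfl) | ⟨τ, hτ, rfl⟩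
      · have hb := (Der.ax (D := HH P) (.head [])).cast
          (congrArg₂ Fm.or (replace_bc (P := P) (Γ := [.olist, .o, .o, .o]) v0 v1 v3)
            (replace_bc (P := P) (Γ := [.olist, .o, .o, .o]) v0 v2 v3))
        refine .uncast (bcAny_subst ..) (hb.or_elim ?_ ?_)
        · exact bcAny_dec (DecCase.der (.left _ (.refl (Tm.conj v1 v2)))) (.ax (.head _))
        · exact bcAny_dec (DecCase.der (.right _ (.refl (Tm.conj v1 v2)))) (.ax (.head _))
      · have hb := (Der.ax (D := HH P) (.head [])).cast
          (congrArg₂ Fm.and (replace_seq (P := P) (Γ := [.olist, .o, .o, .o]) v0 v1)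
            (replace_bc (P := P) (Γ := [.olist, .o, .o, .o]) v0 v2 v3))
        exact .uncast (bcAny_subst ..) (bcAny_impl (.refl (Tm.impl v1 v2)) hb.and_left hb.and_right)
      · exact .uncast (bcAny_subst ..) (bcAny_intro 0 (BchCase.der (.match (.refl v1))))
      · refine Der.ex_elim (u := Sub.id) [] (by simp)
          ((Der.ax (.head [])).cast (Fm.subst_id _).symm) ?_
        intro X' θ t Θ' _ _ hb
        refine .uncast ((congrArg _ (bcAny_subst ..)).trans (bcAny_subst ..))
          (bcAny_dec (DecCase.der (.inst τ hτ _ t (.refl _) (.refl _))) ?_)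
        exact hb.cast ((congrArg _ (replace_bc ..)).trans (bcAny_subst ..))
    all_goals exact absurd hq (by simp [encoding, HHPred.lvl])
  · exfalso
    cases q <;> simp [encoding, AuxPred.lvl] at hq <;> omega

/-- From here on, induction over specification derivations takes place at the metalevel. -/
theorem seqAny_of_seq {K : Tm S X .olist} {G : Tm S X .o} (h : Der (HH P) X Θ (seq K G)) :
    Der (HH P) X Θ (seqAny K G) :=
  h.cut' (.ind (.inl .seq) seqInv (.head _) (fun q _ a => not_occ_seqInv a q) seqInv_closed
    ((Der.ax (.head _)).cast (seqAny_subst ..)))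

theorem bc_dec {K : Tm S X .olist} {F H A : Tm S X .o} (hF : Der (HH P) X Θ (dec F H))
    (hd : Der (HH P) X Θ (bc K H A)) : Der (HH P) X Θ (bc K F A) := by
  refine dec_elim [_] (Der.hyps_one hd) hF fun X' θ Θ' _ hs hc => .uncast (bc_subst ..) ?_
  have hd := (hs _ (.head _)).cast (bc_subst ..)
  rcases hc with ⟨G, hF⟩ | ⟨G, hF⟩ | ⟨τ, hτ, G, t, hF, hH⟩
  · exact bc_conj hF (.inl hd)
  · exact bc_conj hF (.inr hd)
  · exact bc_sfall hF t (hd.atom_conv (Var.forall_three (.refl _) hH (.refl _)))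

/-- Heights can be forgotten: metalevel induction on `h` replays each bounded rule by the
corresponding clause of the encoding. -/
theorem seq_and_bc_of_height (P : List (Tm S [] .o)) (h : ℕ) :
    (∀ (X : List (Ty S.Base)) (Θ : List (XFm S X)) (K : Tm S X .olist) (G : Tm S X .o),
      Der (HH P) X Θ (seqh h K G) → Der (HH P) X Θ (seq K G)) ∧
    ∀ (X : List (Ty S.Base)) (Θ : List (XFm S X)) (K : Tm S X .olist) (F A : Tm S X .o),
      Der (HH P) X Θ (bch h K F A) → Der (HH P) X Θ (bc K F A) := by
  induction h using Nat.strong_induction_on with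
  | h h ih =>
  constructor
  · intro X Θ K G hd
    refine seqh_elim [] (by simp) hd fun X' θ Θ' _ _ hc => .uncast (seq_subst ..) (SeqCase.der ?_)
    rcases hc with ⟨i, j, F, H, hi, hj, hG, hF, hH⟩ | ⟨i, F, H, hi, hG, hF⟩ |
      ⟨i, τ, hτ, F, N, hi, hG, hF⟩ | ⟨i, F, hi, hA, hM, hF⟩
    · exact .conj F H hG ((ih i hi).1 _ _ _ _ hF) ((ih j hj).1 _ _ _ _ hH)
    · exact .impl F H hG ((ih i hi).1 _ _ _ _ hF)
    · exact .sfall τ hτ F N hG fun n hn => (ih i hi).1 _ _ _ _ (hF n hn)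
    · exact .atom F hA hM ((ih i hi).2 _ _ _ _ _ hF)
  · intro X Θ K F A hd
    refine bch_elim [] (by simp) hd fun X' θ Θ' _ _ hc => .uncast (bc_subst ..) ?_
    rcases hc with hF | ⟨i, H, hi, hF, hH⟩ | ⟨i, j, G, H, hi, hj, hF, hG, hH⟩
    · exact bc_match hF
    · exact bc_dec hF ((ih i hi).2 _ _ _ _ _ hH)
    · exact bc_impl hF ((ih i hi).1 _ _ _ _ hG) ((ih j hj).2 _ _ _ _ _ hH)

theorem seq_of_seqh {h : ℕ} {K : Tm S X .olist} {G : Tm S X .o}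
    (hd : Der (HH P) X Θ (seqh h K G)) : Der (HH P) X Θ (seq K G) :=
  (seq_and_bc_of_height P h).1 _ _ _ _ hd

end BoundedHeight

/-! ### Height-preserving monotonicity and replacement of nominal constants. -/

section Admissibility

variable {X X' Γ Δ Ξ : List (Ty S.Base)} {σ τ ρ : Ty S.Base}
variable {P : List (Tm S [] .o)} {Θ : List (XFm S X)} {C : XFm S X}

/-! ### Inclusion of lists and monotonicity -/

theorem sub_intro {K K' : Tm S X .olist} (Hs : List (XFm S X))
    (hHs : ∀ B ∈ Hs, Der (HH P) X Θ B)
    (h : ∀ (X' : List (Ty S.Base)) (θ : Sub S X X') (E : Tm S X' .o) (Θ' : List (XFm S X')),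
      (∀ B ∈ Hs, Der (HH P) X' Θ' (B.subst θ)) → Der (HH P) X' Θ' (member E (K.subst θ)) →
      Der (HH P) X' Θ' (member E (K'.subst θ))) :
    Der (HH P) X Θ (sub K K') := by
  refine .def_intro (Sub.cons K (Sub.cons K' Sub.nil)) rfl (Var.forall_two (.refl K) (.refl K'))
    (.all_intro Hs hHs fun X' θ E Θ' _ hs => .impR (.uncast (member_subst ..) ?_))
  exact h X' θ E _ (fun B hB => (hs B hB).weaken (List.subset_cons_self _ _))
    ((Der.ax (.head _)).cast (member_subst ..))

theorem sub_elim {K K' : Tm S X .olist} {E : Tm S X .o} (h : Der (HH P) X Θ (sub K K'))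
    (hE : Der (HH P) X Θ (member E K)) : Der (HH P) X Θ (member E K') := by
  refine Der.def_elim (.inr .sub) [_] (Der.hyps_one hE) h ?_
  rintro c rfl X' θ u d Θ' - hm hs hb
  have h0 : Tm.Conv (u .z) (K.subst θ) := hm.2.2 _ .z
  have h1 : Tm.Conv (u (.s .z)) (K'.subst θ) := hm.2.2 _ (.s .z)
  have hE : Der (HH P) X' Θ' (member (E.subst θ) (u .z)) :=
    ((hs _ (.head _)).cast (member_subst ..)).atom_conv
      (Var.forall_two (.refl (E.subst θ)) h0.symm)
  have hE' : Der (HH P) X' Θ' (member (E.subst θ) (u (.s .z))) :=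
    ((Der.all_elim (u := u) (E.subst θ) hb).imp_elim (.uncast (member_subst ..) hE)).cast
      (member_subst ..)
  exact .uncast (member_subst ..) (hE'.atom_conv (Var.forall_two (.refl _) h1))

theorem sub_refl (K : Tm S X .olist) : Der (HH P) X Θ (sub K K) :=
  sub_intro [] (by simp) fun _ _ _ _ _ h => h

theorem sub_trans {K₁ K₂ K₃ : Tm S X .olist} (h : Der (HH P) X Θ (sub K₁ K₂))
    (h' : Der (HH P) X Θ (sub K₂ K₃)) : Der (HH P) X Θ (sub K₁ K₃) :=
  sub_intro [_, _] (Der.hyps_two h h') fun _ _ _ _ hs hE =>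
    sub_elim ((hs _ (.tail _ (.head _))).cast (sub_subst ..))
      (sub_elim ((hs _ (.head _)).cast (sub_subst ..)) hE)

theorem sub_cons_right {K K' : Tm S X .olist} (F : Tm S X .o) (h : Der (HH P) X Θ (sub K K')) :
    Der (HH P) X Θ (sub K (Tm.cons F K')) :=
  sub_intro [_] (Der.hyps_one h) fun _ _ _ _ hs hE =>
    member_there _ (sub_elim ((hs _ (.head _)).cast (sub_subst ..)) hE)

/-- A member of `F :: K` is `F` or a member of `K`. -/
theorem member_cons_elim {E F : Tm S X .o} {K : Tm S X .olist} (Hs : List (XFm S X))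
    (hHs : ∀ B ∈ Hs, Der (HH P) X Θ B) (hp : Der (HH P) X Θ (member E (Tm.cons F K)))
    (h : ∀ (X' : List (Ty S.Base)) (θ : Sub S X X') (Θ' : List (XFm S X')),
      (∀ B ∈ Hs, Der (HH P) X' Θ' (B.subst θ)) →
      (Tm.Conv (E.subst θ) (F.subst θ) ∨ Der (HH P) X' Θ' (member (E.subst θ) (K.subst θ))) →
      Der (HH P) X' Θ' (C.subst θ)) :
    Der (HH P) X Θ C := by
  refine member_elim Hs hHs hp fun X' θ Θ' F' K' _ hs hK hE => h _ θ _ hs ?_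
  obtain ⟨hF, hK⟩ := Tm.Conv.cons_inj (F := F.subst θ) (K := K.subst θ) hK
  exact hE.imp (fun hE => hE.trans hF.symm)
    (fun hE => hE.atom_conv (Var.forall_two (.refl _) hK.symm))

theorem sub_cons {K K' : Tm S X .olist} (F : Tm S X .o) (h : Der (HH P) X Θ (sub K K')) :
    Der (HH P) X Θ (sub (Tm.cons F K) (Tm.cons F K')) := by
  refine sub_intro [_] (Der.hyps_one h) fun X' θ E Θ' hs hE => ?_
  refine member_cons_elim [_] (Der.hyps_one ((hs _ (.head _)).cast (sub_subst ..))) hE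
    fun X'' η Θ'' hs' hE' => .uncast (member_subst ..) ?_
  rcases hE' with hE' | hE'
  · exact (member_here (F.subst θ |>.subst η) (K'.subst θ |>.subst η)).atom_conv
      (Var.forall_two hE'.symm (.refl _))
  · exact member_there _ (sub_elim ((hs' _ (.head _)).cast (sub_subst ..)) hE')

/-- The lists vary in the induction because the implication rule extends both by the same formula;
`sub_cons` preserves the inclusion. -/
theorem mono_of_height (P : List (Tm S [] .o)) (h : ℕ) :
    (∀ (X : List (Ty S.Base)) (Θ : List (XFm S X)) (K K' : Tm S X .olist) (G : Tm S X .o),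
      Der (HH P) X Θ (sub K K') → Der (HH P) X Θ (seqh h K G) → Der (HH P) X Θ (seqh h K' G)) ∧
    ∀ (X : List (Ty S.Base)) (Θ : List (XFm S X)) (K K' : Tm S X .olist) (F A : Tm S X .o),
      Der (HH P) X Θ (sub K K') → Der (HH P) X Θ (bch h K F A) →
      Der (HH P) X Θ (bch h K' F A) := by
  induction h using Nat.strong_induction_on with
  | h h ih =>
  constructor
  · intro X Θ K K' G hK hd
    refine seqh_elim [_] (Der.hyps_one hK) hd fun X' θ Θ' _ hs hc =>
      .uncast (seqh_subst ..) (SeqhCase.der ?_)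
    have hK := (hs _ (.head _)).cast (sub_subst ..)
    rcases hc with ⟨i, j, F, H, hi, hj, hG, hF, hH⟩ | ⟨i, F, H, hi, hG, hF⟩ |
      ⟨i, τ, hτ, F, N, hi, hG, hF⟩ | ⟨i, F, hi, hA, hM, hF⟩
    · exact .conj i j F H hi hj hG ((ih i hi).1 _ _ _ _ _ hK hF) ((ih j hj).1 _ _ _ _ _ hK hH)
    · exact .impl i F H hi hG ((ih i hi).1 _ _ _ _ _ (sub_cons F hK) hF)
    · exact .sfall i τ hτ F N hi hG fun n hn => (ih i hi).1 _ _ _ _ _ hK (hF n hn)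
    · refine .atom i F hi hA (hM.or_elim (.orR₁ ?_) (.orR₂ (.ax (.head _))))
        ((ih i hi).2 _ _ _ _ _ _ hK hF)
      exact sub_elim (hK.weaken (List.subset_cons_self _ _)) (.ax (.head _))
  · intro X Θ K K' F A hK hd
    refine bch_elim [_] (Der.hyps_one hK) hd fun X' θ Θ' _ hs hc =>
      .uncast (bch_subst ..) (BchCase.der ?_)
    have hK := (hs _ (.head _)).cast (sub_subst ..)
    rcases hc with hF | ⟨i, H, hi, hF, hH⟩ | ⟨i, j, G, H, hi, hj, hF, hG, hH⟩
    · exact .match hF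
    · exact .dec i H hi hF ((ih i hi).2 _ _ _ _ _ _ hK hH)
    · exact .impl i j G H hi hj hF ((ih i hi).1 _ _ _ _ _ hK hG)
        ((ih j hj).2 _ _ _ _ _ _ hK hH)

theorem seqh_mono {h : ℕ} {K K' : Tm S X .olist} {G : Tm S X .o}
    (hK : Der (HH P) X Θ (sub K K')) (hd : Der (HH P) X Θ (seqh h K G)) :
    Der (HH P) X Θ (seqh h K' G) := (mono_of_height P h).1 _ _ _ _ _ hK hd

theorem seq_mono {K K' : Tm S X .olist} {G : Tm S X .o} (hK : Der (HH P) X Θ (sub K K'))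
    (hd : Der (HH P) X Θ (seq K G)) : Der (HH P) X Θ (seq K' G) :=
  seqAny_elim [_] (Der.hyps_one hK) (seqAny_of_seq hd) fun _ _ _ _ hs _ hh =>
    .uncast (seq_subst ..) (seq_of_seqh (seqh_mono ((hs _ (.head _)).cast (sub_subst ..)) hh))

/-! ### Instantiation -/

theorem Ty.IsQuant.target_ne_o : ∀ {τ : Ty S.Base}, τ.IsQuant → τ.target ≠ .o
  | .base _, _ => by simp [Ty.target]
  | .arr _ b, h => Ty.IsQuant.target_ne_o (τ := b) h.2

theorem Tm.Occ.subst {a : Nom S} {t : Tm S Γ τ} (h : t.Occ a) :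
    ∀ {Δ : List (Ty S.Base)} (θ : Sub S Γ Δ), (t.subst θ).Occ a := by
  induction t with
  | var v => exact h.elim
  | con c => exact h.elim
  | nom n => intros; exact h
  | app f b hf hb => intro Δ θ; exact h.imp (fun h => hf h θ) (fun h => hb h θ)
  | lam b hb => intro Δ θ; exact hb h _

variable {a : Nom S}

theorem member_of_memh {h : ℕ} : ∀ {X : List (Ty S.Base)} {Θ : List (XFm S X)} {E : Tm S X .o}
    {K : Tm S X .olist}, Der (HH P) X Θ (memh h E K) → Der (HH P) X Θ (member E K) := by
  induction h using Nat.strong_induction_on with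
  | h h ih =>
  intro X Θ E K hd
  refine memh_elim [] (by simp) hd fun X' θ Θ' F K' _ _ hK hE => .uncast (member_subst ..) ?_
  rcases hE with hE | ⟨i, hi, hE⟩
  · exact (member_here F K').atom_conv (Var.forall_two hE.symm hK.symm)
  · exact (member_there F (ih i hi hE)).atom_conv (Var.forall_two (.refl _) hK.symm)

theorem member_nsub_of_memh {h : ℕ} : ∀ {X : List (Ty S.Base)} {Θ : List (XFm S X)}
    {E : Tm S X .o} {K : Tm S X .olist} (t : Tm S X a.1), Der (HH P) X Θ (memh h E K) →
    Der (HH P) X Θ (member (E.nsub a t) (K.nsub a t)) := by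
  induction h using Nat.strong_induction_on with
  | h h ih =>
  intro X Θ E K t hd
  -- If `a` occurs in the atom, the substitutions of the case analysis avoid it and commute with the
  -- replacement. If not, the replacement changes nothing. The later lemmas on `nsub` use the same
  -- dichotomy.
  by_cases ho : E.Occ a ∨ K.Occ a
  · refine memh_elim [] (by simp) hd fun X' θ Θ' F K' ha _ hK hE => .uncast (member_subst ..) ?_
    have hθ : ¬ Sub.Occ a θ := fun h => ha _ h (ho.elim (fun h => ⟨_, .z, h⟩)
      (fun h => ⟨_, .s .z, h⟩))
    rw [Tm.subst_nsub _ _ hθ, Tm.subst_nsub _ _ hθ]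
    rcases hE with hE | ⟨i, hi, hE⟩
    · exact (member_here (F.nsub a _) (K'.nsub a _)).atom_conv
        (Var.forall_two (hE.symm.nsub a _) (hK.symm.nsub a _))
    · exact (member_there (F.nsub a _) (ih i hi _ hE)).atom_conv
        (Var.forall_two (.refl _) (hK.symm.nsub a _))
  · rw [not_or] at ho
    rw [Tm.nsub_of_not_occ _ ho.1, Tm.nsub_of_not_occ _ ho.2]
    exact member_of_memh hd

theorem member_nsub {E : Tm S X .o} {K : Tm S X .olist} (t : Tm S X a.1)
    (h : Der (HH P) X Θ (member E K)) :
    Der (HH P) X Θ (member (E.nsub a t) (K.nsub a t)) := by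
  by_cases ho : E.Occ a ∨ K.Occ a
  · refine memAny_elim [] (by simp) (memAny_of_member h) fun X' θ Θ' ha _ i hi =>
      .uncast (member_subst ..) ?_
    have hθ : ¬ Sub.Occ a θ := fun h => ha _ h (ho.elim (fun h => ⟨_, .z, h⟩)
      (fun h => ⟨_, .s .z, h⟩))
    rw [Tm.subst_nsub _ _ hθ, Tm.subst_nsub _ _ hθ]
    exact member_nsub_of_memh _ hi
  · rw [not_or] at ho
    rwa [Tm.nsub_of_not_occ _ ho.1, Tm.nsub_of_not_occ _ ho.2]

/-- Program formulas contain no nominal constants, so the replacement fixes them. -/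
theorem prog_nsub (hP : ∀ F ∈ P, ∀ a : Nom S, ¬ F.Occ a) {F : Tm S X .o} (t : Tm S X a.1)
    (h : Der (HH P) X Θ (prog F)) : Der (HH P) X Θ (prog (F.nsub a t)) := by
  by_cases ho : F.Occ a
  · refine prog_elim [] (by simp) h fun X' θ Θ' ha _ ⟨F₀, hF₀, hF⟩ => .uncast (prog_subst ..) ?_
    rw [Tm.subst_nsub _ _ fun h => ha _ h ⟨_, .z, ho⟩]
    have hF := hF.nsub a (t.subst θ)
    rw [Tm.nsub_of_not_occ _ fun h =>
      (Tm.occ_subst _ _ h).elim (hP _ hF₀ a) (Sub.not_occ_nil a)] at hF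
    exact prog_intro hF₀ hF
  · rwa [Tm.nsub_of_not_occ _ ho]

theorem dec_nsub {F H : Tm S X .o} (t : Tm S X a.1) (h : Der (HH P) X Θ (dec F H)) :
    Der (HH P) X Θ (dec (F.nsub a t) (H.nsub a t)) := by
  by_cases ho : F.Occ a ∨ H.Occ a
  · refine dec_elim [] (by simp) h fun X' θ Θ' ha _ hc => .uncast (dec_subst ..) ?_
    have hθ : ¬ Sub.Occ a θ := fun h => ha _ h (ho.elim (fun h => ⟨_, .z, h⟩)
      (fun h => ⟨_, .s .z, h⟩))
    rw [Tm.subst_nsub _ _ hθ, Tm.subst_nsub _ _ hθ]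
    rcases hc with ⟨G, hF⟩ | ⟨G, hF⟩ | ⟨τ, hτ, G, t', hF, hH⟩
    · exact DecCase.der (.left _ (hF.nsub a _))
    · exact DecCase.der (.right _ (hF.nsub a _))
    · exact DecCase.der (.inst τ hτ _ _ (hF.nsub a _) (hH.nsub a _))
  · rw [not_or] at ho
    rwa [Tm.nsub_of_not_occ _ ho.1, Tm.nsub_of_not_occ _ ho.2]

theorem Tm.NotCompound.nsub (ha : a.1.target ≠ .o) {F : Tm S X .o} (h : F.NotCompound)
    (t : Tm S X a.1) : (F.nsub a t).NotCompound := by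
  refine ⟨fun G H hc => ?_, fun G H hc => ?_, fun τ hτ G hc => ?_⟩
  · obtain ⟨G', H', hc⟩ := Tm.conv_conj_of_nsub ha hc
    exact h.1 _ _ hc
  · obtain ⟨G', H', hc⟩ := Tm.conv_impl_of_nsub ha hc
    exact h.2.1 _ _ hc
  · obtain ⟨G', hc⟩ := Tm.conv_sfall_of_nsub ha hc
    exact h.2.2 _ _ _ hc

/-- To refute a compound form of the replaced formula, unify with that form. `Tm.NotCompound.nsub`
shows that `F` itself was already compound, which contradicts the assumption that it is atomic. -/
theorem atomic_nsub (ha : a.1.target ≠ .o) {F : Tm S X .o} (t : Tm S X a.1)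
    (h : Der (HH P) X Θ (atomic F)) : Der (HH P) X Θ (atomic (F.nsub a t)) := by
  by_cases ho : F.Occ a
  swap
  · rwa [Tm.nsub_of_not_occ _ ho]
  have key : ∀ {X : List (Ty S.Base)} {Θ : List (XFm S X)} {F : Tm S X .o} {t : Tm S X a.1},
      F.Occ a → Der (HH P) X Θ (atomic F) →
      ∀ {E : Tm S X .o}, (∀ (X' : List (Ty S.Base)) (θ : Sub S X X'),
        Tm.Conv ((F.nsub a t).subst θ) (E.subst θ) → ¬ ((F.nsub a t).subst θ).NotCompound) →
      Der (HH P) X Θ (neg (.eq (F.nsub a t) E)) := by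
    intro X Θ F t ho h E hE
    refine .impR (Der.eq_elim [_] (Der.hyps_one (h.weaken (List.subset_cons_self _ _)))
      (.ax (.head _)) fun X' θ Θ' hav hc hs => ?_)
    have hθ : ¬ Sub.Occ a θ := fun h => hav _ (.head _) _ h ⟨_, .z, ho⟩
    have hn := hE X' θ hc
    rw [Tm.subst_nsub _ _ hθ] at hn
    exact atomic_elim ((hs _ (.head _)).cast (atomic_subst ..)) fun h => hn (h.nsub ha _)
  refine .def_intro (Sub.cons (F.nsub a t) Sub.nil) rfl (Var.forall_one (.refl _))
    (.andR (.impR ?_) (.andR ?_ ?_))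
  -- The kept formula `atomic F` contains `a`, which forces the unifier to avoid `a`. The analysed
  -- atom alone need not contain it after the replacement.
  · refine Der.def_elim_avoids (.inl .isForall) [_]
      (Der.hyps_one (h.weaken (List.subset_cons_self _ _))) (.ax (.head _)) ?_
    rintro c ⟨τ, hτ, rfl⟩ X' θ u d Θ' - hav hm hs -
    have hθ : ¬ Sub.Occ a θ := fun h => hav _ (.head _) _ h ⟨_, .z, ho⟩
    have h0 : Tm.Conv (Tm.sfall τ hτ (u .z)) ((F.nsub a t).subst θ) := hm.2.2 _ .z
    rw [Tm.subst_nsub _ _ hθ] at h0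
    exact atomic_elim ((hs _ (.head _)).cast (atomic_subst ..)) fun h =>
      (h.nsub ha _).2.2 τ hτ _ h0.symm
  · refine Der.all_intro [_] (Der.hyps_one h) fun X₁ θ₁ G Θ₁ hp₁ hs₁ => ?_
    refine Der.all_intro [_] (Der.hyps_one ((hs₁ _ (.head _)).cast (atomic_subst ..)))
      fun X₂ θ₂ H Θ₂ hp₂ hs₂ => ?_
    have := key (t := (t.subst θ₁).subst θ₂) (E := Tm.conj (G.subst θ₂) H) ((ho.subst θ₁).subst θ₂)
      ((hs₂ _ (.head _)).cast (atomic_subst ..)) fun X' θ hc hn => hn.1 _ _ hc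
    rw [← Tm.subst_nsub _ _ (hp₂ a), ← Tm.subst_nsub _ _ (hp₁ a)] at this
    exact this
  · refine Der.all_intro [_] (Der.hyps_one h) fun X₁ θ₁ G Θ₁ hp₁ hs₁ => ?_
    refine Der.all_intro [_] (Der.hyps_one ((hs₁ _ (.head _)).cast (atomic_subst ..)))
      fun X₂ θ₂ H Θ₂ hp₂ hs₂ => ?_
    have := key (t := (t.subst θ₁).subst θ₂) (E := Tm.impl (G.subst θ₂) H) ((ho.subst θ₁).subst θ₂)
      ((hs₂ _ (.head _)).cast (atomic_subst ..)) fun X' θ hc hn => hn.2.1 _ _ hc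
    rw [← Tm.subst_nsub _ _ (hp₂ a), ← Tm.subst_nsub _ _ (hp₁ a)] at this
    exact this

/-- The height is unchanged. This matters for cut, where a universal formula is instantiated in a
derivation that must remain lower. -/
theorem nsub_of_height (hP : ∀ F ∈ P, ∀ a : Nom S, ¬ F.Occ a) (ha : a.1.target ≠ .o) (h : ℕ) :
    (∀ (X : List (Ty S.Base)) (Θ : List (XFm S X)) (K : Tm S X .olist) (G : Tm S X .o)
      (t : Tm S X a.1), Der (HH P) X Θ (seqh h K G) →
      Der (HH P) X Θ (seqh h (K.nsub a t) (G.nsub a t))) ∧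
    ∀ (X : List (Ty S.Base)) (Θ : List (XFm S X)) (K : Tm S X .olist) (F A : Tm S X .o)
      (t : Tm S X a.1), Der (HH P) X Θ (bch h K F A) →
      Der (HH P) X Θ (bch h (K.nsub a t) (F.nsub a t) (A.nsub a t)) := by
  induction h using Nat.strong_induction_on with
  | h h ih =>
  constructor
  · intro X Θ K G t hd
    by_cases ho : K.Occ a ∨ G.Occ a
    swap
    · rw [not_or] at ho
      rwa [Tm.nsub_of_not_occ _ ho.1, Tm.nsub_of_not_occ _ ho.2]
    refine seqh_elim [] (by simp) hd fun X' θ Θ' hav _ hc =>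
      .uncast (seqh_subst ..) (SeqhCase.der ?_)
    have hθ : ¬ Sub.Occ a θ := fun h => hav _ h (ho.elim (fun h => ⟨_, .z, h⟩)
      (fun h => ⟨_, .s .z, h⟩))
    rw [Tm.subst_nsub _ _ hθ, Tm.subst_nsub _ _ hθ]
    rcases hc with ⟨i, j, F, H, hi, hj, hG, hF, hH⟩ | ⟨i, F, H, hi, hG, hF⟩ |
      ⟨i, τ, hτ, F, N, hi, hG, hF⟩ | ⟨i, F, hi, hA, hM, hF⟩
    · exact .conj i j _ _ hi hj (hG.nsub a _) ((ih i hi).1 _ _ _ _ _ hF)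
        ((ih j hj).1 _ _ _ _ _ hH)
    · exact .impl i _ _ hi (hG.nsub a _) ((ih i hi).1 _ _ _ _ _ hF)
    -- Indices above `a.2` keep the constant chosen for the quantifier distinct from `a`, so that
    -- the replacement leaves it alone.
    · refine .sfall i τ hτ _ (max N (a.2 + 1)) hi (hG.nsub a _) fun n hn => ?_
      have hd := (ih i hi).1 _ _ _ _ (t.subst θ) (hF n (by omega))
      have hne : a ≠ (τ, n) := fun h => by subst h; exact absurd hn (by simp)
      rwa [show (Tm.app F (.nom n)).nsub a (t.subst θ) = .app (F.nsub a (t.subst θ)) (.nom n) from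
        congrArg (Tm.app _) (Tm.nsub_nom_of_ne _ hne)] at hd
    · refine .atom i (F.nsub a (t.subst θ)) hi (atomic_nsub ha _ hA) (hM.or_elim (.orR₁ ?_)
        (.orR₂ ?_)) ((ih i hi).2 _ _ _ _ _ _ hF)
      · exact member_nsub _ (.ax (.head _))
      · exact prog_nsub hP _ (.ax (.head _))
  · intro X Θ K F A t hd
    by_cases ho : K.Occ a ∨ F.Occ a ∨ A.Occ a
    swap
    · rw [not_or, not_or] at ho
      rwa [Tm.nsub_of_not_occ _ ho.1, Tm.nsub_of_not_occ _ ho.2.1, Tm.nsub_of_not_occ _ ho.2.2]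
    refine bch_elim [] (by simp) hd fun X' θ Θ' hav _ hc =>
      .uncast (bch_subst ..) (BchCase.der ?_)
    have hθ : ¬ Sub.Occ a θ := fun h => hav _ h (by
      rcases ho with ho | ho | ho
      · exact ⟨_, .z, ho⟩
      · exact ⟨_, .s .z, ho⟩
      · exact ⟨_, .s (.s .z), ho⟩)
    rw [Tm.subst_nsub _ _ hθ, Tm.subst_nsub _ _ hθ, Tm.subst_nsub _ _ hθ]
    rcases hc with hF | ⟨i, H, hi, hF, hH⟩ | ⟨i, j, G, H, hi, hj, hF, hG, hH⟩
    · exact .match (hF.nsub a _)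
    · exact .dec i _ hi (dec_nsub _ hF) ((ih i hi).2 _ _ _ _ _ _ hH)
    · exact .impl i j _ _ hi hj (hF.nsub a _) ((ih i hi).1 _ _ _ _ _ hG)
        ((ih j hj).2 _ _ _ _ _ _ hH)

theorem seqh_nsub (hP : ∀ F ∈ P, ∀ a : Nom S, ¬ F.Occ a) (ha : a.1.target ≠ .o) {h : ℕ}
    {K : Tm S X .olist} {G : Tm S X .o} (t : Tm S X a.1) (hd : Der (HH P) X Θ (seqh h K G)) :
    Der (HH P) X Θ (seqh h (K.nsub a t) (G.nsub a t)) := (nsub_of_height hP ha h).1 _ _ _ _ _ hd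

end Admissibility

/-! ### Depth-indexed reducibility, neutral hypotheses and environments. -/

section Reducibility

variable {X X' Γ Δ Ξ : List (Ty S.Base)} {σ τ ρ : Ty S.Base}
variable {P : List (Tm S [] .o)} {Θ : List (XFm S X)} {C : XFm S X}

/-! ### Reducible formulas -/

theorem redBase_subst (θ : Sub S Γ Δ) (b : Bool) (K : Tm S Γ .olist) (F : Tm S Γ .o) :
    (redBase b K F).subst θ = redBase b (K.subst θ) (F.subst θ) := by
  cases b
  · exact congrArg₂ Fm.imp (atomic_subst ..) (seq_subst ..)
  · exact seq_subst ..

theorem redBase_conv {b : Bool} {K K' : Tm S X .olist} {F F' : Tm S X .o}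
    (h : Der (HH P) X Θ (redBase b K F)) (hK : Tm.Conv K K') (hF : Tm.Conv F F') :
    Der (HH P) X Θ (redBase b K' F') := by
  refine h.conv ?_
  cases b
  · exact .imp (.atom _ (Var.forall_one hF)) (.atom _ (Var.forall_two hK hF))
  · exact .atom _ (Var.forall_two hK hF)

/-- The equations `k = i + 1` treat depth 0, where the component conditions are vacuous, together
with positive depth. -/
theorem red_intro {b : Bool} {k : ℕ} {K : Tm S X .olist} {F : Tm S X .o}
    (hb : Der (HH P) X Θ (redBase b K F)) (Hs : List (XFm S X))
    (hHs : ∀ B ∈ Hs, Der (HH P) X Θ B)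
    (hdec : ∀ i, k = i + 1 → ∀ (X' : List (Ty S.Base)) (θ : Sub S X X') (H : Tm S X' .o)
      (Θ' : List (XFm S X')), (∀ B ∈ Hs, Der (HH P) X' Θ' (B.subst θ)) →
      Der (HH P) X' Θ' (dec (F.subst θ) H) → Der (HH P) X' Θ' (red b i (K.subst θ) H))
    (himp : ∀ i, k = i + 1 → ∀ (X' : List (Ty S.Base)) (θ : Sub S X X') (K' : Tm S X' .olist)
      (G H : Tm S X' .o) (Θ' : List (XFm S X')), (∀ B ∈ Hs, Der (HH P) X' Θ' (B.subst θ)) →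
      Der (HH P) X' Θ' (isImp (F.subst θ) G H) → Der (HH P) X' Θ' (sub (K.subst θ) K') →
      Der (HH P) X' Θ' (red (!b) i K' G) → Der (HH P) X' Θ' (red b i K' H)) :
    Der (HH P) X Θ (red b k K F) := by
  rcases k with _ | i
  · exact .def_intro (Sub.cons K (Sub.cons F Sub.nil)) rfl (Var.forall_two (.refl K) (.refl F))
      (.uncast (redBase_subst ..) hb)
  · refine .def_intro (Sub.cons K (Sub.cons F Sub.nil)) rfl (Var.forall_two (.refl K) (.refl F))
      (.andR (.uncast (redBase_subst ..) hb) (.andR ?_ ?_))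
    · refine .all_intro Hs hHs fun X' θ H Θ' _ hs => .impR (.uncast (red_subst ..) ?_)
      exact hdec i rfl X' θ H _ (fun B hB => (hs B hB).weaken (List.subset_cons_self _ _))
        ((Der.ax (.head _)).cast (dec_subst ..))
    · refine .all_intro Hs hHs fun X₁ θ₁ K' Θ₁ _ hs₁ => ?_
      refine .all_intro (Hs.map (Fm.subst θ₁)) (by simpa using hs₁) fun X₂ θ₂ G Θ₂ _ hs₂ => ?_
      refine .all_intro ((Hs.map (Fm.subst θ₁)).map (Fm.subst θ₂))
        (by simpa only [List.forall_mem_map] using hs₂) fun X₃ θ₃ H Θ₃ _ hs₃ => ?_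
      refine .impR (.impR (.impR (.uncast (red_subst ..) ?_)))
      refine himp i rfl X₃ ((θ₁.comp θ₂).comp θ₃) ((K'.subst θ₂).subst θ₃) (G.subst θ₃) H _
        (fun B hB => ?_) ?_ ?_ ?_
      · have := hs₃ _ (List.mem_map_of_mem (List.mem_map_of_mem hB))
        rw [Fm.subst_subst B θ₁ θ₂, Fm.subst_subst] at this
        refine this.weaken fun A hA => ?_
        exact .tail _ (.tail _ (.tail _ hA))
      · refine (Der.ax (.tail _ (.tail _ (.head _)))).cast ((isImp_subst ..).trans ?_)
        rw [← Tm.subst_subst, ← Tm.subst_subst]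
        rfl
      · refine (Der.ax (.tail _ (.head _))).cast ((sub_subst ..).trans ?_)
        rw [← Tm.subst_subst, ← Tm.subst_subst]
        rfl
      · exact (Der.ax (.head _)).cast (red_subst ..)

theorem red_base {b : Bool} {k : ℕ} {K : Tm S X .olist} {F : Tm S X .o}
    (h : Der (HH P) X Θ (red b k K F)) : Der (HH P) X Θ (redBase b K F) := by
  refine Der.def_elim (.inr (.red b k)) [] (by simp) h ?_
  rintro c rfl X' θ u d Θ' - hm - hb
  have h0 : Tm.Conv (u .z) (K.subst θ) := hm.2.2 _ .z
  have h1 : Tm.Conv (u (.s .z)) (F.subst θ) := hm.2.2 _ (.s .z)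
  refine .uncast (redBase_subst ..) (redBase_conv ?_ h0 h1)
  rcases k with _ | k
  · exact hb.cast (redBase_subst ..)
  · exact hb.and_left.cast (redBase_subst ..)

theorem red_dec {b : Bool} {k : ℕ} {K : Tm S X .olist} {F H : Tm S X .o}
    (h : Der (HH P) X Θ (red b (k + 1) K F)) (hF : Der (HH P) X Θ (dec F H)) :
    Der (HH P) X Θ (red b k K H) := by
  refine Der.def_elim (.inr (.red b (k + 1))) [_] (Der.hyps_one hF) h ?_
  rintro c rfl X' θ u d Θ' - hm hs hb
  have h0 : Tm.Conv (u .z) (K.subst θ) := hm.2.2 _ .z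
  have h1 : Tm.Conv (u (.s .z)) (F.subst θ) := hm.2.2 _ (.s .z)
  have hF : Der (HH P) X' Θ' (dec (u (.s .z)) (H.subst θ)) :=
    ((hs _ (.head _)).cast (dec_subst ..)).atom_conv (Var.forall_two h1.symm (.refl _))
  have hH : Der (HH P) X' Θ' (red b k (u .z) (H.subst θ)) :=
    ((Der.all_elim (u := u) (H.subst θ) hb.and_right.and_left).imp_elim
      (.uncast (dec_subst ..) hF)).cast (red_subst ..)
  exact .uncast (red_subst ..) (hH.atom_conv (Var.forall_two h0 (.refl _)))

theorem red_imp {b : Bool} {k : ℕ} {K K' : Tm S X .olist} {F G H : Tm S X .o}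
    (h : Der (HH P) X Θ (red b (k + 1) K F)) (hF : Der (HH P) X Θ (isImp F G H))
    (hK : Der (HH P) X Θ (sub K K')) (hG : Der (HH P) X Θ (red (!b) k K' G)) :
    Der (HH P) X Θ (red b k K' H) := by
  refine Der.def_elim (.inr (.red b (k + 1))) [_, _, _] (Der.hyps_three hF hK hG) h ?_
  rintro c rfl X' θ u d Θ' - hm hs hb
  have h0 : Tm.Conv (u .z) (K.subst θ) := hm.2.2 _ .z
  have h1 : Tm.Conv (u (.s .z)) (F.subst θ) := hm.2.2 _ (.s .z)
  have hF : Der (HH P) X' Θ' (isImp (u (.s .z)) (G.subst θ) (H.subst θ)) :=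
    ((hs _ (.head _)).cast (isImp_subst ..)).atom_conv
      (Var.forall_three h1.symm (.refl _) (.refl _))
  have hK : Der (HH P) X' Θ' (sub (u .z) (K'.subst θ)) :=
    ((hs _ (.tail _ (.head _))).cast (sub_subst ..)).atom_conv
      (Var.forall_two h0.symm (.refl _))
  have hG := (hs _ (.tail _ (.tail _ (.head _)))).cast (red_subst ..)
  have hall := Der.all_elim (H.subst θ) (Der.all_elim (G.subst θ)
    (Der.all_elim (u := u) (K'.subst θ) hb.and_right.and_right))
  exact .uncast (red_subst ..) ((((hall.imp_elim (.uncast (isImp_subst ..) hF)).imp_elim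
    (.uncast (sub_subst ..) hK)).imp_elim (.uncast (red_subst ..) hG)).cast (red_subst ..))

/-- The base condition is monotone by `seq_mono`, and the implication condition already quantifies
over all extensions of the context. -/
theorem red_mono {b : Bool} {k : ℕ} : ∀ {X : List (Ty S.Base)} {Θ : List (XFm S X)}
    {K K' : Tm S X .olist} {F : Tm S X .o}, Der (HH P) X Θ (sub K K') →
    Der (HH P) X Θ (red b k K F) → Der (HH P) X Θ (red b k K' F) := by
  induction k with
  | zero =>
    intro X Θ K K' F hK h
    refine red_intro ?_ [] (by simp) (by simp) (by simp)
    cases b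
    · exact .impR (seq_mono (hK.weaken (List.subset_cons_self _ _))
        (((red_base h).weaken (List.subset_cons_self _ _)).imp_elim (.ax (.head _))))
    · exact seq_mono hK (red_base h)
  | succ k ih =>
    intro X Θ K K' F hK h
    refine red_intro ?_ [_, _] (Der.hyps_two hK h) ?_ ?_
    · cases b
      · exact .impR (seq_mono (hK.weaken (List.subset_cons_self _ _))
          (((red_base h).weaken (List.subset_cons_self _ _)).imp_elim (.ax (.head _))))
      · exact seq_mono hK (red_base h)
    · rintro _ ⟨⟩ X' θ H Θ' hs hF
      exact ih ((hs _ (.head _)).cast (sub_subst ..))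
        (red_dec ((hs _ (.tail _ (.head _))).cast (red_subst ..)) hF)
    · rintro _ ⟨⟩ X' θ L G H Θ' hs hF hL hG
      exact red_imp ((hs _ (.tail _ (.head _))).cast (red_subst ..)) hF
        (sub_trans ((hs _ (.head _)).cast (sub_subst ..)) hL) hG

/-- A formula that is reducible as a goal is reducible as a hypothesis. -/
theorem red_false_of_true {k : ℕ} : ∀ {X : List (Ty S.Base)} {Θ : List (XFm S X)}
    {K : Tm S X .olist} {F : Tm S X .o},
    Der (HH P) X Θ (red true k K F) → Der (HH P) X Θ (red false k K F) := by
  induction k with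
  | zero =>
    intro X Θ K F h
    exact red_intro (.impR ((red_base h).weaken (List.subset_cons_self _ _))) [] (by simp)
      (by simp) (by simp)
  | succ k ih =>
    intro X Θ K F h
    refine red_intro (.impR ((red_base h).weaken (List.subset_cons_self _ _))) [_]
      (Der.hyps_one h) ?_ ?_
    · rintro _ ⟨⟩ X' θ H Θ' hs hF
      exact ih (red_dec ((hs _ (.head _)).cast (red_subst ..)) hF)
    · rintro _ ⟨⟩ X' θ L G H Θ' hs hF hL hG
      -- The antecedent is given as a goal but must be supplied as a hypothesis. The induction
      -- hypothesis converts it, and then converts the conclusion.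
      exact ih (red_imp ((hs _ (.head _)).cast (red_subst ..)) hF hL (ih hG))

/-! ### Formulas usable as hypotheses -/

theorem ne_intro {K : Tm S X .olist} {F : Tm S X .o} (Hs : List (XFm S X))
    (hHs : ∀ B ∈ Hs, Der (HH P) X Θ B)
    (h : ∀ (X' : List (Ty S.Base)) (θ : Sub S X X') (L : Tm S X' .olist) (A : Tm S X' .o)
      (Θ' : List (XFm S X')), (∀ B ∈ Hs, Der (HH P) X' Θ' (B.subst θ)) →
      Der (HH P) X' Θ' (sub (K.subst θ) L) → Der (HH P) X' Θ' (bc L (F.subst θ) A) →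
      Der (HH P) X' Θ' (atomic A) → Der (HH P) X' Θ' (seq L A)) :
    Der (HH P) X Θ (ne K F) := by
  refine .def_intro (Sub.cons K (Sub.cons F Sub.nil)) rfl (Var.forall_two (.refl K) (.refl F)) ?_
  refine .all_intro Hs hHs fun X₁ θ₁ L Θ₁ _ hs₁ => ?_
  refine .all_intro (Hs.map (Fm.subst θ₁)) (by simpa using hs₁) fun X₂ θ₂ A Θ₂ _ hs₂ => ?_
  refine .impR (.impR (.impR (.uncast (seq_subst ..) ?_)))
  refine h X₂ (θ₁.comp θ₂) (L.subst θ₂) A _ (fun B hB => ?_) ?_ ?_ ?_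
  · have := hs₂ _ (List.mem_map_of_mem hB)
    rw [Fm.subst_subst] at this
    exact this.weaken fun A hA => .tail _ (.tail _ (.tail _ hA))
  · refine (Der.ax (.tail _ (.tail _ (.head _)))).cast ((sub_subst ..).trans ?_)
    rw [← Tm.subst_subst]
    rfl
  · refine (Der.ax (.tail _ (.head _))).cast ((bc_subst ..).trans ?_)
    rw [← Tm.subst_subst]
    rfl
  · exact (Der.ax (.head _)).cast (atomic_subst ..)

theorem ne_elim {K L : Tm S X .olist} {F A : Tm S X .o} (h : Der (HH P) X Θ (ne K F))
    (hK : Der (HH P) X Θ (sub K L)) (hF : Der (HH P) X Θ (bc L F A))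
    (hA : Der (HH P) X Θ (atomic A)) : Der (HH P) X Θ (seq L A) := by
  refine Der.def_elim (.inr .ne) [_, _, _] (Der.hyps_three hK hF hA) h ?_
  rintro c rfl X' θ u d Θ' - hm hs hb
  have h0 : Tm.Conv (u .z) (K.subst θ) := hm.2.2 _ .z
  have h1 : Tm.Conv (u (.s .z)) (F.subst θ) := hm.2.2 _ (.s .z)
  have hK : Der (HH P) X' Θ' (sub (u .z) (L.subst θ)) :=
    ((hs _ (.head _)).cast (sub_subst ..)).atom_conv (Var.forall_two h0.symm (.refl _))
  have hF : Der (HH P) X' Θ' (bc (L.subst θ) (u (.s .z)) (A.subst θ)) :=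
    ((hs _ (.tail _ (.head _))).cast (bc_subst ..)).atom_conv
      (Var.forall_three (.refl _) h1.symm (.refl _))
  have hA := (hs _ (.tail _ (.tail _ (.head _)))).cast (atomic_subst ..)
  have hall := Der.all_elim (A.subst θ) (Der.all_elim (u := u) (L.subst θ) hb)
  exact .uncast (seq_subst ..) ((((hall.imp_elim (.uncast (sub_subst ..) hK)).imp_elim
    (.uncast (bc_subst ..) hF)).imp_elim (.uncast (atomic_subst ..) hA)).cast (seq_subst ..))

theorem ne_of_member {K : Tm S X .olist} {F : Tm S X .o} (h : Der (HH P) X Θ (member F K)) :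
    Der (HH P) X Θ (ne K F) :=
  ne_intro [_] (Der.hyps_one h) fun _ _ _ _ _ hs hK hF hA =>
    SeqCase.der (.atom _ hA (.orR₁ (sub_elim hK ((hs _ (.head _)).cast (member_subst ..)))) hF)

theorem ne_of_prog (K : Tm S X .olist) {F : Tm S X .o} (h : Der (HH P) X Θ (prog F)) :
    Der (HH P) X Θ (ne K F) :=
  ne_intro [_] (Der.hyps_one h) fun _ _ _ _ _ hs _ hF hA =>
    SeqCase.der (.atom _ hA (.orR₂ ((hs _ (.head _)).cast (prog_subst ..))) hF)

theorem bc_isImp {K : Tm S X .olist} {F G H A : Tm S X .o} (hF : Der (HH P) X Θ (isImp F G H))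
    (hG : Der (HH P) X Θ (seq K G)) (hH : Der (HH P) X Θ (bc K H A)) :
    Der (HH P) X Θ (bc K F A) :=
  isImp_elim [_, _] (Der.hyps_two hG hH) hF fun _ _ _ hs hF =>
    .uncast (bc_subst ..) (bc_impl hF ((hs _ (.head _)).cast (seq_subst ..))
      ((hs _ (.tail _ (.head _))).cast (bc_subst ..)))

/-- A usable formula is reducible as a hypothesis. -/
theorem red_of_ne {k : ℕ} : ∀ {X : List (Ty S.Base)} {Θ : List (XFm S X)}
    {K : Tm S X .olist} {F : Tm S X .o}, Der (HH P) X Θ (ne K F) →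
    Der (HH P) X Θ (red false k K F) := by
  have base : ∀ {X : List (Ty S.Base)} {Θ : List (XFm S X)} {K : Tm S X .olist} {F : Tm S X .o},
      Der (HH P) X Θ (ne K F) → Der (HH P) X Θ (redBase false K F) := fun h =>
    .impR (ne_elim (h.weaken (List.subset_cons_self _ _)) (sub_refl _) (bc_match (.refl _))
      (.ax (.head _)))
  induction k with
  | zero =>
    intro X Θ K F h
    exact red_intro (base h) [] (by simp) (by simp) (by simp)
  | succ k ih =>
    intro X Θ K F h
    refine red_intro (base h) [_] (Der.hyps_one h) ?_ ?_
    · rintro _ ⟨⟩ X' θ H Θ' hs hF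
      refine ih (ne_intro [_, _] (Der.hyps_two ((hs _ (.head _)).cast (ne_subst ..)) hF) ?_)
      intro X'' η L A Θ'' hs' hL hH hA
      exact ne_elim ((hs' _ (.head _)).cast (ne_subst ..)) hL
        (bc_dec ((hs' _ (.tail _ (.head _))).cast (dec_subst ..)) hH) hA
    · rintro _ ⟨⟩ X' θ K' G H Θ' hs hF hK hG
      -- The base condition of the reducible antecedent is a derivation of it, which is the side
      -- premise for focusing on the implication.
      refine ih (ne_intro [_, _, _, _] (Der.hyps_four ((hs _ (.head _)).cast (ne_subst ..)) hF hK
        (red_base hG)) ?_)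
      intro X'' η L A Θ'' hs' hL hH hA
      refine ne_elim ((hs' _ (.head _)).cast (ne_subst ..))
        (sub_trans ((hs' _ (.tail _ (.tail _ (.head _)))).cast (sub_subst ..)) hL) ?_ hA
      exact bc_isImp ((hs' _ (.tail _ (.head _))).cast (isImp_subst ..))
        (seq_mono hL ((hs' _ (.tail _ (.tail _ (.tail _ (.head _))))).cast (redBase_subst ..))) hH

/-! ### Environments -/

theorem hyp_intro {h N k : ℕ} (hk : h ≤ k) (hN : k ≤ N) {K : Tm S X .olist} {F : Tm S X .o}
    (hd : Der (HH P) X Θ (red false k K F)) : Der (HH P) X Θ (hyp h N K F) :=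
  .def_intro (Sub.cons K (Sub.cons F Sub.nil)) ⟨k, hk, hN, rfl⟩
    (Var.forall_two (.refl K) (.refl F)) (.uncast (red_subst ..) hd)

theorem hyp_elim {h N : ℕ} {K : Tm S X .olist} {F : Tm S X .o} (Hs : List (XFm S X))
    (hHs : ∀ B ∈ Hs, Der (HH P) X Θ B) (hp : Der (HH P) X Θ (hyp h N K F))
    (hcase : ∀ (X' : List (Ty S.Base)) (θ : Sub S X X') (Θ' : List (XFm S X')),
      (∀ B ∈ Hs, Der (HH P) X' Θ' (B.subst θ)) → ∀ k, h ≤ k → k ≤ N →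
      Der (HH P) X' Θ' (red false k (K.subst θ) (F.subst θ)) → Der (HH P) X' Θ' (C.subst θ)) :
    Der (HH P) X Θ C := by
  refine Der.def_elim (.inr (.hyp h N)) Hs hHs hp ?_
  rintro c ⟨k, hk, hN, rfl⟩ X' θ u d Θ' - hm hs hb
  have h0 : Tm.Conv (u .z) (K.subst θ) := hm.2.2 _ .z
  have h1 : Tm.Conv (u (.s .z)) (F.subst θ) := hm.2.2 _ (.s .z)
  exact hcase _ θ _ hs k hk hN ((hb.cast (red_subst ..)).atom_conv (Var.forall_two h0 h1))

theorem env_intro {h N : ℕ} {K L : Tm S X .olist} (Hs : List (XFm S X))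
    (hHs : ∀ B ∈ Hs, Der (HH P) X Θ B)
    (hd : ∀ (X' : List (Ty S.Base)) (θ : Sub S X X') (E : Tm S X' .o) (Θ' : List (XFm S X')),
      (∀ B ∈ Hs, Der (HH P) X' Θ' (B.subst θ)) → Der (HH P) X' Θ' (member E (K.subst θ)) →
      Der (HH P) X' Θ' (hyp h N (L.subst θ) E)) :
    Der (HH P) X Θ (env h N K L) := by
  refine .def_intro (Sub.cons K (Sub.cons L Sub.nil)) rfl (Var.forall_two (.refl K) (.refl L))
    (.all_intro Hs hHs fun X' θ E Θ' _ hs => .impR (.uncast (hyp_subst ..) ?_))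
  exact hd X' θ E _ (fun B hB => (hs B hB).weaken (List.subset_cons_self _ _))
    ((Der.ax (.head _)).cast (member_subst ..))

theorem env_elim {h N : ℕ} {K L : Tm S X .olist} {E : Tm S X .o}
    (hd : Der (HH P) X Θ (env h N K L)) (hE : Der (HH P) X Θ (member E K)) :
    Der (HH P) X Θ (hyp h N L E) := by
  refine Der.def_elim (.inr (.env h N)) [_] (Der.hyps_one hE) hd ?_
  rintro c rfl X' θ u d Θ' - hm hs hb
  have h0 : Tm.Conv (u .z) (K.subst θ) := hm.2.2 _ .z
  have h1 : Tm.Conv (u (.s .z)) (L.subst θ) := hm.2.2 _ (.s .z)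
  have hE : Der (HH P) X' Θ' (member (E.subst θ) (u .z)) :=
    ((hs _ (.head _)).cast (member_subst ..)).atom_conv
      (Var.forall_two (.refl (E.subst θ)) h0.symm)
  have hE' : Der (HH P) X' Θ' (hyp h N (u (.s .z)) (E.subst θ)) :=
    ((Der.all_elim (u := u) (E.subst θ) hb).imp_elim (.uncast (member_subst ..) hE)).cast
      (hyp_subst ..)
  exact .uncast (hyp_subst ..) (hE'.atom_conv (Var.forall_two h1 (.refl _)))

/-- Lowering `h` only widens the interval of permitted depths, so monotonicity of reducibility in
the depth is never needed. -/
theorem env_mono {h i N : ℕ} (hi : i ≤ h) {K L L' : Tm S X .olist}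
    (hL : Der (HH P) X Θ (sub L L')) (hd : Der (HH P) X Θ (env h N K L)) :
    Der (HH P) X Θ (env i N K L') := by
  refine env_intro [_, _] (Der.hyps_two hL hd) fun X₁ θ₁ E Θ₁ hs₁ hE => ?_
  refine hyp_elim [_] (Der.hyps_one ((hs₁ _ (.head _)).cast (sub_subst ..)))
    (env_elim ((hs₁ _ (.tail _ (.head _))).cast (env_subst ..)) hE)
    fun X₂ θ₂ Θ₂ hs₂ k hk hN hr => ?_
  exact .uncast (hyp_subst ..) (hyp_intro (hi.trans hk) hN
    (red_mono ((hs₂ _ (.head _)).cast (sub_subst ..)) hr))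

theorem env_self {h N : ℕ} (hN : h ≤ N) (K : Tm S X .olist) : Der (HH P) X Θ (env h N K K) :=
  env_intro [] (by simp) fun _ _ _ _ _ hE => hyp_intro hN le_rfl (red_of_ne (ne_of_member hE))

theorem env_cons {h N k : ℕ} (hk : h ≤ k) (hN : k ≤ N) {K L : Tm S X .olist} {F : Tm S X .o}
    (hF : Der (HH P) X Θ (red false k L F)) (hd : Der (HH P) X Θ (env h N K L)) :
    Der (HH P) X Θ (env h N (Tm.cons F K) L) := by
  refine env_intro [_, _] (Der.hyps_two hF hd) fun X₁ θ₁ E Θ₁ hs₁ hE => ?_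
  refine member_cons_elim [_, _] (Der.hyps_two ((hs₁ _ (.head _)).cast (red_subst ..))
    ((hs₁ _ (.tail _ (.head _))).cast (env_subst ..))) hE fun X₂ θ₂ Θ₂ hs₂ hE' =>
    .uncast (hyp_subst ..) ?_
  rcases hE' with hE' | hE'
  · exact hyp_intro hk hN (((hs₂ _ (.head _)).cast (red_subst ..)).atom_conv
      (Var.forall_two (.refl _) hE'.symm))
  · exact env_elim ((hs₂ _ (.tail _ (.head _))).cast (env_subst ..)) hE'

end Reducibility

/-! ### Soundness of reducibility and the three admissible principles. -/

section CutAdmissibility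

variable {X X' Γ Δ Ξ : List (Ty S.Base)} {σ τ ρ : Ty S.Base}
variable {P : List (Tm S [] .o)} {Θ : List (XFm S X)} {C : XFm S X}

/-! ### Soundness of reducibility -/

/-- A derivation of a conjunction or of a universal formula contains or yields lower derivations of
the components. -/
theorem seqh_dec (hP : ∀ F ∈ P, ∀ a : Nom S, ¬ F.Occ a) {h : ℕ} {K : Tm S X .olist}
    {F H : Tm S X .o} (Hs : List (XFm S X)) (hHs : ∀ B ∈ Hs, Der (HH P) X Θ B)
    (hd : Der (HH P) X Θ (seqh h K F)) (hF : Der (HH P) X Θ (dec F H))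
    (hcase : ∀ (X' : List (Ty S.Base)) (θ : Sub S X X') (Θ' : List (XFm S X')),
      (∀ B ∈ Hs, Der (HH P) X' Θ' (B.subst θ)) → ∀ i < h,
      Der (HH P) X' Θ' (seqh i (K.subst θ) (H.subst θ)) → Der (HH P) X' Θ' (C.subst θ)) :
    Der (HH P) X Θ C := by
  refine dec_elim (seqh h K F :: Hs) (by simpa using ⟨hd, hHs⟩) hF fun X₁ θ₁ Θ₁ _ hs₁ hF => ?_
  refine seqh_elim (dec (F.subst θ₁) (H.subst θ₁) :: Hs.map (Fm.subst θ₁)) ?_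
    ((hs₁ _ (.head _)).cast (seqh_subst ..)) fun X₂ θ₂ Θ₂ _ hs₂ hc => ?_
  · simp only [List.forall_mem_cons, List.forall_mem_map]
    exact ⟨hF.der, fun B hB => hs₁ B (.tail _ hB)⟩
  simp only [List.forall_mem_cons, List.forall_mem_map, Fm.subst_subst] at hs₂
  replace hF : DecCase ((F.subst θ₁).subst θ₂) ((H.subst θ₁).subst θ₂) := by
    rcases hF with ⟨G, hF⟩ | ⟨G, hF⟩ | ⟨τ, hτ, G, t, hF, hH⟩
    · exact .left _ (hF.subst θ₂)
    · exact .right _ (hF.subst θ₂)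
    · exact .inst τ hτ _ _ (hF.subst θ₂) (hH.subst θ₂)
  -- The last rule either matches the constructor of `F` and yields a lower derivation, or is
  -- backchaining, which would make a compound formula atomic. Disjointness of the constructors
  -- excludes the rest.
  suffices hlow : (∃ i < h, Der (HH P) X₂ Θ₂
      (seqh i ((K.subst θ₁).subst θ₂) ((H.subst θ₁).subst θ₂))) ∨
      (¬ ((F.subst θ₁).subst θ₂).NotCompound ∧
        Der (HH P) X₂ Θ₂ (atomic ((F.subst θ₁).subst θ₂))) by
    rcases hlow with ⟨i, hi, hlow⟩ | ⟨hn, hA⟩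
    · rw [Tm.subst_subst, Tm.subst_subst] at hlow
      rw [Fm.subst_subst]
      exact hcase X₂ (θ₁.comp θ₂) Θ₂ hs₂.2 i hi hlow
    · exact atomic_elim hA hn
  clear hs₂ hs₁ hcase
  generalize (F.subst θ₁).subst θ₂ = F' at *
  generalize (H.subst θ₁).subst θ₂ = H' at *
  generalize (K.subst θ₁).subst θ₂ = K' at *
  rcases hc with ⟨i, j, F₁, F₂, hi, hj, hG, h₁, h₂⟩ | ⟨i, F₁, F₂, hi, hG, h₁⟩ |
    ⟨i, τ, hτ, F₁, N, hi, hG, h₁⟩ | ⟨i, F₁, hi, hA, hM, h₁⟩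
  · left
    rcases hF with ⟨G, hF⟩ | ⟨G, hF⟩ | ⟨τ, hτ, G, t, hF, hH⟩
    · exact ⟨i, hi, h₁.atom_conv (Var.forall_two (.refl _) (hG.symm.trans hF).conj_inj.1)⟩
    · exact ⟨j, hj, h₂.atom_conv (Var.forall_two (.refl _) (hG.symm.trans hF).conj_inj.2)⟩
    · exact absurd (hG.symm.trans hF) Tm.not_conv_conj_sfall
  · exfalso
    rcases hF with ⟨G, hF⟩ | ⟨G, hF⟩ | ⟨τ, hτ, G, t, hF, hH⟩
    · exact Tm.not_conv_conj_impl (hF.symm.trans hG)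
    · exact Tm.not_conv_conj_impl (hF.symm.trans hG)
    · exact Tm.not_conv_impl_sfall (hG.symm.trans hF)
  · left
    rcases hF with ⟨G, hF⟩ | ⟨G, hF⟩ | ⟨σ, hσ, G, t, hF, hH⟩
    · exact absurd (hF.symm.trans hG) Tm.not_conv_conj_sfall
    · exact absurd (hF.symm.trans hG) Tm.not_conv_conj_sfall
    · obtain ⟨rfl, hGF⟩ := (hG.symm.trans hF).sfall_inj
      obtain ⟨n, hn, hf⟩ := exists_fresh K' F₁ N
      have hf := hf n le_rfl τ
      -- The derivation concerns a generic nominal constant; replacing it by the required witness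
      -- keeps the height `i`.
      have hd := seqh_nsub (a := (τ, n)) hP hτ.target_ne_o t (h₁ n hn)
      rw [Tm.nsub_of_not_occ _ hf.1, show (Tm.app F₁ (.nom n)).nsub (τ, n) t = .app F₁ t from
        congrArg₂ Tm.app (Tm.nsub_of_not_occ _ hf.2) (Tm.nsub_self n t)] at hd
      exact ⟨i, hi, hd.atom_conv (Var.forall_two (.refl _) ((Tm.Conv.app hGF (.refl t)).trans
        hH.symm))⟩
  · refine .inr ⟨fun hn => ?_, hA⟩
    rcases hF with ⟨G, hF⟩ | ⟨G, hF⟩ | ⟨τ, hτ, G, t, hF, hH⟩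
    · exact hn.1 _ _ hF
    · exact hn.1 _ _ hF
    · exact hn.2.2 _ _ _ hF

/-- A derivation of an implication contains a lower derivation of its premise. -/
theorem seqh_isImp {h : ℕ} {K : Tm S X .olist} {F G H : Tm S X .o} (Hs : List (XFm S X))
    (hHs : ∀ B ∈ Hs, Der (HH P) X Θ B) (hd : Der (HH P) X Θ (seqh h K F))
    (hF : Der (HH P) X Θ (isImp F G H))
    (hcase : ∀ (X' : List (Ty S.Base)) (θ : Sub S X X') (Θ' : List (XFm S X')),
      (∀ B ∈ Hs, Der (HH P) X' Θ' (B.subst θ)) → ∀ i < h,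
      Der (HH P) X' Θ' (seqh i (Tm.cons (G.subst θ) (K.subst θ)) (H.subst θ)) →
      Der (HH P) X' Θ' (C.subst θ)) :
    Der (HH P) X Θ C := by
  refine isImp_elim (seqh h K F :: Hs) (by simpa using ⟨hd, hHs⟩) hF fun X₁ θ₁ Θ₁ hs₁ hF => ?_
  refine seqh_elim (Hs.map (Fm.subst θ₁)) ?_
    ((hs₁ _ (.head _)).cast (seqh_subst ..)) fun X₂ θ₂ Θ₂ _ hs₂ hc => ?_
  · simp only [List.forall_mem_map]
    exact fun B hB => hs₁ B (.tail _ hB)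
  simp only [List.forall_mem_map, Fm.subst_subst] at hs₂
  replace hF : Tm.Conv ((F.subst θ₁).subst θ₂)
    (Tm.impl ((G.subst θ₁).subst θ₂) ((H.subst θ₁).subst θ₂)) := hF.subst θ₂
  rcases hc with ⟨i, j, F₁, F₂, hi, hj, hG, h₁, h₂⟩ | ⟨i, F₁, F₂, hi, hG, h₁⟩ |
    ⟨i, τ, hτ, F₁, N, hi, hG, h₁⟩ | ⟨i, F₁, hi, hA, hM, h₁⟩
  · exact absurd (hG.symm.trans hF) Tm.not_conv_conj_impl
  · obtain ⟨e₁, e₂⟩ := (hG.symm.trans hF).impl_inj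
    have hlow : Der (HH P) X₂ Θ₂ (seqh i (Tm.cons ((G.subst θ₁).subst θ₂)
        ((K.subst θ₁).subst θ₂)) ((H.subst θ₁).subst θ₂)) :=
      h₁.atom_conv (Var.forall_two (.app (.app (.refl _) e₁) (.refl _)) e₂)
    rw [Tm.subst_subst, Tm.subst_subst, Tm.subst_subst] at hlow
    rw [Fm.subst_subst]
    exact hcase X₂ (θ₁.comp θ₂) Θ₂ hs₂ i hi hlow
  · exact absurd (hF.symm.trans hG) Tm.not_conv_impl_sfall
  · exact atomic_elim hA fun hn => hn.2.1 _ _ hF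

/-- The three statements concern derivability of goals, reducibility of goals and use of a focused
reducible hypothesis. They are proved simultaneously by strong induction on `h`. Each passage to a
component lowers the depth by one and the height by at least one, so depths stay at or above the
height. `N` caps all depths. -/
theorem reducible_of_height (hP : ∀ F ∈ P, ∀ a : Nom S, ¬ F.Occ a) (N h : ℕ) :
    (∀ (X : List (Ty S.Base)) (Θ : List (XFm S X)) (K L : Tm S X .olist) (G : Tm S X .o),
      h ≤ N → Der (HH P) X Θ (env h N K L) → Der (HH P) X Θ (seqh h K G) →
      Der (HH P) X Θ (seq L G)) ∧
    (∀ n (X : List (Ty S.Base)) (Θ : List (XFm S X)) (K L : Tm S X .olist) (G : Tm S X .o),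
      h ≤ n → n ≤ N → Der (HH P) X Θ (env h N K L) → Der (HH P) X Θ (seqh h K G) →
      Der (HH P) X Θ (red true n L G)) ∧
    ∀ k (X : List (Ty S.Base)) (Θ : List (XFm S X)) (K L : Tm S X .olist) (F A : Tm S X .o),
      h ≤ k → k ≤ N → Der (HH P) X Θ (env h N K L) → Der (HH P) X Θ (bch h K F A) →
      Der (HH P) X Θ (red false k L F) → Der (HH P) X Θ (atomic A) →
      Der (HH P) X Θ (seq L A) := by
  induction h using Nat.strong_induction_on with
  | h h ih =>
  have hseq : ∀ (X : List (Ty S.Base)) (Θ : List (XFm S X)) (K L : Tm S X .olist) (G : Tm S X .o),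
      h ≤ N → Der (HH P) X Θ (env h N K L) → Der (HH P) X Θ (seqh h K G) →
      Der (HH P) X Θ (seq L G) := by
    intro X Θ K L G hN he hd
    refine seqh_elim [_] (Der.hyps_one he) hd fun X' θ Θ' _ hs hc => .uncast (seq_subst ..) ?_
    have he := (hs _ (.head _)).cast (env_subst ..)
    have low : ∀ i < h, Der (HH P) X' Θ' (env i N (K.subst θ) (L.subst θ)) := fun i hi =>
      env_mono hi.le (sub_refl _) he
    rcases hc with ⟨i, j, F, H, hi, hj, hG, hF, hH⟩ | ⟨i, F, H, hi, hG, hF⟩ |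
      ⟨i, τ, hτ, F, M, hi, hG, hF⟩ | ⟨i, F, hi, hA, hM, hF⟩
    · exact SeqCase.der (.conj F H hG ((ih i hi).1 _ _ _ _ _ (hi.le.trans hN) (low i hi) hF)
        ((ih j hj).1 _ _ _ _ _ (hj.le.trans hN) (low j hj) hH))
    · refine SeqCase.der (.impl F H hG ((ih i hi).1 _ _ _ _ _ (hi.le.trans hN) ?_ hF))
      -- The new assumption is in the extended target context as well, hence neutral and reducible
      -- to any depth; the largest allowed one is chosen.
      exact env_cons (hi.le.trans hN) le_rfl (red_of_ne (ne_of_member (member_here _ _)))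
        (env_mono hi.le (sub_cons_right F (sub_refl _)) he)
    · exact SeqCase.der (.sfall τ hτ F M hG fun n hn =>
        (ih i hi).1 _ _ _ _ _ (hi.le.trans hN) (low i hi) (hF n hn))
    · have wk : ∀ {A B : XFm S X'}, Der (HH P) X' Θ' B → Der (HH P) X' (A :: Θ') B := fun h =>
        h.weaken (List.subset_cons_self _ _)
      refine hM.or_elim ?_ ?_
      · refine hyp_elim [_, _, _] (Der.hyps_three (wk (low i hi)) (wk hF) (wk hA))
          (env_elim (wk he) (.ax (.head _))) fun X'' η Θ'' hs k hk hkN hr =>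
          .uncast (seq_subst ..) ?_
        exact (ih i hi).2.2 k _ _ _ _ _ _ (hi.le.trans hk) hkN
          ((hs _ (.head _)).cast (env_subst ..))
          ((hs _ (.tail _ (.head _))).cast (bch_subst ..)) hr
          ((hs _ (.tail _ (.tail _ (.head _)))).cast (atomic_subst ..))
      · exact (ih i hi).2.2 N _ _ _ _ _ _ (hi.le.trans hN) le_rfl (wk (low i hi)) (wk hF)
          (red_of_ne (ne_of_prog _ (.ax (.head _)))) (wk hA)
  refine ⟨hseq, ?_, ?_⟩
  · intro n X Θ K L G hn hN he hd
    refine red_intro (b := true) (hseq _ _ _ _ _ (hn.trans hN) he hd) [_, _] (Der.hyps_two he hd)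
      ?_ ?_
    · rintro n rfl X' θ H Θ' hs hG
      have he := (hs _ (.head _)).cast (env_subst ..)
      refine seqh_dec hP [_] (Der.hyps_one he) ((hs _ (.tail _ (.head _))).cast (seqh_subst ..)) hG
        fun X'' η Θ'' hs i hi hd => .uncast (red_subst ..) ?_
      exact (ih i hi).2.1 n _ _ _ _ _ (by omega) (by omega)
        (env_mono hi.le (sub_refl _) ((hs _ (.head _)).cast (env_subst ..))) hd
    · rintro n rfl X' θ L' F H Θ' hs hG hL hF
      have he := (hs _ (.head _)).cast (env_subst ..)
      refine seqh_isImp [_, _, _] (Der.hyps_three he hL hF)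
        ((hs _ (.tail _ (.head _))).cast (seqh_subst ..)) hG
        fun X'' η Θ'' hs i hi hd => .uncast (red_subst ..) ?_
      refine (ih i hi).2.1 n _ _ _ _ _ (by omega) (by omega) (env_cons (k := n) (by omega)
        (by omega) ((hs _ (.tail _ (.tail _ (.head _)))).cast (red_subst ..)) ?_) hd
      exact env_mono hi.le ((hs _ (.tail _ (.head _))).cast (sub_subst ..))
        ((hs _ (.head _)).cast (env_subst ..))
  · intro k X Θ K L F A hk hN he hd hr hA
    refine bch_elim [_, _, _] (Der.hyps_three he hr hA) hd fun X' θ Θ' _ hs hc =>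
      .uncast (seq_subst ..) ?_
    have he := (hs _ (.head _)).cast (env_subst ..)
    have hr := (hs _ (.tail _ (.head _))).cast (red_subst ..)
    have hA := (hs _ (.tail _ (.tail _ (.head _)))).cast (atomic_subst ..)
    have low : ∀ i < h, Der (HH P) X' Θ' (env i N (K.subst θ) (L.subst θ)) := fun i hi =>
      env_mono hi.le (sub_refl _) he
    rcases hc with hF | ⟨i, H, hi, hF, hH⟩ | ⟨i, j, G, H, hi, hj, hF, hG, hH⟩
    · exact (redBase_conv (red_base hr) (.refl _) hF).imp_elim hA
    · obtain ⟨k, rfl⟩ : ∃ l, k = l + 1 := ⟨k - 1, by omega⟩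
      exact (ih i hi).2.2 k _ _ _ _ _ _ (by omega) (by omega) (low i hi) hH (red_dec hr hF) hA
    · obtain ⟨k, rfl⟩ : ∃ l, k = l + 1 := ⟨k - 1, by omega⟩
      exact (ih j hj).2.2 k _ _ _ _ _ _ (by omega) (by omega) (low j hj) hH
        (red_imp hr (isImp_intro hF) (sub_refl _)
          ((ih i hi).2.1 k _ _ _ _ _ (by omega) (by omega) (low i hi) hG)) hA

/-! ### Cut, instantiation and monotonicity -/

/-- With depths capped at `max i j`, the derivation of `F` makes `F` a reducible hypothesis over
`K`. Every member of `K` is one by `env_self`, so the derivation from `Tm.cons F K` is sound over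
`K` alone. -/
theorem seq_cut (hP : ∀ F ∈ P, ∀ a : Nom S, ¬ F.Occ a) {K : Tm S X .olist} {F G : Tm S X .o}
    (hF : Der (HH P) X Θ (seq K F)) (hG : Der (HH P) X Θ (seq (Tm.cons F K) G)) :
    Der (HH P) X Θ (seq K G) := by
  refine seqAny_elim [_] (Der.hyps_one (seqAny_of_seq hG)) (seqAny_of_seq hF)
    fun X₁ θ₁ Θ₁ _ hs₁ i hi => .uncast (seq_subst ..) ?_
  refine seqAny_elim [_] (Der.hyps_one hi) ((hs₁ _ (.head _)).cast (seqAny_subst ..))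
    fun X₂ θ₂ Θ₂ _ hs₂ j hj => .uncast (seq_subst ..) ?_
  have hi := (hs₂ _ (.head _)).cast (seqh_subst ..)
  have hF := (reducible_of_height hP (max i j) i).2.1 _ _ _ _ _ _ (le_max_left i j) le_rfl
    (env_self (le_max_left i j) _) hi
  exact (reducible_of_height hP (max i j) j).1 _ _ _ _ _ (le_max_right i j)
    (env_cons (le_max_right i j) le_rfl (red_false_of_true hF) (env_self (le_max_right i j) _)) hj

theorem seq_inst (hP : ∀ F ∈ P, ∀ a : Nom S, ¬ F.Occ a) (hτ : τ.target ≠ .o)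
    {K : Tm S X (.arr τ .olist)} {G : Tm S X (.arr τ .o)} {n : ℕ} (hK : ¬ K.Occ (τ, n))
    (hG : ¬ G.Occ (τ, n)) (t : Tm S X τ)
    (hd : Der (HH P) X Θ (seq (.app K (.nom n)) (.app G (.nom n)))) :
    Der (HH P) X Θ (seq (.app K t) (.app G t)) := by
  refine seqAny_elim [] (by simp) (seqAny_of_seq hd) fun X' θ Θ' ha _ i hi =>
    .uncast (seq_subst ..) (seq_of_seqh (h := i) ?_)
  have hθ : ¬ Sub.Occ (τ, n) θ := fun h => ha _ h ⟨_, .z, .inr rfl⟩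
  have key : ∀ {σ : Ty S.Base} {H : Tm S X (.arr τ σ)}, ¬ H.Occ (τ, n) →
      ((Tm.app H (.nom n)).subst θ).nsub (τ, n) (t.subst θ) = (Tm.app H t).subst θ := fun hH =>
    congrArg₂ Tm.app (Tm.nsub_of_not_occ _ fun h => (Tm.occ_subst _ _ h).elim hH hθ)
      (Tm.nsub_self n _)
  have hd := seqh_nsub (a := (τ, n)) hP hτ (t.subst θ) hi
  rwa [key hK, key hG] at hd

theorem provable_cutFormula (hP : ∀ F ∈ P, ∀ a : Nom S, ¬ F.Occ a) :
    Provable (HH P) (cutFormula (auxLang S)) := by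
  refine .uncast (Fm.subst_id _).symm ?_
  refine Der.all_intro [] (by simp) fun X₁ θ₁ K Θ₁ _ _ => ?_
  refine Der.all_intro [] (by simp) fun X₂ θ₂ F Θ₂ _ _ => ?_
  refine Der.all_intro [] (by simp) fun X₃ θ₃ G Θ₃ _ _ => ?_
  refine .impR (.impR (.uncast (seq_subst ..) ?_))
  exact seq_cut hP ((Der.ax (.tail _ (.head _))).cast (seq_subst ..))
    ((Der.ax (.head _)).cast (seq_subst ..))

theorem provable_instFormula (hP : ∀ F ∈ P, ∀ a : Nom S, ¬ F.Occ a) (hτ : τ.target ≠ .o) :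
    Provable (HH P) (instFormula (auxLang S) τ) := by
  refine .uncast (Fm.subst_id _).symm ?_
  refine Der.all_intro [] (by simp) fun X₁ θ₁ K Θ₁ _ _ => ?_
  refine Der.all_intro [] (by simp) fun X₂ θ₂ G Θ₂ _ _ => ?_
  obtain ⟨M, hM⟩ := exists_bound (Fm.finite_occ (Fm.subst (Sub.lift (σ := τ)
    (Sub.cons G (Sub.comp (Sub.cons K (Sub.comp Sub.id θ₁)) θ₂)))
    (.imp (seq (.app v2 v0) (.app v1 v0)) (.all τ (seq (.app v3 v0) (.app v2 v0))) :
      XFm S [τ, .arr τ .o, .arr τ .olist])))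
  -- The index must be fresh for the whole formula under the nabla, and for the two abstractions
  -- separately, as `seq_inst` requires.
  obtain ⟨n, hn, hf⟩ := exists_fresh (K.subst θ₂) G M
  have hf := hf n le_rfl τ
  refine Der.nab_intro (n := n) (hM τ n hn) (.impR ?_)
  refine Der.all_intro [_] (Der.hyps_one (.ax (.head _))) fun X₃ θ₃ t Θ₃ hp hs =>
    .uncast (seq_subst ..) ?_
  have hocc : ∀ {σ : Ty S.Base} {H : Tm S X₂ σ}, ¬ H.Occ (τ, n) → ¬ (H.subst θ₃).Occ (τ, n) :=
    fun hH h => (Tm.occ_subst _ _ h).elim hH (hp _)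
  have hd := (hs _ (.head _)).cast ((congrArg _ (seq_subst ..)).trans (seq_subst ..))
  exact seq_inst hP hτ (hocc hf.1) (hocc hf.2) t hd

theorem provable_monoFormula : Provable (HH P) (monoFormula (auxLang S)) := by
  refine .uncast (Fm.subst_id _).symm ?_
  refine Der.all_intro [] (by simp) fun X₁ θ₁ K Θ₁ _ _ => ?_
  refine Der.all_intro [] (by simp) fun X₂ θ₂ K' Θ₂ _ _ => ?_
  refine Der.all_intro [] (by simp) fun X₃ θ₃ G Θ₃ _ _ => ?_
  refine .impR (.impR (.uncast (seq_subst ..) ?_))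
  refine seq_mono (sub_intro [_] (Der.hyps_one (.ax (.head _))) fun X₄ θ₄ E Θ₄ hs hE => ?_)
    ((Der.ax (.tail _ (.head _))).cast (seq_subst ..))
  have h := Der.all_elim E ((hs _ (.head _)).cast (Fm.subst_subst ..))
  exact (h.imp_elim (.uncast (member_subst ..) hE)).cast (member_subst ..)

end CutAdmissibility

end TwoLevel

theorem theorem2 (S : TwoLevel.HHSig) :
    ∃ E : TwoLevel.AuxDefn S, ∀ Θ : List (TwoLevel.Tm S [] TwoLevel.Ty.o),
      (∀ F ∈ Θ, ∀ a : TwoLevel.Nom S, ¬ TwoLevel.Tm.Occ a F) →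
      (TwoLevel.encoding Θ E).WellFormed ∧
      TwoLevel.Provable (TwoLevel.encoding Θ E) (TwoLevel.cutFormula E.lang) ∧
      (∀ τ : TwoLevel.Ty S.Base, τ.IsSpec → τ.target ≠ TwoLevel.Ty.o →
        TwoLevel.Provable (TwoLevel.encoding Θ E) (TwoLevel.instFormula E.lang τ)) ∧
      TwoLevel.Provable (TwoLevel.encoding Θ E) (TwoLevel.monoFormula E.lang) :=
  ⟨TwoLevel.auxDefn S, fun _ hΘ => ⟨TwoLevel.encoding_wellFormed hΘ,
    TwoLevel.provable_cutFormula hΘ, fun _ _ hτ => TwoLevel.provable_instFormula hΘ hτ,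
    TwoLevel.provable_monoFormula⟩⟩
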